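/- Let $(M,e)$ be a complete, connected, smooth Riemannian manifold without boundary of dimension $n\ge 1$ which is Euclidean at infinity: there is a compact set $K\subset M$ such that $M\setminus K$ is a disjoint union of finitely many (possibly zero) open sets $U_1,\dots,U_N$, each of which, with the metric $e$, is isometric to the exterior $\{x\in\mathbb{R}^n : |x|>R_i\}$ of a ball, $R_i>0$, with the Euclidean metric. Let $D$ be the Levi-Civita connection of $e$, $\mu_e$ the Riemannian volume measure, fix a point $o\in M$, and put $\sigma(x)=(1+d_e(x,o)^2)^{1/2}$. Let $E=\bigoplus_{j}T^{r_j}_{k_j}M$ be a finite direct sum of tensor bundles, with the pointwise norm $|\cdot|_e$ induced by $e$. For $p\geq 1$, $\delta,\beta\in\mathbb{R}$ and an integer $s\ge 0$ let $W^p_{s,\delta}$ be the space of sections $u$ of $E$ (up to equality almost everywhere) with generalized covariant derivatives of order up to $s$ and $$\|u\|_{W^p_{s,\delta}}=\Big(\sum_{0\le m\le s}\int_M |D^m u|_e^p\,\sigma^{p(m+\delta)}\,d\mu_e\Big)^{1/p}<\infty ,$$ and let $C^s_\beta$ be the space of sections $u$ of $E$ of class $C^s$ with $$\|u\|_{C^s_\beta}=\sum_{0\le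 m\le s}\ \sup_M |D^m u|_e\,\sigma^{\beta+m}<\infty .$$ Let $n<p<\infty$ and $\delta'<\delta$. Then: 1. the embedding $W^p_{1,\delta}\hookrightarrow C^0_{\delta'+\frac np}$ is compact; 2. the embedding $W^p_{2,\delta}\hookrightarrow C^1_{\delta'+\frac np}$ is compact. Here an embedding of such a Sobolev space $X$ into such a space $Y$ being compact means that each class in $X$ has exactly one representative in $Y$, that the resulting linear map $X\to Y$ is bounded, and that the image of every bounded sequence of $X$ has a subsequence which converges in $Y$. -/

import Mathlib

open Set Filter Topology MeasureTheory Manifold Bundle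
open scoped ENNReal NNReal ContDiff

noncomputable section

namespace EucInf

/-- Tensors of type `(r, k)` on a real vector space `V` (`r` contravariant and `k` covariant
indices): multilinear functions of `r` covectors and `k` vectors. -/
abbrev TensorAt (r k : ℕ) (V : Type*) [AddCommGroup V] [Module ℝ V] : Type _ :=
  MultilinearMap ℝ (fun _ : Fin r => Module.Dual ℝ V) (MultilinearMap ℝ (fun _ : Fin k => V) ℝ)

section Norm

variable {V : Type*} [NormedAddCommGroup V] [InnerProductSpace ℝ V] [FiniteDimensional ℝ V]

/-- The squared norm of a tensor on a Euclidean space: the sum of the squares of its components in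
an orthonormal basis (it does not depend on the basis). -/
def tensorNormSq {r k : ℕ} (T : TensorAt r k V) : ℝ :=
  ∑ I : Fin r → Fin (Module.finrank ℝ V), ∑ J : Fin k → Fin (Module.finrank ℝ V),
    (T (fun a => (innerₗ V (stdOrthonormalBasis ℝ V (I a)) : Module.Dual ℝ V))
      (fun b => stdOrthonormalBasis ℝ V (J b))) ^ 2

end Norm

variable {n : ℕ}

/-- The model space `ℝⁿ`. -/
abbrev Model (n : ℕ) : Type := EuclideanSpace ℝ (Fin n)

/-- The `i`-th standard basis vector of `ℝⁿ`. -/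
abbrev stdVec (i : Fin n) : Model n := EuclideanSpace.single i (1 : ℝ)

section Charts

variable {M : Type*} [TopologicalSpace M] [ChartedSpace (Model n) M]

/-- The coordinate vector field `∂_i` of the chart `φ`, at the point with coordinates `z`. -/
def coordVec (φ : OpenPartialHomeomorph M (Model n)) (i : Fin n) (z : Model n) :
    TangentSpace (𝓡 n) (φ.symm z) :=
  mfderiv 𝓘(ℝ, Model n) (𝓡 n) φ.symm z (stdVec i)

/-- The coordinate covector field `dx^i` of the chart `φ`, at the point with coordinates `z`. -/
def coordCovec (φ : OpenPartialHomeomorph M (Model n)) (i : Fin n) (z : Model n) :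
    Module.Dual ℝ (TangentSpace (𝓡 n) (φ.symm z)) :=
  (EuclideanSpace.proj i : Model n →L[ℝ] ℝ).toLinearMap ∘ₗ
    (mfderiv (𝓡 n) 𝓘(ℝ, Model n) φ (φ.symm z) :
      TangentSpace (𝓡 n) (φ.symm z) →L[ℝ] Model n).toLinearMap

/-- Sections (not assumed to have any regularity) of the bundle `⨁ j, T^{r j}_{k j} M`. -/
abbrev TensorSection {ι : Type*} (M : Type*) [TopologicalSpace M] [ChartedSpace (Model n) M]
    (r k : ι → ℕ) : Type _ :=
  ∀ x : M, ∀ j : ι, TensorAt (r j) (k j) (TangentSpace (𝓡 n) x)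

/-- The component `(u_j)^I_J` of a section in the chart `φ`, as a function of the coordinates.
It is meaningful on `φ.target`. -/
def comp {ι : Type*} {r k : ι → ℕ} (φ : OpenPartialHomeomorph M (Model n))
    (u : TensorSection (n := n) M r k) (j : ι) (I : Fin (r j) → Fin n) (J : Fin (k j) → Fin n)
    (z : Model n) : ℝ :=
  u (φ.symm z) j (fun a => coordCovec φ (I a) z) (fun b => coordVec φ (J b) z)

/-- Local integrability of a section: all its components in all charts are locally integrable
(in particular measurable). -/
def IsLocInt {ι : Type*} {r k : ι → ℕ} (u : TensorSection (n := n) M r k) : Prop :=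
  ∀ φ ∈ IsManifold.maximalAtlas (𝓡 n) ∞ M, ∀ (j : ι) (I : Fin (r j) → Fin n)
    (J : Fin (k j) → Fin n), LocallyIntegrableOn (comp φ u j I J) φ.target volume

/-- Continuity of a section: all its components in all charts are continuous. -/
def IsCont {ι : Type*} {r k : ι → ℕ} (u : TensorSection (n := n) M r k) : Prop :=
  ∀ φ ∈ IsManifold.maximalAtlas (𝓡 n) ∞ M, ∀ (j : ι) (I : Fin (r j) → Fin n)
    (J : Fin (k j) → Fin n), ContinuousOn (comp φ u j I J) φ.target

variable [RiemannianBundle (fun x : M => TangentSpace (𝓡 n) x)]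

/-- The coefficients `e_{ij}` of the Riemannian metric in the chart `φ`. -/
def metricCoeff (φ : OpenPartialHomeomorph M (Model n)) (z : Model n) :
    Matrix (Fin n) (Fin n) ℝ :=
  Matrix.of fun i j => inner ℝ (coordVec φ i z) (coordVec φ j z)

/-- The Christoffel symbols
`Γ^m_{ij} = ½ e^{mh} (∂_i e_{jh} + ∂_j e_{ih} - ∂_h e_{ij})` of the Levi-Civita connection in the
chart `φ`. -/
def christoffel (φ : OpenPartialHomeomorph M (Model n)) (m i j : Fin n) (z : Model n) : ℝ :=
  (1 / 2) * ∑ h : Fin n, (metricCoeff φ z)⁻¹ m h *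
    (fderiv ℝ (fun y => metricCoeff φ y j h) z (stdVec i)
      + fderiv ℝ (fun y => metricCoeff φ y i h) z (stdVec j)
      - fderiv ℝ (fun y => metricCoeff φ y i j) z (stdVec h))

/-- The zeroth order part of the covariant derivative `D_l` of a section, in the chart `φ`:
`∑_a Γ^{I_a}_{lm} u^{I[a ↦ m]}_J - ∑_b Γ^m_{l J_b} u^I_{J[b ↦ m]}`. -/
def connectionTerm {ι : Type*} {r k : ι → ℕ} (φ : OpenPartialHomeomorph M (Model n))
    (u : TensorSection (n := n) M r k) (j : ι) (I : Fin (r j) → Fin n) (J : Fin (k j) → Fin n)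
    (l : Fin n) (z : Model n) : ℝ :=
  (∑ a : Fin (r j), ∑ m : Fin n, christoffel φ (I a) l m z *
      comp φ u j (Function.update I a m) J z)
    - ∑ b : Fin (k j), ∑ m : Fin n, christoffel φ m l (J b) z *
      comp φ u j I (Function.update J b m) z

/-- `v = D u` in the generalized sense. The differentiation index is the first covariant index of
`v`; in every chart
`v^I_{lJ} - connectionTerm` is the distributional derivative `∂_l u^I_J`. -/
def IsWeakCovDeriv {ι : Type*} {r k : ι → ℕ} (u : TensorSection (n := n) M r k)
    (v : TensorSection (n := n) M r (fun j => k j + 1)) : Prop :=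
  ∀ φ ∈ IsManifold.maximalAtlas (𝓡 n) ∞ M, ∀ (j : ι) (I : Fin (r j) → Fin n)
    (J : Fin (k j) → Fin n) (l : Fin n) (ψ : Model n → ℝ),
    ContDiff ℝ ∞ ψ → HasCompactSupport ψ → tsupport ψ ⊆ φ.target →
    ∫ z in φ.target, comp φ u j I J z * fderiv ℝ ψ z (stdVec l) =
      - ∫ z in φ.target,
          (comp φ v j I (Fin.cons l J) z - connectionTerm φ u j I J l z) * ψ z

/-- `v = D u` in the classical sense, with `u` differentiable everywhere. -/
def IsCovDeriv {ι : Type*} {r k : ι → ℕ} (u : TensorSection (n := n) M r k)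
    (v : TensorSection (n := n) M r (fun j => k j + 1)) : Prop :=
  ∀ φ ∈ IsManifold.maximalAtlas (𝓡 n) ∞ M, ∀ (j : ι) (I : Fin (r j) → Fin n)
    (J : Fin (k j) → Fin n), ∀ z ∈ φ.target,
    DifferentiableAt ℝ (comp φ u j I J) z ∧
    ∀ l : Fin n, comp φ v j I (Fin.cons l J) z =
      fderiv ℝ (comp φ u j I J) z (stdVec l) + connectionTerm φ u j I J l z

/-- `D 0, …, D s` are the generalized covariant derivatives of `u` of orders `0, …, s`. -/
def IsWeakJet {ι : Type*} {r k : ι → ℕ} (s : ℕ) (u : TensorSection (n := n) M r k)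
    (D : ∀ m : ℕ, TensorSection (n := n) M r (fun j => k j + m)) : Prop :=
  D 0 = u ∧ (∀ m ≤ s, IsLocInt (D m)) ∧ ∀ m < s, IsWeakCovDeriv (D m) (D (m + 1))

/-- `u` is of class `C^s`, and `D 0, …, D s` are its covariant derivatives of orders
`0, …, s`. -/
def IsClassicalJet {ι : Type*} {r k : ι → ℕ} (s : ℕ) (u : TensorSection (n := n) M r k)
    (D : ∀ m : ℕ, TensorSection (n := n) M r (fun j => k j + m)) : Prop :=
  D 0 = u ∧ (∀ m ≤ s, IsCont (D m)) ∧ ∀ m < s, IsCovDeriv (D m) (D (m + 1))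

/-- The pointwise norm `|u|_e` of a section of `⨁ j, T^{r j}_{k j} M`. -/
def pointNorm {ι : Type*} [Fintype ι] {r k : ι → ℕ} (u : TensorSection (n := n) M r k)
    (x : M) : ℝ :=
  haveI : FiniteDimensional ℝ (TangentSpace (𝓡 n) x) :=
    inferInstanceAs (FiniteDimensional ℝ (Model n))
  √(∑ j : ι, tensorNormSq (V := TangentSpace (𝓡 n) x) (u x j))

variable (n M) in
/-- The Riemannian volume measure. In a chart `φ` it has the density `√(det e_{ij})` with respect to
Lebesgue measure, so that it is the least measure which dominates, for every chart `φ`, the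
measure with this density carried over to `φ.source` (and extended by zero). -/
def riemVolume [MeasurableSpace M] : Measure M :=
  ⨆ φ : IsManifold.maximalAtlas (𝓡 n) ∞ M,
    Measure.map φ.1.symm ((volume.restrict φ.1.target).withDensity
      fun z => ENNReal.ofReal √((metricCoeff φ.1 z).det))

variable (n M) in
/-- The Riemannian manifold `M` is Euclidean at infinity: outside a compact set it is the disjoint
union of finitely many open sets, the ends, each of which is isometric, by a smooth chart, to the
exterior of a ball of `ℝⁿ` with the Euclidean metric. There may be no ends. -/
def IsEuclideanAtInfinity : Prop :=
  ∃ (K : Set M) (N : ℕ) (R : Fin N → ℝ) (Φ : Fin N → OpenPartialHomeomorph M (Model n)),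
    IsCompact K ∧ Kᶜ = ⋃ i, (Φ i).source ∧
    (Pairwise fun i i' => Disjoint (Φ i).source (Φ i').source) ∧
    ∀ i, 0 < R i ∧ Φ i ∈ IsManifold.maximalAtlas (𝓡 n) ∞ M ∧
      (Φ i).target = (Metric.closedBall 0 (R i))ᶜ ∧
      ∀ z ∈ (Φ i).target, metricCoeff (Φ i) z = 1

end Charts

section Spaces

/-- The weight `σ(x) = (1 + d(x, o)²)^{1/2}`. -/
def weight {M : Type*} [MetricSpace M] (o x : M) : ℝ := √(1 + dist x o ^ 2)

variable {M : Type*} [MetricSpace M] [ChartedSpace (Model n) M]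
  [RiemannianBundle (fun x : M => TangentSpace (𝓡 n) x)]
  {ι : Type*} [Fintype ι] {r k : ι → ℕ}

/-- The norm of the weighted Sobolev space `W^p_{s,δ}`,
`(∑_{m ≤ s} ∫ |D^m u|^p σ^{p (m + δ)})^{1/p}`, where `D^m u` are the generalized covariant
derivatives, which are unique up to null sets; the norm is `∞` if they do not exist. The space
consists of the sections of finite norm, up to equality almost everywhere. -/
def sobolevNorm [MeasurableSpace M] (o : M) (p : ℝ) (s : ℕ) (δ : ℝ)
    (u : TensorSection (n := n) M r k) : ℝ≥0∞ :=
  ⨅ (D : ∀ m : ℕ, TensorSection (n := n) M r (fun j => k j + m)) (_ : IsWeakJet s u D),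
    (∑ m ∈ Finset.range (s + 1), ∫⁻ x, ENNReal.ofReal
      (pointNorm (D m) x ^ p * weight o x ^ (p * (m + δ))) ∂(riemVolume n M)) ^ (1 / p)

/-- The norm of the weighted space `C^s_β`, `∑_{m ≤ s} sup |D^m u| σ^{β + m}`, where `D^m u` are
the (unique) classical covariant derivatives; the norm is `∞` if `u` is not of class `C^s`. The
space consists of the sections of finite norm. -/
def weightedCNorm (o : M) (s : ℕ) (β : ℝ) (u : TensorSection (n := n) M r k) : ℝ≥0∞ :=
  ⨅ (D : ∀ m : ℕ, TensorSection (n := n) M r (fun j => k j + m)) (_ : IsClassicalJet s u D),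
    ∑ m ∈ Finset.range (s + 1), ⨆ x : M,
      ENNReal.ofReal (pointNorm (D m) x * weight o x ^ (β + m))

/-- Compactness of the embedding `X ↪ Y`, where `X` is the space of the sections, up to equality
almost everywhere, whose norm `NX` is finite, and `Y` is the space of the sections whose norm `NY`
is finite: every class in `X` has exactly one representative in `Y`, the resulting map is
bounded, and it maps every bounded sequence to a sequence with a subsequence which converges
in `Y`. -/
def IsCompactEmbedding [MeasurableSpace M]
    (NX NY : TensorSection (n := n) M r k → ℝ≥0∞) : Prop :=
  (∀ u, NX u < ⊤ → ∃! v, NY v < ⊤ ∧ ∀ᵐ x ∂(riemVolume n M), u x = v x) ∧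
  (∃ C : ℝ≥0, ∀ u v, NX u < ⊤ → NY v < ⊤ → (∀ᵐ x ∂(riemVolume n M), u x = v x) →
    NY v ≤ C * NX u) ∧
  ∀ (B : ℝ≥0) (u v : ℕ → TensorSection (n := n) M r k),
    (∀ i, NX (u i) ≤ B) → (∀ i, NY (v i) < ⊤) →
    (∀ i, ∀ᵐ x ∂(riemVolume n M), u i x = v i x) →
    ∃ (w : TensorSection (n := n) M r k) (θ : ℕ → ℕ), NY w < ⊤ ∧ StrictMono θ ∧
      Tendsto (fun i => NY (v (θ i) - w)) atTop (𝓝 0)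

end Spaces

end EucInf

end

/-! Everything is done at the scale of the weight. Around every point x there is a chart ball whose
radius T is comparable with σ(x) and in which the coordinate frame, the volume density, the scaled
Christoffel symbols T·Γ and the oscillation of σ are controlled by one constant Λ, the same for the
whole manifold (`GoodBall`, `IsEnds.exists_goodBall`). In an end this is a Euclidean ball whose
radius is a fixed fraction of σ. What remains is compact by completeness (`IsEnds.isCompact_core`),
and there ordinary charts serve.

On such a ball σ is constant up to a factor. Hence a component f of u satisfies ‖f‖_p ≲ σ(x)^(-δ) N.
Since ∂f is a component of Du corrected by Γ·u and |Γ| ≲ 1/T, also ‖∂f‖_p ≲ σ(x)^(-δ) N / T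
(`exists_eLpNorm_le`). Morrey's inequality for p > n, |f(x)| ≲ T^(-n/p) (‖f‖_p + T ‖∂f‖_p), then
produces a continuous representative with |u| ≲ N σ^(-(δ + n/p)), together with a Hölder modulus
that depends on u only through N (`exists_comp_bounds`, `exists_pointNorm_le`).

Morrey's inequality (`exists_morrey`) comes from mollification. The derivative of ∫ f η_t in the
radius t is a pairing of the weak gradient with the kernel yη at the same scale, without a factor
1/t. By Hölder it is at most a constant times t^(-n/p), which is integrable at 0 exactly when p > n;
so the mollifications converge with a rate.

Compactness follows from equicontinuity and the strict loss of weight. A bounded sequence converges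
along an ultrafilter at every point, and locally uniformly by equicontinuity
(`IsEquicont.exists_limit`). Off a large compact set the bound with exponent δ + n/p, measured with
exponent δ' + n/p, is a negative power of σ and so is uniformly small
(`TendstoLocUnif.tendsto_iSup`). The norms therefore tend to 0 along the ultrafilter, hence along a
subsequence.

For two derivatives the same is applied to u with weight δ and to Du with weight 1 + δ. A continuous
function with continuous weak gradient is differentiable (`HasWeakGrad.hasFDerivAt`), so the
representative of Du is the classical derivative of that of u, and locally uniform convergence of
both passes this relation to the limit (`IsCovDeriv.of_tendstoLocUnif`). -/

noncomputable section

namespace EucInf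

/-! ### Weak gradients in ℝⁿ and the derivatives of mollifications -/

section WeakGradient

variable {n : ℕ}

/-- `g` is the distributional gradient of the locally integrable function `f` on `U`. -/
structure HasWeakGrad (U : Set (Model n)) (f : Model n → ℝ) (g : Fin n → Model n → ℝ) : Prop where
  locInt : LocallyIntegrableOn f U volume
  locInt_grad : ∀ l, LocallyIntegrableOn (g l) U volume
  weak : ∀ (l : Fin n) (ψ : Model n → ℝ), ContDiff ℝ ∞ ψ → HasCompactSupport ψ → tsupport ψ ⊆ U →
    ∫ z in U, f z * fderiv ℝ ψ z (stdVec l) = - ∫ z in U, g l z * ψ z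

theorem apply_eq_sum_stdVec (L : Model n →L[ℝ] ℝ) (w : Model n) :
    L w = ∑ l, w l * L (stdVec l) := by
  conv_lhs => rw [← (EuclideanSpace.basisFun (Fin n) ℝ).sum_repr w, map_sum]
  simp

/-- The function `ζ` moved to the ball of centre `x` and radius `t`, with its integral kept. -/
def rescale (t : ℝ) (x : Model n) (ζ : Model n → ℝ) (z : Model n) : ℝ :=
  (t ^ n)⁻¹ * ζ (t⁻¹ • (z - x))

theorem rescale_contDiff {t : ℝ} {x : Model n} {ζ : Model n → ℝ} (hζ : ContDiff ℝ ∞ ζ) :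
    ContDiff ℝ ∞ (rescale t x ζ) := by
  unfold rescale
  fun_prop

theorem rescale_eq_zero {t : ℝ} (ht : 0 < t) {x : Model n} {ζ : Model n → ℝ}
    (hζ : tsupport ζ ⊆ Metric.closedBall 0 1) {z : Model n} (hz : z ∉ Metric.closedBall x t) :
    rescale t x ζ z = 0 := by
  have : t⁻¹ • (z - x) ∉ tsupport ζ := by
    intro h
    apply hz
    have := hζ h
    rw [mem_closedBall_zero_iff, norm_smul, norm_inv, Real.norm_of_nonneg ht.le] at this
    rw [Metric.mem_closedBall, dist_eq_norm]
    rwa [inv_mul_le_iff₀ ht, mul_one] at this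
  rw [rescale, image_eq_zero_of_notMem_tsupport this, mul_zero]

theorem tsupport_rescale_subset {t : ℝ} (ht : 0 < t) {x : Model n} {ζ : Model n → ℝ}
    (hζ : tsupport ζ ⊆ Metric.closedBall 0 1) :
    tsupport (rescale t x ζ) ⊆ Metric.closedBall x t := by
  refine closure_minimal (fun z hz => ?_) Metric.isClosed_closedBall
  by_contra h
  exact hz (rescale_eq_zero ht hζ h)

theorem fderiv_rescale {t : ℝ} {x : Model n} {ζ : Model n → ℝ} (hζ : Differentiable ℝ ζ)
    (z v : Model n) :
    fderiv ℝ (rescale t x ζ) z v = (t ^ n)⁻¹ * (t⁻¹ * fderiv ℝ ζ (t⁻¹ • (z - x)) v) := by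
  have h1 : HasFDerivAt (fun z : Model n => t⁻¹ • (z - x)) (t⁻¹ • ContinuousLinearMap.id ℝ _) z :=
    ((hasFDerivAt_id z).sub_const x).const_smul t⁻¹
  have h2 := ((hζ (t⁻¹ • (z - x))).hasFDerivAt.comp z h1).const_mul ((t ^ n)⁻¹)
  have h3 : HasFDerivAt (rescale t x ζ) _ z := h2
  rw [h3.fderiv]
  simp

/-- If the parameter derivative of the kernel is minus the divergence of a test field `V`, the
definition of the weak gradient moves that divergence onto `g`, and no derivative of the kernel is
left. Dilations and translations of a mollifier are both of this form. -/
theorem HasWeakGrad.hasDerivAt_integral {U : Set (Model n)} {f : Model n → ℝ}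
    {g : Fin n → Model n → ℝ} (h : HasWeakGrad U f g) {B : Set (Model n)}
    (hB : IsCompact B) (hBU : B ⊆ U) {S : Set ℝ} (hS : IsOpen S) {s₀ : ℝ} (hs₀ : s₀ ∈ S)
    {k k' : ℝ → Model n → ℝ} {V : Fin n → Model n → ℝ} {A : ℝ}
    (hk : ∀ s ∈ S, Continuous (k s)) (hkB : ∀ s ∈ S, ∀ z ∉ B, k s z = 0)
    (hkd : ∀ s ∈ S, ∀ z, HasDerivAt (fun s => k s z) (k' s z) s)
    (hkA : ∀ s ∈ S, ∀ z, |k' s z| ≤ A)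
    (hV : ∀ l, ContDiff ℝ ∞ (V l)) (hVB : ∀ l, tsupport (V l) ⊆ B)
    (hkV : ∀ z, k' s₀ z = - ∑ l, fderiv ℝ (V l) z (stdVec l)) :
    HasDerivAt (fun s => ∫ z in U, f z * k s z) (∑ l, ∫ z in U, g l z * V l z) s₀ := by
  have hfB : IntegrableOn f B := h.locInt.integrableOn_compact_subset hBU hB
  have hfm : AEStronglyMeasurable f (volume.restrict U) := h.locInt.aestronglyMeasurable
  have hcont : ∀ l, Continuous fun z => fderiv ℝ (V l) z (stdVec l) := fun l =>
    ((hV l).continuous_fderiv (by simp)).clm_apply continuous_const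
  have hVc : ∀ l, HasCompactSupport (V l) := fun l => hB.of_isClosed_subset
    (isClosed_tsupport _) (hVB l)
  have hdB : ∀ l, ∀ z ∉ B, fderiv ℝ (V l) z = 0 := fun l z hz =>
    image_eq_zero_of_notMem_tsupport fun h' => hz (hVB l (tsupport_fderiv_subset ℝ h'))
  have hInt : ∀ {u : Model n → ℝ}, (∀ z ∉ B, u z = 0) → Continuous u →
      Integrable (fun z => f z * u z) (volume.restrict U) := by
    intro u hu huc
    have : IntegrableOn (fun z => f z * u z) B :=
      hfB.mul_continuousOn huc.continuousOn hB
    refine (IntegrableOn.integrable_of_forall_notMem_eq_zero this fun z hz => ?_).integrableOn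
    simp [hu z hz]
  have hk0 : ∀ s ∈ S, ∀ z ∉ B, k' s z = 0 := by
    intro s hs z hz
    have h1 : (fun s => k s z) =ᶠ[𝓝 s] fun _ => 0 := by
      filter_upwards [hS.mem_nhds hs] with s' hs' using hkB s' hs' z hz
    exact ((hkd s hs z).congr_of_eventuallyEq h1.symm).unique (hasDerivAt_const s 0)
  have key := (hasDerivAt_integral_of_dominated_loc_of_deriv_le (𝕜 := ℝ)
    (μ := volume.restrict U) (F := fun s z => f z * k s z) (F' := fun s z => f z * k' s z)
    (bound := B.indicator fun z => ‖f z‖ * A) (x₀ := s₀) (hS.mem_nhds hs₀) ?_ ?_ ?_ ?_ ?_ ?_).2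
  · refine key.congr_deriv ?_
    have : ∀ z, f z * k' s₀ z = ∑ l, - (f z * fderiv ℝ (V l) z (stdVec l)) := by
      intro z
      rw [hkV, Finset.sum_neg_distrib, ← Finset.mul_sum, mul_neg]
    rw [funext this, integral_finsetSum]
    · refine Finset.sum_congr rfl fun l _ => ?_
      rw [integral_neg, h.weak l (V l) (hV l) (hVc l) ((hVB l).trans hBU), neg_neg]
    · intro l _
      exact (hInt (fun z hz => by simp [hdB l z hz]) (hcont l)).neg
  · filter_upwards [hS.mem_nhds hs₀] with s hs
    exact hfm.mul (hk s hs).aestronglyMeasurable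
  · exact hInt (hkB s₀ hs₀) (hk s₀ hs₀)
  · refine hfm.mul (Continuous.aestronglyMeasurable ?_)
    rw [funext hkV]
    exact (continuous_finsetSum _ fun l _ => hcont l).neg
  · refine ae_of_all _ fun z s hs => ?_
    by_cases hz : z ∈ B
    · rw [indicator_of_mem hz, norm_mul]
      exact mul_le_mul_of_nonneg_left (hkA s hs z) (norm_nonneg _)
    · simp [hk0 s hs z hz, hz]
  · have : IntegrableOn (fun z => ‖f z‖ * A) B := hfB.norm.mul_const A
    exact (this.integrable_indicator hB.measurableSet).integrableOn
  · exact ae_of_all _ fun z s hs => (hkd s hs z).const_mul (f z)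

/-- Hölder on the ball of radius t: the kernel is at most A t^(-n) and the ball has measure κ t^n,
so the powers combine to t^(-n) t^(n(1 - 1/p)) = t^(-n/p). -/
theorem abs_integral_mul_rescale_le {U : Set (Model n)} (hU : IsOpen U) {h : Model n → ℝ}
    (hh : LocallyIntegrableOn h U volume) {p : ℝ} (hp : 1 ≤ p) {t : ℝ} (ht : 0 < t) {x : Model n}
    (hxt : Metric.closedBall x t ⊆ U) {ζ : Model n → ℝ} {A : ℝ} (hζA : ∀ y, |ζ y| ≤ A)
    (hζ : tsupport ζ ⊆ Metric.closedBall 0 1) {b : ℝ} (hb : 0 ≤ b)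
    (hhb : eLpNorm h (ENNReal.ofReal p) (volume.restrict (Metric.closedBall x t)) ≤
      ENNReal.ofReal b) :
    |∫ z in U, h z * rescale t x ζ z| ≤
      A * (volume.real (Metric.ball (0 : Model n) 1)) ^ (1 - 1 / p) * (t ^ (-(n / p) : ℝ) * b) := by
  set B := Metric.closedBall x t with hBdef
  set κ := volume.real (Metric.ball (0 : Model n) 1)
  have hA : 0 ≤ A := (abs_nonneg _).trans (hζA 0)
  have hB : IsCompact B := isCompact_closedBall x t
  have hhB : IntegrableOn h B := hh.integrableOn_compact_subset hxt hB
  have hp0 : 0 < p := zero_lt_one.trans_le hp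
  have h1 : ∫ z in U, h z * rescale t x ζ z = ∫ z in B, h z * rescale t x ζ z := by
    refine setIntegral_eq_of_subset_of_forall_sdiff_eq_zero hU.measurableSet hxt fun z hz => ?_
    rw [rescale_eq_zero ht hζ hz.2, mul_zero]
  rw [h1]
  have h2 : |∫ z in B, h z * rescale t x ζ z| ≤ A * (t ^ n)⁻¹ * ∫ z in B, ‖h z‖ := by
    rw [← integral_const_mul, ← Real.norm_eq_abs]
    refine norm_integral_le_of_norm_le (hhB.norm.const_mul _) (ae_of_all _ fun z => ?_)
    rw [norm_mul, mul_comm, rescale, norm_mul, norm_inv, norm_pow, Real.norm_of_nonneg ht.le]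
    refine mul_le_mul_of_nonneg_right ?_ (norm_nonneg _)
    rw [mul_comm]
    exact mul_le_mul_of_nonneg_right (hζA _) (by positivity)
  have h3 : ∫ z in B, ‖h z‖ ≤ b * (t ^ n * κ) ^ (1 - 1 / p) := by
    rw [integral_norm_eq_lintegral_enorm hhB.aestronglyMeasurable]
    refine ENNReal.toReal_le_of_le_ofReal (by positivity) ?_
    rw [← eLpNorm_one_eq_lintegral_enorm]
    refine (eLpNorm_le_eLpNorm_mul_rpow_measure_univ (q := ENNReal.ofReal p)
      (by simpa using hp) hhB.aestronglyMeasurable).trans ?_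
    rw [ENNReal.ofReal_mul hb]
    refine mul_le_mul' hhb ?_
    rw [Measure.restrict_apply_univ, Measure.addHaar_closedBall _ _ ht.le,
      ENNReal.toReal_one, ENNReal.toReal_ofReal hp0.le,
      ← ENNReal.ofReal_rpow_of_nonneg (by positivity) (by simp [hp, inv_le_one_of_one_le₀]),
      ENNReal.ofReal_mul (by positivity)]
    simp [κ, measureReal_def, ENNReal.ofReal_toReal measure_ball_lt_top.ne]
  refine h2.trans ((mul_le_mul_of_nonneg_left h3 (by positivity)).trans (le_of_eq ?_))
  rw [Real.mul_rpow (by positivity) (by positivity)]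
  have : (t ^ n)⁻¹ * (t ^ n) ^ (1 - 1 / p) = t ^ (-(n / p) : ℝ) := by
    rw [← Real.rpow_natCast, ← Real.rpow_mul ht.le, ← Real.rpow_neg ht.le, ← Real.rpow_add ht]
    congr 1
    field_simp
    ring
  rw [← this]
  ring


theorem exists_mollifier (n : ℕ) : ∃ η : Model n → ℝ, ContDiff ℝ ∞ η ∧
    tsupport η ⊆ Metric.closedBall 0 1 ∧ ∫ y, η y = 1 := by
  let φ : ContDiffBump (0 : Model n) := ⟨1 / 2, 1, by norm_num, by norm_num⟩
  refine ⟨φ.normed volume, φ.contDiff_normed, ?_, φ.integral_normed⟩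
  rw [φ.tsupport_normed_eq]

theorem exists_bound {ζ : Model n → ℝ} (hζ : Continuous ζ)
    (h : tsupport ζ ⊆ Metric.closedBall 0 1) : ∃ A, ∀ y, |ζ y| ≤ A :=
  hζ.bounded_above_of_compact_support
    ((isCompact_closedBall 0 1).of_isClosed_subset (isClosed_tsupport _) h)

theorem integral_rescale {t : ℝ} (ht : 0 < t) (x : Model n) (ζ : Model n → ℝ) :
    ∫ z, rescale t x ζ z = ∫ y, ζ y := by
  simp only [rescale]
  rw [integral_const_mul, integral_sub_right_eq_self (fun z => ζ (t⁻¹ • z)) x,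
    Measure.integral_comp_inv_smul_of_nonneg volume ζ ht.le]
  simp only [finrank_euclideanSpace, Fintype.card_fin, smul_eq_mul]
  rw [inv_mul_cancel_left₀ (by positivity)]

/-- Radial derivative of the mollification. -/
theorem HasWeakGrad.hasDerivAt_radius {U : Set (Model n)} {f : Model n → ℝ}
    {g : Fin n → Model n → ℝ} (h : HasWeakGrad U f g) {η : Model n → ℝ}
    (hη : ContDiff ℝ ∞ η) (hη1 : tsupport η ⊆ Metric.closedBall 0 1) {x : Model n} {t T : ℝ}
    (ht : 0 < t) (htT : t < T) (hT : Metric.closedBall x T ⊆ U) :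
    HasDerivAt (fun t => ∫ z in U, f z * rescale t x η z)
      (∑ l, ∫ z in U, g l z * rescale t x (fun y => y l * η y) z) t := by
  have hηd : Differentiable ℝ η := hη.differentiable (by simp)
  have hζ : ∀ l : Fin n, ContDiff ℝ ∞ fun y : Model n => y l * η y := fun l =>
    (EuclideanSpace.proj l : Model n →L[ℝ] ℝ).contDiff.mul hη
  have hζ1 : ∀ l : Fin n, tsupport (fun y : Model n => y l * η y) ⊆ Metric.closedBall 0 1 :=
    fun l => (closure_mono (Function.support_mul_subset_right _ _)).trans hη1
  -- This is the divergence of y ↦ η(y) y; the dilation derivative of the kernel is minus its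
  -- rescaling divided by the radius.
  let χ : Model n → ℝ := fun y => n * η y + fderiv ℝ η y y
  have hχc : Continuous χ := (continuous_const.mul hη.continuous).add
    ((hη.continuous_fderiv (by simp)).clm_apply continuous_id)
  have hχ1 : tsupport χ ⊆ Metric.closedBall 0 1 := by
    refine closure_minimal (fun y hy => ?_) Metric.isClosed_closedBall
    by_contra hy'
    refine hy ?_
    have h1 : η y = 0 := image_eq_zero_of_notMem_tsupport fun h' => hy' (hη1 h')
    have h2 : fderiv ℝ η y = 0 :=
      image_eq_zero_of_notMem_tsupport fun h' => hy' (hη1 (tsupport_fderiv_subset ℝ h'))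
    simp [χ, h1, h2]
  obtain ⟨A, hA⟩ := exists_bound hχc hχ1
  have hA0 : 0 ≤ A := (abs_nonneg _).trans (hA 0)
  have hdiv : ∀ y : Model n, ∑ l, fderiv ℝ (fun y : Model n => y l * η y) y (stdVec l) = χ y := by
    intro y
    have : ∀ l : Fin n, fderiv ℝ (fun y : Model n => y l * η y) y (stdVec l)
        = η y + y l * fderiv ℝ η y (stdVec l) := by
      intro l
      have h1 : HasFDerivAt (fun y : Model n => y l)
        (EuclideanSpace.proj l : Model n →L[ℝ] ℝ) y :=
        (EuclideanSpace.proj l : Model n →L[ℝ] ℝ).hasFDerivAt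
      have h2 : HasFDerivAt (fun y : Model n => y l * η y) _ y := h1.mul (hηd y).hasFDerivAt
      rw [h2.fderiv]
      simp [add_comm]
    simp only [this, Finset.sum_add_distrib, χ]
    congr 1
    · simp
    · exact (apply_eq_sum_stdVec _ _).symm
  -- Radii above t / 2 keep the negative powers of the radius bounded, which gives the uniform bound
  -- needed for domination.
  refine h.hasDerivAt_integral (isCompact_closedBall x T) hT (S := Ioo (t / 2) T)
    (k' := fun s z => -((s ^ n)⁻¹ * (s⁻¹ * χ (s⁻¹ • (z - x)))))
    (A := ((t / 2) ^ n)⁻¹ * ((t / 2)⁻¹ * A))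
    isOpen_Ioo ⟨by linarith, htT⟩ ?_ ?_ ?_ ?_ ?_ ?_ ?_
  · exact fun s hs => (rescale_contDiff hη).continuous
  · intro s hs z hz
    have hs0 : 0 < s := by linarith [hs.1]
    exact rescale_eq_zero hs0 hη1 fun h' => hz (Metric.closedBall_subset_closedBall hs.2.le h')
  · intro s hs z
    have hs0 : 0 < s := by linarith [hs.1]
    have h1 : HasDerivAt (fun s : ℝ => (s ^ n)⁻¹) (-(n * s ^ (n - 1)) / (s ^ n) ^ 2) s :=
      (hasDerivAt_pow n s).inv (by positivity)
    have h2 : HasDerivAt (fun s : ℝ => s⁻¹ • (z - x)) ((-(s ^ 2)⁻¹) • (z - x)) s :=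
      (hasDerivAt_inv hs0.ne').smul_const _
    have h3 : HasDerivAt (fun s : ℝ => η (s⁻¹ • (z - x))) _ s :=
      (hηd (s⁻¹ • (z - x))).hasFDerivAt.comp_hasDerivAt s h2
    refine (h1.mul h3).congr_deriv ?_
    have h4 : n * s ^ (n - 1) / (s ^ n) ^ 2 = (s ^ n)⁻¹ * s⁻¹ * n := by
      -- The exponent `n - 1` is truncated, so dimension 0 is treated apart.
      rcases Nat.eq_zero_or_pos n with rfl | hn
      · simp
      · have : s ^ n = s ^ (n - 1) * s := by rw [← pow_succ, Nat.sub_add_cancel hn]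
        rw [this]
        field_simp
    have h5 : -(s ^ 2)⁻¹ • (z - x) = -(s⁻¹ • s⁻¹ • (z - x)) := by
      rw [smul_smul, ← neg_smul]; congr 1; field_simp
    rw [neg_div, h4, h5, map_neg, map_smul, smul_eq_mul]
    simp only [χ]
    ring
  · intro s hs z
    have hs0 : 0 < s := by linarith [hs.1]
    have ht2 : 0 < t / 2 := by linarith
    have hst : t / 2 ≤ s := hs.1.le
    rw [abs_neg, abs_mul, abs_mul, abs_of_pos (a := (s ^ n)⁻¹) (by positivity),
      abs_of_pos (a := s⁻¹) (by positivity)]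
    gcongr
    exact hA _
  · exact fun l => rescale_contDiff (hζ l)
  · exact fun l => (tsupport_rescale_subset ht (hζ1 l)).trans
      (Metric.closedBall_subset_closedBall htT.le)
  · intro z
    simp only [fderiv_rescale ((hζ _).differentiable (by simp)), ← Finset.mul_sum, hdiv]

/-- Derivative of the mollification in the direction of a translation. -/
theorem HasWeakGrad.hasDerivAt_center {U : Set (Model n)} {f : Model n → ℝ}
    {g : Fin n → Model n → ℝ} (h : HasWeakGrad U f g) {η : Model n → ℝ}
    (hη : ContDiff ℝ ∞ η) (hη1 : tsupport η ⊆ Metric.closedBall 0 1) {x w : Model n} {t s₀ T : ℝ}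
    (ht : 0 < t) (htT : ‖s₀ • w‖ + t < T) (hT : Metric.closedBall x T ⊆ U) :
    HasDerivAt (fun s => ∫ z in U, f z * rescale t (x + s • w) η z)
      (∑ l, w l * ∫ z in U, g l z * rescale t (x + s₀ • w) η z) s₀ := by
  have hηd : Differentiable ℝ η := hη.differentiable (by simp)
  have hd1 : tsupport (fun y => fderiv ℝ η y w) ⊆ Metric.closedBall 0 1 := by
    refine closure_minimal (fun y hy => ?_) Metric.isClosed_closedBall
    by_contra hy'
    refine hy ?_
    have h2 : fderiv ℝ η y = 0 :=
      image_eq_zero_of_notMem_tsupport fun h' => hy' (hη1 (tsupport_fderiv_subset ℝ h'))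
    simp [h2]
  obtain ⟨A, hA⟩ := exists_bound
    ((hη.continuous_fderiv (by simp)).clm_apply (continuous_const (y := w))) hd1
  have hsub : ∀ s : ℝ, ‖s • w‖ + t < T →
      Metric.closedBall (x + s • w) t ⊆ Metric.closedBall x T := by
    intro s hs
    refine Metric.closedBall_subset_closedBall' ?_
    rw [dist_eq_norm, add_sub_cancel_left]
    linarith
  have key := h.hasDerivAt_integral (isCompact_closedBall x T) hT
    (S := {s : ℝ | ‖s • w‖ + t < T}) (s₀ := s₀) (k := fun s : ℝ => rescale t (x + s • w) η)
    (k' := fun (s : ℝ) z => -((t ^ n)⁻¹ * (t⁻¹ * fderiv ℝ η (t⁻¹ • (z - (x + s • w))) w)))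
    (V := fun l z => w l * rescale t (x + s₀ • w) η z)
    (A := (t ^ n)⁻¹ * (t⁻¹ * A))
    (isOpen_lt (by fun_prop) continuous_const) htT ?_ ?_ ?_ ?_ ?_ ?_ ?_
  · refine key.congr_deriv (Finset.sum_congr rfl fun l _ => ?_)
    rw [← integral_const_mul]
    congr 1
    ext z
    ring
  · exact fun s hs => (rescale_contDiff hη).continuous
  · intro s hs z hz
    exact rescale_eq_zero ht hη1 fun h' => hz (hsub s hs h')
  · intro s hs z
    have h2 : HasDerivAt (fun s : ℝ => t⁻¹ • (z - (x + s • w))) (t⁻¹ • (-w)) s := by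
      have h1 : HasDerivAt (fun s : ℝ => z - (x + s • w)) (-w) s := by
        simpa using (((hasDerivAt_id s).smul_const w).const_add x).const_sub z
      exact h1.const_smul t⁻¹
    have h3 : HasDerivAt (fun s : ℝ => η (t⁻¹ • (z - (x + s • w)))) _ s :=
      (hηd _).hasFDerivAt.comp_hasDerivAt s h2
    refine (h3.const_mul ((t ^ n)⁻¹)).congr_deriv ?_
    simp
  · intro s hs z
    rw [abs_neg, abs_mul, abs_mul, abs_of_pos (a := (t ^ n)⁻¹) (by positivity),
      abs_of_pos (a := t⁻¹) (by positivity)]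
    gcongr
    exact hA _
  · exact fun l => contDiff_const.mul (rescale_contDiff hη)
  · exact fun l => (closure_mono (Function.support_mul_subset_right _ _)).trans
      ((tsupport_rescale_subset ht hη1).trans (hsub s₀ htT))
  · intro z
    have : ∀ l : Fin n, fderiv ℝ (fun z => w l * rescale t (x + s₀ • w) η z) z (stdVec l) =
        (t ^ n)⁻¹ * (t⁻¹ * (w l * fderiv ℝ η (t⁻¹ • (z - (x + s₀ • w))) (stdVec l))) := by
      intro l
      rw [fderiv_const_mul ((rescale_contDiff hη).differentiable (by simp) z),
        smul_apply, fderiv_rescale hηd, smul_eq_mul]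
      ring
    simp only [this, ← Finset.mul_sum]
    congr 3
    exact apply_eq_sum_stdVec _ _

/-! ### Morrey's inequality, and differentiability from a continuous weak gradient -/

section Morrey

variable {U : Set (Model n)} {f : Model n → ℝ} {g : Fin n → Model n → ℝ} {η : Model n → ℝ}
  {A p : ℝ}

/-- The constant in the estimates for the derivatives of the mollification. -/
def mollConst (n : ℕ) (A p : ℝ) : ℝ :=
  n * (A * (volume.real (Metric.ball (0 : Model n) 1)) ^ (1 - 1 / p))

theorem mollConst_nonneg (hA : 0 ≤ A) : 0 ≤ mollConst n A p := by
  unfold mollConst; positivity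

/-- The radial derivative at τ is at most C b τ^(α - 1) with α = 1 - n/p > 0, so the difference is
bounded by the increment of the primitive (C/α) b τ^α. The bound is uniform in the smaller radius s,
which is what makes the limit s → 0 exist. -/
theorem HasWeakGrad.abs_radius_sub_le (h : HasWeakGrad U f g) (hU : IsOpen U)
    (hη : ContDiff ℝ ∞ η) (hη1 : tsupport η ⊆ Metric.closedBall 0 1) (hηA : ∀ y, |η y| ≤ A)
    (hp1 : 1 ≤ p) (hp : (n : ℝ) < p) {x : Model n} {s t T b : ℝ} (hs : 0 < s) (hst : s ≤ t)
    (htT : t < T) (hT : Metric.closedBall x T ⊆ U) (hb : 0 ≤ b)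
    (hgb : ∀ l, eLpNorm (g l) (ENNReal.ofReal p) (volume.restrict (Metric.closedBall x T)) ≤
      ENNReal.ofReal b) :
    |(∫ z in U, f z * rescale t x η z) - ∫ z in U, f z * rescale s x η z| ≤
      mollConst n A p / (1 - n / p) * t ^ (1 - n / p) * b := by
  have hp0 : 0 < p := by linarith
  have hA : 0 ≤ A := (abs_nonneg _).trans (hηA 0)
  set α := 1 - n / p with hα
  have hα0 : 0 < α := by rw [hα, sub_pos, div_lt_one hp0]; exact hp
  set C := mollConst n A p
  have hC : 0 ≤ C := mollConst_nonneg hA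
  have hder : ∀ τ, 0 < τ → τ ≤ t → HasDerivAt (fun t => ∫ z in U, f z * rescale t x η z)
      (∑ l, ∫ z in U, g l z * rescale τ x (fun y => y l * η y) z) τ := fun τ h0 h1 =>
    h.hasDerivAt_radius hη hη1 h0 (h1.trans_lt htT) hT
  have hbd : ∀ τ, 0 < τ → τ ≤ t →
      ‖∑ l, ∫ z in U, g l z * rescale τ x (fun y => y l * η y) z‖ ≤ C * b * τ ^ (α - 1) := by
    intro τ h0 h1
    have hsub : Metric.closedBall x τ ⊆ Metric.closedBall x T :=
      Metric.closedBall_subset_closedBall (h1.trans htT.le)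
    refine (norm_sum_le _ _).trans ((Finset.sum_le_card_nsmul _ _
      (A * (volume.real (Metric.ball (0 : Model n) 1)) ^ (1 - 1 / p) * (τ ^ (-(n / p) : ℝ) * b))
      fun l _ => ?_).trans_eq ?_)
    · refine abs_integral_mul_rescale_le hU (h.locInt_grad l) hp1 h0 (hsub.trans hT) ?_ ?_ hb
        ((eLpNorm_mono_measure _ (Measure.restrict_mono_set _ hsub)).trans (hgb l))
      · intro y
        by_cases hy : y ∈ Metric.closedBall (0 : Model n) 1
        · rw [abs_mul]
          have h2 : |y l| ≤ 1 := (PiLp.norm_apply_le y l).trans (by simpa using hy)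
          calc |y l| * |η y| ≤ 1 * A := by gcongr; exact hηA y
            _ = A := one_mul A
        · rw [image_eq_zero_of_notMem_tsupport fun h' => hy (hη1 h')]
          simpa using hA
      · exact (closure_mono (Function.support_mul_subset_right _ _)).trans hη1
    · have : α - 1 = -(n / p) := by rw [hα]; ring
      rw [this]
      simp [C, mollConst]
      ring
  have hBd : ∀ τ, 0 < τ → HasDerivAt (fun τ => C / α * b * (τ ^ α - s ^ α))
      (C * b * τ ^ (α - 1)) τ := by
    intro τ h0
    refine (((Real.hasDerivAt_rpow_const (Or.inl h0.ne')).sub_const (s ^ α)).const_mul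
      (C / α * b)).congr_deriv ?_
    field_simp
  have key := image_norm_le_of_norm_deriv_right_le_deriv_boundary' (a := s) (b := t)
    (f := fun t => (∫ z in U, f z * rescale t x η z) - ∫ z in U, f z * rescale s x η z)
    (f' := fun τ => ∑ l, ∫ z in U, g l z * rescale τ x (fun y => y l * η y) z)
    (B := fun τ => C / α * b * (τ ^ α - s ^ α)) (B' := fun τ => C * b * τ ^ (α - 1))
    (fun τ hτ => ((hder τ (hs.trans_le hτ.1) hτ.2).sub_const _).continuousAt.continuousWithinAt)
    (fun τ hτ => ((hder τ (hs.trans_le hτ.1) hτ.2.le).sub_const _).hasDerivWithinAt) (by simp)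
    (fun τ hτ => (hBd τ (hs.trans_le hτ.1)).continuousAt.continuousWithinAt)
    (fun τ hτ => (hBd τ (hs.trans_le hτ.1)).hasDerivWithinAt)
    (fun τ hτ => hbd τ (hs.trans_le hτ.1) hτ.2.le) (right_mem_Icc.2 hst)
  refine key.trans ?_
  have h1 : 0 ≤ C / α * b := by positivity
  have h2 : 0 ≤ s ^ α := by positivity
  nlinarith

/-- Mean value inequality along the segment from x to y at fixed radius t. With t of the size of ‖y
- x‖ it has the same order t^(1 - n/p) as the radial estimate. -/
theorem HasWeakGrad.abs_center_sub_le (h : HasWeakGrad U f g) (hU : IsOpen U)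
    (hη : ContDiff ℝ ∞ η) (hη1 : tsupport η ⊆ Metric.closedBall 0 1) (hηA : ∀ y, |η y| ≤ A)
    (hp1 : 1 ≤ p) {x y : Model n} {t T b : ℝ} (ht : 0 < t)
    (htT : ‖y - x‖ + t < T) (hT : Metric.closedBall x T ⊆ U) (hb : 0 ≤ b)
    (hgb : ∀ l, eLpNorm (g l) (ENNReal.ofReal p) (volume.restrict (Metric.closedBall x T)) ≤
      ENNReal.ofReal b) :
    |(∫ z in U, f z * rescale t y η z) - ∫ z in U, f z * rescale t x η z| ≤
      mollConst n A p * ‖y - x‖ * t ^ (-(n / p) : ℝ) * b := by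
  have hA : 0 ≤ A := (abs_nonneg _).trans (hηA 0)
  set w := y - x with hw
  have hsw : ∀ s ∈ Icc (0 : ℝ) 1, ‖s • w‖ + t < T := by
    intro s hs
    rw [norm_smul, Real.norm_of_nonneg hs.1]
    nlinarith [norm_nonneg w, hs.2]
  have key := norm_image_sub_le_of_norm_deriv_le_segment_01'
    (f := fun s : ℝ => ∫ z in U, f z * rescale t (x + s • w) η z)
    (f' := fun s => ∑ l, w l * ∫ z in U, g l z * rescale t (x + s • w) η z)
    (C := mollConst n A p * ‖w‖ * t ^ (-(n / p) : ℝ) * b)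
    (fun s hs => (h.hasDerivAt_center hη hη1 ht (hsw s hs) hT).hasDerivWithinAt)
    (fun s hs => ?_)
  · simpa [hw] using key
  · have hsub : Metric.closedBall (x + s • w) t ⊆ Metric.closedBall x T := by
      refine Metric.closedBall_subset_closedBall' ?_
      rw [dist_eq_norm, add_sub_cancel_left]
      linarith [hsw s ⟨hs.1, hs.2.le⟩]
    refine (norm_sum_le _ _).trans ((Finset.sum_le_card_nsmul _ _
      (‖w‖ * (A * (volume.real (Metric.ball (0 : Model n) 1)) ^ (1 - 1 / p) *
        (t ^ (-(n / p) : ℝ) * b))) fun l _ => ?_).trans_eq ?_)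
    · rw [norm_mul]
      refine mul_le_mul (PiLp.norm_apply_le w l) ?_ (norm_nonneg _) (norm_nonneg _)
      exact abs_integral_mul_rescale_le hU (h.locInt_grad l) hp1 ht (hsub.trans hT) hηA hη1 hb
        ((eLpNorm_mono_measure _ (Measure.restrict_mono_set _ hsub)).trans (hgb l))
    · simp [mollConst]
      ring

/-- Convergence holds at every Lebesgue point, because a rescaled kernel is bounded by a constant
over the measure of its ball. -/
theorem ae_tendsto_integral_rescale {f : Model n → ℝ} (hf : LocallyIntegrable f volume)
    (hη1 : tsupport η ⊆ Metric.closedBall 0 1) (hηA : ∀ y, |η y| ≤ A)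
    (hηi : ∫ y, η y = 1) :
    ∀ᵐ x, Tendsto (fun t => ∫ z, f z * rescale t x η z) (𝓝[>] 0) (𝓝 (f x)) := by
  filter_upwards [IsUnifLocDoublingMeasure.ae_tendsto_average_norm_sub volume hf 1] with x hx
  have h0 : ∀ᶠ t : ℝ in 𝓝[>] 0, 0 < t := self_mem_nhdsWithin
  have := tendsto_integral_smul_of_tendsto_average_norm_sub
    (A * volume.real (Metric.ball (0 : Model n) 1)) (f := f) (c := f x) (l := 𝓝[>] (0 : ℝ))
    (a := fun t => Metric.closedBall x t) (g := fun t => rescale t x η)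
    (hx (fun _ => x) id tendsto_id (by
      filter_upwards [h0] with t ht using Metric.mem_closedBall_self (by simpa using ht.le)))
    (Eventually.of_forall fun t => hf.integrableOn_isCompact (isCompact_closedBall _ _))
    (tendsto_const_nhds.congr' (by
      filter_upwards [h0] with t ht
      rw [integral_rescale ht, hηi]))
    (by
      filter_upwards [h0] with t ht
      exact subset_closure.trans (tsupport_rescale_subset ht hη1))
    (by
      filter_upwards [h0] with t ht z
      have hball : 0 < volume.real (Metric.ball (0 : Model n) 1) :=
        ENNReal.toReal_pos (Metric.measure_ball_pos _ _ one_pos).ne' measure_ball_lt_top.ne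
      rw [Measure.addHaar_real_closedBall _ _ ht.le, rescale, abs_mul,
        abs_of_pos (a := (t ^ n)⁻¹) (by positivity)]
      simp only [finrank_euclideanSpace, Fintype.card_fin]
      rw [mul_div_mul_right _ _ hball.ne', div_eq_inv_mul]
      gcongr
      exact hηA _)
  simpa [mul_comm] using this

/-- **Morrey's inequality**, in the form of a continuous representative with a bound for its values
and its oscillation. -/
theorem exists_morrey (n : ℕ) {p : ℝ} (hp1 : 1 ≤ p) (hp : (n : ℝ) < p) :
    ∃ C : ℝ, 0 ≤ C ∧ ∀ (U : Set (Model n)) (f : Model n → ℝ) (g : Fin n → Model n → ℝ), IsOpen U →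
      HasWeakGrad U f g →
      (∀ x ∈ U, ∃ T b : ℝ, 0 < T ∧ 0 ≤ b ∧ Metric.closedBall x T ⊆ U ∧ ∀ l,
        eLpNorm (g l) (ENNReal.ofReal p) (volume.restrict (Metric.closedBall x T)) ≤
          ENNReal.ofReal b) →
      ∃ F : Model n → ℝ, ContinuousOn F U ∧ (∀ᵐ z ∂volume.restrict U, F z = f z) ∧
        (∀ x (T a b : ℝ), 0 < T → 0 ≤ a → 0 ≤ b → Metric.closedBall x T ⊆ U →
          eLpNorm f (ENNReal.ofReal p) (volume.restrict (Metric.closedBall x T)) ≤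
            ENNReal.ofReal a →
          (∀ l, eLpNorm (g l) (ENNReal.ofReal p) (volume.restrict (Metric.closedBall x T)) ≤
            ENNReal.ofReal b) → |F x| ≤ C * (T ^ (-(n / p) : ℝ) * (a + T * b))) ∧
        ∀ x y (T b : ℝ), 0 < T → 0 ≤ b → Metric.closedBall x (3 * T) ⊆ U → ‖y - x‖ ≤ T →
          (∀ l, eLpNorm (g l) (ENNReal.ofReal p) (volume.restrict (Metric.closedBall x (3 * T))) ≤
            ENNReal.ofReal b) → |F y - F x| ≤ C * (T ^ (1 - n / p) * b) := by
  obtain ⟨η, hη, hη1, hηi⟩ := exists_mollifier n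
  obtain ⟨A, hηA⟩ := exists_bound hη.continuous hη1
  have hA : 0 ≤ A := (abs_nonneg _).trans (hηA 0)
  have hp0 : 0 < p := by linarith
  set α := 1 - n / p with hα
  have hα0 : 0 < α := by rw [hα, sub_pos, div_lt_one hp0]; exact hp
  have hα1 : α ≤ 1 := by
    have : 0 ≤ n / p := by positivity
    linarith
  set D := mollConst n A p with hD
  have hD0 : 0 ≤ D := mollConst_nonneg hA
  set K := A * (volume.real (Metric.ball (0 : Model n) 1)) ^ (1 - 1 / p) with hK
  have hK0 : 0 ≤ K := by positivity
  -- `K` comes from the size of a mollification, each `D / α` from one comparison of a value with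
  -- its mollification (two for an oscillation), and the last `D` from the translation.
  refine ⟨2 * K + 2 * (D / α) + D, by positivity, fun U f g hU h hloc => ?_⟩
  set G : Model n → ℝ → ℝ := fun x t => ∫ z in U, f z * rescale t x η z with hG
  have hrad : ∀ x (s t T b : ℝ), 0 < s → s ≤ t → t < T → Metric.closedBall x T ⊆ U → 0 ≤ b →
      (∀ l, eLpNorm (g l) (ENNReal.ofReal p) (volume.restrict (Metric.closedBall x T)) ≤
        ENNReal.ofReal b) → |G x t - G x s| ≤ D / α * t ^ α * b :=
    fun x s t T b h1 h2 h3 h4 h5 h6 => h.abs_radius_sub_le hU hη hη1 hηA hp1 hp h1 h2 h3 h4 h5 h6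
  -- By the radial estimate the mollifications with radius in (0, t] differ by at most (D/α) t^α b,
  -- so they are Cauchy as the radius tends to 0.
  have hlim : ∀ x ∈ U, ∃ c, Tendsto (G x) (𝓝[>] 0) (𝓝 c) := by
    intro x hx
    obtain ⟨T, b, hT, hb, hTU, hgb⟩ := hloc x hx
    rw [← cauchy_map_iff_exists_tendsto, Metric.cauchy_iff]
    refine ⟨inferInstance, fun ε hε => ?_⟩
    have h1 : Tendsto (fun t : ℝ => D / α * t ^ α * b) (𝓝[>] 0) (𝓝 (D / α * 0 ^ α * b)) := by
      refine Tendsto.mono_left ?_ nhdsWithin_le_nhds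
      exact (((Real.continuousAt_rpow_const 0 α (Or.inr hα0.le)).tendsto).const_mul _).mul_const _
    rw [Real.zero_rpow hα0.ne', mul_zero, zero_mul] at h1
    obtain ⟨t, ht1, ht2⟩ := ((h1.eventually_lt_const hε).and
      (Ioo_mem_nhdsGT hT)).exists
    refine ⟨G x '' Ioc 0 t, image_mem_map (Ioc_mem_nhdsGT ht2.1), ?_⟩
    have aux : ∀ s s', 0 < s → s ≤ s' → s' ≤ t → |G x s' - G x s| < ε := by
      intro s s' h0 h1 h2
      refine (hrad x s s' T b h0 h1 (h2.trans_lt ht2.2) hTU hb hgb).trans_lt (lt_of_le_of_lt ?_ ht1)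
      have := h0.le.trans h1
      gcongr
    rintro _ ⟨s, hs, rfl⟩ _ ⟨s', hs', rfl⟩
    rcases le_total s s' with hss | hss
    · rw [dist_comm]; exact aux s s' hs.1 hss hs'.2
    · exact aux s' s hs'.1 hss hs.2
  choose! F hF using hlim
  have hFG : ∀ x (t T b : ℝ), 0 < t → t < T → Metric.closedBall x T ⊆ U → 0 ≤ b →
      (∀ l, eLpNorm (g l) (ENNReal.ofReal p) (volume.restrict (Metric.closedBall x T)) ≤
        ENNReal.ofReal b) → |G x t - F x| ≤ D / α * t ^ α * b := by
    intro x t T b ht htT hTU hb hgb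
    have hx : x ∈ U := hTU (Metric.mem_closedBall_self (ht.trans htT).le)
    refine le_of_tendsto ((tendsto_const_nhds.sub (hF x hx)).abs) ?_
    filter_upwards [Ioc_mem_nhdsGT ht] with s hs
    exact hrad x s t T b hs.1 hs.2 htT hTU hb hgb
  -- Both values are compared with their mollifications at scale T. The radial estimate needs a ball
  -- strictly larger than T, and the ball of radius 2T about y fits into that of radius 3T about x.
  have hosc : ∀ x y (T b : ℝ), 0 < T → 0 ≤ b → Metric.closedBall x (3 * T) ⊆ U → ‖y - x‖ ≤ T →
      (∀ l, eLpNorm (g l) (ENNReal.ofReal p) (volume.restrict (Metric.closedBall x (3 * T))) ≤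
        ENNReal.ofReal b) → |F y - F x| ≤ (2 * (D / α) + D) * (T ^ α * b) := by
    intro x y T b hT hb hTU hxy hgb
    have hsub : Metric.closedBall y (2 * T) ⊆ Metric.closedBall x (3 * T) := by
      refine Metric.closedBall_subset_closedBall' ?_
      rw [dist_eq_norm]; linarith
    have h1 := hFG x T (3 * T) b hT (by linarith) hTU hb hgb
    have h2 := hFG y T (2 * T) b hT (by linarith) (hsub.trans hTU) hb fun l =>
      (eLpNorm_mono_measure _ (Measure.restrict_mono_set _ hsub)).trans (hgb l)
    have h3 : |G y T - G x T| ≤ D * ‖y - x‖ * T ^ (-(n / p) : ℝ) * b :=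
      h.abs_center_sub_le hU hη hη1 hηA hp1 hT (by linarith) hTU hb hgb
    have h4 : D * ‖y - x‖ * T ^ (-(n / p) : ℝ) * b ≤ D * T ^ α * b := by
      have : T ^ α = T * T ^ (-(n / p) : ℝ) := by
        rw [hα, sub_eq_add_neg, Real.rpow_add hT, Real.rpow_one]
      rw [this, ← mul_assoc]
      gcongr
    have h5 : F y - F x = -(G y T - F y) + (G y T - G x T) + (G x T - F x) := by ring
    rw [h5]
    refine (abs_add_three _ _ _).trans ?_
    rw [abs_neg]
    linarith
  refine ⟨F, ?_, ?_, ?_, ?_⟩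
  · intro x hx
    obtain ⟨T, b, hT, hb, hTU, hgb⟩ := hloc x hx
    refine ContinuousAt.continuousWithinAt (Metric.continuousAt_iff'.2 fun ε hε => ?_)
    have h1 : Tendsto (fun t : ℝ => (2 * (D / α) + D) * (t ^ α * b)) (𝓝[>] 0)
        (𝓝 ((2 * (D / α) + D) * (0 ^ α * b))) := by
      refine Tendsto.mono_left ?_ nhdsWithin_le_nhds
      exact (((Real.continuousAt_rpow_const 0 α (Or.inr hα0.le)).tendsto).mul_const _).const_mul _
    rw [Real.zero_rpow hα0.ne', zero_mul, mul_zero] at h1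
    obtain ⟨t, ht1, ht2⟩ := ((h1.eventually_lt_const hε).and
      (Ioo_mem_nhdsGT (show 0 < T / 3 by linarith))).exists
    filter_upwards [Metric.closedBall_mem_nhds x ht2.1] with y hy
    have hsub : Metric.closedBall x (3 * t) ⊆ Metric.closedBall x T :=
      Metric.closedBall_subset_closedBall (by linarith [ht2.2])
    refine (hosc x y t b ht2.1 hb (hsub.trans hTU) (by rwa [← dist_eq_norm]) fun l =>
      (eLpNorm_mono_measure _ (Measure.restrict_mono_set _ hsub)).trans (hgb l)).trans_lt ht1
  · rw [ae_restrict_iff' hU.measurableSet, ae_iff]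
    refine measure_null_of_locally_null _ fun x hx => ?_
    have hxU : x ∈ U := by
      by_contra h'
      exact hx fun h'' => absurd h'' h'
    obtain ⟨T, hT, hTU⟩ := Metric.nhds_basis_closedBall.mem_iff.1 (hU.mem_nhds hxU)
    set B := Metric.closedBall x T
    have hB : IsCompact B := isCompact_closedBall x T
    -- Cutting `f` off outside a ball gives a function that is locally integrable on all of ℝⁿ; near
    -- the centre its mollifications of small radius are those of `f`.
    have hfi : LocallyIntegrable (B.indicator f) volume :=
      ((h.locInt.integrableOn_compact_subset hTU hB).integrable_indicator
        hB.measurableSet).locallyIntegrable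
    refine ⟨Metric.ball x (T / 2) ∩ _, inter_mem (mem_nhdsWithin_of_mem_nhds
      (Metric.ball_mem_nhds x (half_pos hT))) self_mem_nhdsWithin, ?_⟩
    refine measure_mono_null ?_ (ae_iff.1 (ae_tendsto_integral_rescale hfi hη1 hηA hηi))
    rintro z ⟨hz, hz'⟩ hlimz
    refine hz' fun hzU => ?_
    have hzB : z ∈ B := Metric.ball_subset_closedBall (Metric.ball_subset_ball (by linarith) hz)
    rw [indicator_of_mem hzB] at hlimz
    refine tendsto_nhds_unique (hF z hzU) (hlimz.congr' ?_)
    filter_upwards [Ioo_mem_nhdsGT (half_pos hT)] with t ht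
    have hsub : Metric.closedBall z t ⊆ B := Metric.closedBall_subset_closedBall' (by
      have := Metric.mem_ball.1 hz
      linarith [ht.2])
    have h1 : ∀ z', B.indicator f z' * rescale t z η z' =
        U.indicator (fun z' => f z' * rescale t z η z') z' := by
      intro z'
      by_cases hz'B : z' ∈ B
      · rw [indicator_of_mem hz'B, indicator_of_mem (hTU hz'B)]
      · have h0 := rescale_eq_zero ht.1 hη1 fun h' => hz'B (hsub h')
        simp [indicator, h0]
    rw [funext h1, integral_indicator hU.measurableSet]
  · intro x T a b hT ha hb hTU hfa hgb
    have hT2 : 0 < T / 2 := half_pos hT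
    have hsub : Metric.closedBall x (T / 2) ⊆ Metric.closedBall x T :=
      Metric.closedBall_subset_closedBall (by linarith)
    have h1 := hFG x (T / 2) T b hT2 (by linarith) hTU hb hgb
    have h2 : |G x (T / 2)| ≤ K * ((T / 2) ^ (-(n / p) : ℝ) * a) :=
      abs_integral_mul_rescale_le hU h.locInt hp1 hT2 (hsub.trans hTU) hηA hη1 ha
        ((eLpNorm_mono_measure _ (Measure.restrict_mono_set _ hsub)).trans hfa)
    -- Half the radius leaves the room required by `hFG`; it costs a factor at most 2 because n/p <
    -- 1.
    have h3 : (T / 2) ^ (-(n / p) : ℝ) ≤ 2 * T ^ (-(n / p) : ℝ) := by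
      rw [Real.div_rpow hT.le (by norm_num), div_le_iff₀ (by positivity), mul_comm (2 : ℝ),
        mul_assoc]
      refine le_mul_of_one_le_right (by positivity) ?_
      have : (2 : ℝ) * 2 ^ (-(n / p) : ℝ) = 2 ^ α := by
        rw [hα, sub_eq_add_neg, Real.rpow_add (by norm_num), Real.rpow_one]
      rw [this]
      exact Real.one_le_rpow (by norm_num) hα0.le
    have h4 : (T / 2) ^ α ≤ T * T ^ (-(n / p) : ℝ) := by
      have : T ^ α = T * T ^ (-(n / p) : ℝ) := by
        rw [hα, sub_eq_add_neg, Real.rpow_add hT, Real.rpow_one]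
      rw [← this]
      gcongr
      linarith
    have h5 : |F x| ≤ |G x (T / 2)| + |G x (T / 2) - F x| := by
      have := abs_sub_abs_le_abs_sub (F x) (G x (T / 2))
      rw [abs_sub_comm] at this
      linarith
    set θ := T ^ (-(n / p) : ℝ)
    have hθ : 0 ≤ θ := by positivity
    calc |F x| ≤ K * ((T / 2) ^ (-(n / p) : ℝ) * a) + D / α * (T / 2) ^ α * b :=
          h5.trans (add_le_add h2 h1)
      _ ≤ K * ((2 * θ) * a) + D / α * (T * θ) * b := by gcongr
      _ ≤ (2 * K + 2 * (D / α) + D) * (θ * (a + T * b)) := by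
          have e1 : 0 ≤ D / α := by positivity
          have e2 : 0 ≤ θ * a := by positivity
          have e3 : 0 ≤ θ * (T * b) := by positivity
          nlinarith [mul_nonneg e1 e2, mul_nonneg hD0 e2, mul_nonneg hK0 e3, mul_nonneg hD0 e3,
            mul_nonneg e1 e3]
  · intro x y T b hT hb hTU hxy hgb
    refine (hosc x y T b hT hb hTU hxy hgb).trans ?_
    gcongr
    linarith

theorem HasWeakGrad.sub_clm (h : HasWeakGrad U f g) (hU : IsOpen U) (L : Model n →L[ℝ] ℝ) :
    HasWeakGrad U (fun z => f z - L z) (fun l z => g l z - L (stdVec l)) where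
  locInt := h.locInt.sub (L.continuous.continuousOn.locallyIntegrableOn hU.measurableSet)
  locInt_grad l := (h.locInt_grad l).sub
    (continuousOn_const.locallyIntegrableOn hU.measurableSet)
  weak l ψ hψ hψc hψU := by
    have hc : Continuous fun z => fderiv ℝ ψ z (stdVec l) :=
      (hψ.continuous_fderiv (by simp)).clm_apply continuous_const
    have hcs : HasCompactSupport fun z => fderiv ℝ ψ z (stdVec l) :=
      (hψc.fderiv ℝ).mono' fun z hz => subset_closure fun h' => hz (by simp [h'])
    have hd0 : ∀ z ∉ tsupport ψ, fderiv ℝ ψ z (stdVec l) = 0 := fun z hz => by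
      rw [image_eq_zero_of_notMem_tsupport fun h' => hz (tsupport_fderiv_subset ℝ h')]
      simp
    have hi : ∀ {u v : Model n → ℝ}, LocallyIntegrableOn u U volume → Continuous v →
        (∀ z ∉ tsupport ψ, v z = 0) → Integrable (fun z => u z * v z) (volume.restrict U) := by
      intro u v hu hv hv0
      have : IntegrableOn (fun z => u z * v z) (tsupport ψ) :=
        (hu.integrableOn_compact_subset hψU hψc).mul_continuousOn hv.continuousOn hψc
      refine (IntegrableOn.integrable_of_forall_notMem_eq_zero this fun z hz => ?_).integrableOn
      simp [hv0 z hz]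
    have hψ0 : ∀ z ∉ tsupport ψ, ψ z = 0 := fun z hz => image_eq_zero_of_notMem_tsupport hz
    have hL : LocallyIntegrableOn (fun z => L z) U volume :=
      L.continuous.continuousOn.locallyIntegrableOn hU.measurableSet
    have hk : LocallyIntegrableOn (fun _ => L (stdVec l)) U (volume : Measure (Model n)) :=
      continuousOn_const.locallyIntegrableOn hU.measurableSet
    have hext : ∀ {w : Model n → ℝ}, (∀ z ∉ tsupport ψ, w z = 0) → ∫ z in U, w z = ∫ z, w z := by
      intro w hw
      exact setIntegral_eq_integral_of_forall_compl_eq_zero fun z hz =>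
        hw z fun h' => hz (hψU h')
    simp only [sub_mul]
    rw [integral_sub (hi h.locInt hc hd0) (hi hL hc hd0), h.weak l ψ hψ hψc hψU,
      integral_sub (hi (h.locInt_grad l) hψ.continuous hψ0) (hi hk hψ.continuous hψ0),
      hext (w := fun z => L z * fderiv ℝ ψ z (stdVec l)) (fun z hz => by simp [hd0 z hz]),
      hext (w := fun z => L (stdVec l) * ψ z) (fun z hz => by simp [hψ0 z hz]),
      integral_mul_fderiv_eq_neg_fderiv_mul_of_integrable (f := fun z => L z) (g := ψ)
        (v := stdVec l) ?_ ?_ ?_ (fun z _ => L.differentiableAt)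
        (fun z _ => hψ.differentiable (by simp) z)]
    · simp only [ContinuousLinearMap.fderiv]
      ring
    · simp only [ContinuousLinearMap.fderiv]
      exact (continuous_const.mul hψ.continuous).integrable_of_hasCompactSupport hψc.mul_left
    · exact (L.continuous.mul hc).integrable_of_hasCompactSupport hcs.mul_left
    · exact (L.continuous.mul hψ.continuous).integrable_of_hasCompactSupport hψc.mul_left

/-- A continuous function with a continuous weak gradient is differentiable. -/
theorem HasWeakGrad.hasFDerivAt (h : HasWeakGrad U f g) (hU : IsOpen U) (hf : ContinuousOn f U)
    (hg : ∀ l, ContinuousOn (g l) U) {x : Model n} (hx : x ∈ U) :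
    HasFDerivAt f (∑ l, g l x • (EuclideanSpace.proj l : Model n →L[ℝ] ℝ)) x := by
  set L : Model n →L[ℝ] ℝ := ∑ l, g l x • (EuclideanSpace.proj l : Model n →L[ℝ] ℝ) with hLdef
  have hLl : ∀ l, L (stdVec l) = g l x := by
    intro l
    simp [hLdef, sum_apply]
  have h' := h.sub_clm hU L
  -- Any exponent above n would do, as the gradient is locally bounded.
  set p : ℝ := n + 1 with hpdef
  have hp1 : 1 ≤ p := by simp [hpdef]
  have hp0 : 0 < p := by linarith
  have hp : (n : ℝ) < p := by simp [hpdef]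
  obtain ⟨C, hC, hmor⟩ := exists_morrey n hp1 hp
  set κ := volume.real (Metric.ball (0 : Model n) 1) with hκ
  -- the `L^p` norm on a ball of a function which is small there
  have hLp : ∀ (y : Model n) (T ε : ℝ) (u : Model n → ℝ), 0 < T → 0 ≤ ε →
      (∀ z ∈ Metric.closedBall y T, |u z| ≤ ε) →
      eLpNorm u (ENNReal.ofReal p) (volume.restrict (Metric.closedBall y T)) ≤
        ENNReal.ofReal ((T ^ n * κ) ^ p⁻¹ * ε) := by
    intro y T ε u hT hε hu
    refine (eLpNorm_le_of_ae_bound (C := ε) ?_).trans_eq ?_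
    · exact (ae_restrict_iff' Metric.isClosed_closedBall.measurableSet).2 (ae_of_all _ hu)
    · rw [Measure.restrict_apply_univ, Measure.addHaar_closedBall _ _ hT.le,
        ENNReal.toReal_ofReal hp0.le, ENNReal.ofReal_mul (by positivity),
        ← ENNReal.ofReal_rpow_of_nonneg (by positivity) (by positivity),
        ENNReal.ofReal_mul (by positivity), hκ, measureReal_def,
        ENNReal.ofReal_toReal measure_ball_lt_top.ne]
      simp
  have hgc : ∀ y ∈ U, ∀ ε > 0, ∃ T > 0, Metric.closedBall y T ⊆ U ∧
      ∀ l, ∀ z ∈ Metric.closedBall y T, |g l z - g l y| ≤ ε := by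
    intro y hy ε hε
    have : ∀ᶠ z in 𝓝 y, z ∈ U ∧ ∀ l, |g l z - g l y| ≤ ε := by
      refine (hU.eventually_mem hy).and (eventually_all.2 fun l => ?_)
      filter_upwards [((hg l).continuousAt (hU.mem_nhds hy)).eventually
        (Metric.closedBall_mem_nhds _ hε)] with z hz using hz
    obtain ⟨T, hT, hTs⟩ := Metric.nhds_basis_closedBall.mem_iff.1 this
    exact ⟨T, hT, fun z hz => (hTs hz).1, fun l z hz => (hTs hz).2 l⟩
  obtain ⟨F, hFc, hFf, -, hosc⟩ := hmor U _ _ hU h' (by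
    intro y hy
    obtain ⟨T, hT, hTU, hTg⟩ := hgc y hy 1 one_pos
    set s := ∑ l, |g l y - L (stdVec l)| with hs
    refine ⟨T, _, hT, ?_, hTU, fun l => hLp y T (1 + s) _ hT (by positivity) fun z hz => ?_⟩
    · positivity
    · have h1 := hTg l z hz
      have h2 : |g l y - L (stdVec l)| ≤ s :=
        Finset.single_le_sum (f := fun l => |g l y - L (stdVec l)|)
          (fun _ _ => abs_nonneg _) (Finset.mem_univ l)
      have h3 : g l z - L (stdVec l) = (g l z - g l y) + (g l y - L (stdVec l)) := by ring
      rw [h3]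
      exact (abs_add_le _ _).trans (add_le_add h1 h2))
  have hFeq : EqOn F (fun z => f z - L z) U := Measure.eqOn_open_of_ae_eq hFf hU hFc
    (hf.sub L.continuous.continuousOn)
  rw [hasFDerivAt_iff_isLittleO_nhds_zero, Asymptotics.isLittleO_iff]
  intro c hc
  set M := C * ((3 : ℝ) ^ n * κ) ^ p⁻¹ with hM
  have hM0 : 0 ≤ M := by positivity
  -- `f - L` has a weak gradient that is small near `x`; the oscillation estimate for it is the
  -- differentiability estimate. The `+ 1` avoids division by zero.
  obtain ⟨T, hT, hTU, hTg⟩ := hgc x hx (c / (M + 1)) (by positivity)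
  filter_upwards [Metric.ball_mem_nhds (0 : Model n) (show 0 < T / 3 by linarith)] with w hw
  rw [mem_ball_zero_iff] at hw
  rcases eq_or_ne w 0 with rfl | hw0
  · simp
  have hw' : 0 < ‖w‖ := norm_pos_iff.2 hw0
  have hsub : Metric.closedBall x (3 * ‖w‖) ⊆ Metric.closedBall x T :=
    Metric.closedBall_subset_closedBall (by linarith)
  have hxw : x + w ∈ U := hTU (by simp; linarith)
  have key := hosc x (x + w) ‖w‖ (((3 * ‖w‖) ^ n * κ) ^ p⁻¹ * (c / (M + 1))) hw' (by positivity)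
    (hsub.trans hTU) (by simp) fun l => hLp x (3 * ‖w‖) (c / (M + 1)) _ (by positivity)
      (by positivity) fun z hz => by rw [hLl]; exact hTg l z (hsub hz)
  rw [hFeq hxw, hFeq hx] at key
  have e1 : f (x + w) - f x - L w = f (x + w) - L (x + w) - (f x - L x) := by
    rw [map_add]; ring
  rw [e1, Real.norm_eq_abs]
  refine key.trans ?_
  -- The measure of the ball contributes ‖w‖^(n/p), which completes Morrey's ‖w‖^(1 - n/p) to ‖w‖.
  have e2 : ((3 * ‖w‖) ^ n * κ) ^ p⁻¹ = ((3 : ℝ) ^ n * κ) ^ p⁻¹ * ‖w‖ ^ (n / p) := by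
    rw [mul_pow, mul_right_comm, Real.mul_rpow (by positivity) (by positivity),
      ← Real.rpow_natCast ‖w‖, ← Real.rpow_mul (norm_nonneg w), div_eq_mul_inv]
  have e3 : ‖w‖ ^ (1 - n / p) * ‖w‖ ^ (n / p) = ‖w‖ := by
    rw [← Real.rpow_add hw']; simp
  calc C * (‖w‖ ^ (1 - n / p) * (((3 * ‖w‖) ^ n * κ) ^ p⁻¹ * (c / (M + 1))))
      = M * (c / (M + 1)) * (‖w‖ ^ (1 - n / p) * ‖w‖ ^ (n / p)) := by rw [e2, hM]; ring
    _ = M / (M + 1) * c * ‖w‖ := by rw [e3]; ring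
    _ ≤ 1 * c * ‖w‖ := by
        gcongr
        rw [div_le_one (by positivity)]
        linarith
    _ = c * ‖w‖ := by ring

end Morrey

end WeakGradient

/-! ### Tensors in dual frames, and comparison of their norm with their components -/

section Tensor

variable {V : Type*} [AddCommGroup V] [Module ℝ V] {r k : ℕ}

theorem tensor_expand {κ κ' : Type*} [Fintype κ] [Fintype κ'] (T : TensorAt r k V)
    (γ : κ → Module.Dual ℝ V) (w : κ' → V) (a : Fin r → κ → ℝ) (b : Fin k → κ' → ℝ) :
    T (fun i => ∑ x, a i x • γ x) (fun i => ∑ x, b i x • w x) =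
      ∑ I : Fin r → κ, ∑ J : Fin k → κ', ((∏ i, a i (I i)) * ∏ i, b i (J i)) *
        T (fun i => γ (I i)) (fun i => w (J i)) := by
  classical
  have h1 : T (fun i => ∑ x, a i x • γ x) =
      ∑ I : Fin r → κ, (∏ i, a i (I i)) • T (fun i => γ (I i)) := by
    rw [MultilinearMap.map_sum]
    exact Finset.sum_congr rfl fun I _ => MultilinearMap.map_smul_univ _ _ _
  rw [h1, sum_apply]
  refine Finset.sum_congr rfl fun I _ => ?_
  rw [MultilinearMap.map_sum]
  refine Finset.sum_congr rfl fun J _ => ?_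
  rw [MultilinearMap.map_smul_univ, smul_apply, smul_eq_mul, smul_eq_mul]
  ring

theorem abs_tensor_le {κ κ' : Type*} [Fintype κ] [Fintype κ'] (T : TensorAt r k V)
    (γ : κ → Module.Dual ℝ V) (w : κ' → V) (a : Fin r → κ → ℝ) (b : Fin k → κ' → ℝ) {A : ℝ}
    (ha : ∀ i x, |a i x| ≤ A) (hb : ∀ i x, |b i x| ≤ A) :
    |T (fun i => ∑ x, a i x • γ x) (fun i => ∑ x, b i x • w x)| ≤
      A ^ (r + k) * ∑ I : Fin r → κ, ∑ J : Fin k → κ',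
        |T (fun i => γ (I i)) (fun i => w (J i))| := by
  rw [tensor_expand]
  simp only [Finset.mul_sum]
  refine (Finset.abs_sum_le_sum_abs _ _).trans (Finset.sum_le_sum fun I _ => ?_)
  refine (Finset.abs_sum_le_sum_abs _ _).trans (Finset.sum_le_sum fun J _ => ?_)
  rw [abs_mul, abs_mul, Finset.abs_prod, Finset.abs_prod, pow_add]
  have h1 : ∏ i, |a i (I i)| ≤ A ^ r := by
    refine (Finset.prod_le_prod (fun _ _ => abs_nonneg _) fun i _ => ha i (I i)).trans_eq
      (by simp)
  have h2 : ∏ i, |b i (J i)| ≤ A ^ k := by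
    refine (Finset.prod_le_prod (fun _ _ => abs_nonneg _) fun i _ => hb i (J i)).trans_eq
      (by simp)
  refine mul_le_mul_of_nonneg_right ?_ (abs_nonneg _)
  exact mul_le_mul h1 h2 (Finset.prod_nonneg fun _ _ => abs_nonneg _)
    ((Finset.prod_nonneg fun _ _ => abs_nonneg _).trans h1)

/-- `b` and `c` are dual bases of `V` and its dual. -/
structure IsDualFrame {n : ℕ} (b : Fin n → V) (c : Fin n → Module.Dual ℝ V) : Prop where
  apply_eq : ∀ i j, c i (b j) = if i = j then 1 else 0
  sum_eq : ∀ v, ∑ i, c i v • b i = v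

theorem IsDualFrame.dual_sum_eq {n : ℕ} {b : Fin n → V} {c : Fin n → Module.Dual ℝ V}
    (h : IsDualFrame b c) (α : Module.Dual ℝ V) : ∑ i, α (b i) • c i = α := by
  ext v
  conv_rhs => rw [← h.sum_eq v, map_sum]
  simp [mul_comm]

theorem IsDualFrame.linearIndependent {n : ℕ} {b : Fin n → V} {c : Fin n → Module.Dual ℝ V}
    (h : IsDualFrame b c) : LinearIndependent ℝ b := by
  rw [Fintype.linearIndependent_iff]
  intro g hg i
  have := congrArg (c i) hg
  simpa [map_sum, h.apply_eq] using this

theorem IsDualFrame.tensor_ext {n : ℕ} {b : Fin n → V} {c : Fin n → Module.Dual ℝ V}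
    (h : IsDualFrame b c) {T T' : TensorAt r k V}
    (hT : ∀ (I : Fin r → Fin n) (J : Fin k → Fin n), T (fun a => c (I a)) (fun a => b (J a)) =
      T' (fun a => c (I a)) (fun a => b (J a))) : T = T' := by
  ext α v
  have hα : α = fun a => ∑ i, (α a (b i)) • c i := funext fun a => (h.dual_sum_eq (α a)).symm
  have hv : v = fun a => ∑ i, (c i (v a)) • b i := funext fun a => (h.sum_eq (v a)).symm
  rw [hα, hv, tensor_expand, tensor_expand]
  simp only [hT]

/-- The tensor is the combination, with coefficients `t`, of the products of the evaluations at b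
(`P`) and the covectors c (`Q`), which form the dual family to the component functionals. -/
theorem IsDualFrame.exists_tensor {n : ℕ} {b : Fin n → V} {c : Fin n → Module.Dual ℝ V}
    (h : IsDualFrame b c) (t : (Fin r → Fin n) → (Fin k → Fin n) → ℝ) :
    ∃ T : TensorAt r k V, ∀ I J, T (fun a => c (I a)) (fun a => b (J a)) = t I J := by
  let P : (Fin r → Fin n) → MultilinearMap ℝ (fun _ : Fin r => Module.Dual ℝ V) ℝ := fun I =>
    (MultilinearMap.mkPiAlgebra ℝ (Fin r) ℝ).compLinearMap fun a => Module.Dual.eval ℝ V (b (I a))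
  let Q : (Fin k → Fin n) → MultilinearMap ℝ (fun _ : Fin k => V) ℝ := fun J =>
    (MultilinearMap.mkPiAlgebra ℝ (Fin k) ℝ).compLinearMap fun a => c (J a)
  have hP : ∀ I I', P I (fun a => c (I' a)) = if I' = I then 1 else 0 := by
    intro I I'
    simp only [P, MultilinearMap.compLinearMap_apply, MultilinearMap.mkPiAlgebra_apply,
      Module.Dual.eval_apply, h.apply_eq, Finset.prod_ite_zero, Finset.prod_const_one]
    simp [funext_iff]
  have hQ : ∀ J J', Q J (fun a => b (J' a)) = if J = J' then 1 else 0 := by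
    intro J J'
    simp only [Q, MultilinearMap.compLinearMap_apply, MultilinearMap.mkPiAlgebra_apply,
      h.apply_eq, Finset.prod_ite_zero, Finset.prod_const_one]
    simp [funext_iff]
  refine ⟨∑ I, (P I).smulRight (∑ J, t I J • Q J), fun I J => ?_⟩
  rw [sum_apply, sum_apply]
  simp only [MultilinearMap.smulRight_apply, smul_apply, sum_apply,
    hP, hQ]
  simp

end Tensor

section TensorNorm

variable {V : Type*} [NormedAddCommGroup V] [InnerProductSpace ℝ V] [FiniteDimensional ℝ V]
  {r k n : ℕ} {b : Fin n → V} {c : Fin n → Module.Dual ℝ V}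

theorem tensorNormSq_nonneg (T : TensorAt r k V) : 0 ≤ tensorNormSq T :=
  Finset.sum_nonneg fun _ _ => Finset.sum_nonneg fun _ _ => sq_nonneg _

theorem sq_le_sum_sum_sq {α β : Type*} [Fintype α] [Fintype β] (f : α → β → ℝ) (a : α) (b : β) :
    f a b ^ 2 ≤ ∑ x, ∑ y, f x y ^ 2 :=
  (Finset.single_le_sum (f := fun y => f a y ^ 2) (fun _ _ => sq_nonneg _)
    (Finset.mem_univ b)).trans
  (Finset.single_le_sum (f := fun x => ∑ y, f x y ^ 2)
    (fun _ _ => Finset.sum_nonneg fun _ _ => sq_nonneg _) (Finset.mem_univ a))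

theorem sqrt_sum_sum_sq_le {α β : Type*} [Fintype α] [Fintype β] (f : α → β → ℝ) :
    √(∑ x, ∑ y, f x y ^ 2) ≤ ∑ x, ∑ y, |f x y| := by
  rw [← Fintype.sum_prod_type', ← Fintype.sum_prod_type']
  refine Real.sqrt_le_iff.2 ⟨Finset.sum_nonneg fun _ _ => abs_nonneg _, ?_⟩
  simpa using Finset.sum_sq_le_sq_sum_of_nonneg (s := Finset.univ)
    (f := fun x : α × β => |f x.1 x.2|) fun _ _ => abs_nonneg _

/-- Expanding the frame in an orthonormal basis e gives coefficients c(e) and ⟨e, b⟩, which the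
frame bound controls by A. -/
theorem abs_comp_le_sqrt_tensorNormSq {A : ℝ} (hA : 0 ≤ A)
    (hb : ∀ i, ‖b i‖ ≤ A) (hc : ∀ i v, |c i v| ≤ A * ‖v‖) (T : TensorAt r k V)
    (I : Fin r → Fin n) (J : Fin k → Fin n) :
    |T (fun a => c (I a)) (fun a => b (J a))| ≤
      A ^ (r + k) * (Module.finrank ℝ V : ℝ) ^ (r + k) * √(tensorNormSq T) := by
  set e := stdOrthonormalBasis ℝ V with he
  have hI : (fun a => c (I a)) = fun a => ∑ i, c (I a) (e i) • (innerₗ V (e i) :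
      Module.Dual ℝ V) := by
    ext a v
    conv_lhs => rw [← e.sum_repr v, map_sum]
    simp [e.repr_apply_apply, mul_comm]
  have hJ : (fun a => b (J a)) = fun a => ∑ i, inner ℝ (e i) (b (J a)) • e i := by
    ext a
    exact (e.sum_repr' _).symm
  rw [hI, hJ]
  refine (abs_tensor_le T _ _ _ _ (A := A) (fun i x => ?_) (fun i x => ?_)).trans ?_
  · simpa using hc (I i) (e x)
  · refine (abs_real_inner_le_norm _ _).trans ?_
    simpa using hb (J i)
  · rw [mul_assoc]
    refine mul_le_mul_of_nonneg_left ?_ (pow_nonneg hA _)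
    have hle : ∀ (I' : Fin r → Fin (Module.finrank ℝ V)) (J' : Fin k → Fin (Module.finrank ℝ V)),
        |T (fun i => (innerₗ V (e (I' i)) : Module.Dual ℝ V)) (fun i => e (J' i))| ≤
          √(tensorNormSq T) := by
      intro I' J'
      exact Real.abs_le_sqrt (sq_le_sum_sum_sq (fun (I : Fin r → Fin (Module.finrank ℝ V))
        (J : Fin k → Fin (Module.finrank ℝ V)) =>
        T (fun i => (innerₗ V (e (I i)) : Module.Dual ℝ V)) (fun i => e (J i))) I' J')
    refine (Finset.sum_le_sum fun I' _ => Finset.sum_le_sum fun J' _ => hle I' J').trans_eq ?_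
    simp [pow_add, mul_assoc]

/-- The reverse expansion: an orthonormal basis written in the frame again has the coefficients ⟨e,
b⟩ and c(e), so the same bound A works in both directions. -/
theorem IsDualFrame.sqrt_tensorNormSq_le (h : IsDualFrame b c) {A : ℝ}
    (hb : ∀ i, ‖b i‖ ≤ A) (hc : ∀ i v, |c i v| ≤ A * ‖v‖) (T : TensorAt r k V) :
    √(tensorNormSq T) ≤ (Module.finrank ℝ V : ℝ) ^ (r + k) * A ^ (r + k) *
      ∑ I : Fin r → Fin n, ∑ J : Fin k → Fin n, |T (fun a => c (I a)) (fun a => b (J a))| := by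
  set e := stdOrthonormalBasis ℝ V with he
  set S := ∑ I : Fin r → Fin n, ∑ J : Fin k → Fin n, |T (fun a => c (I a)) (fun a => b (J a))|
  have hle : ∀ (I : Fin r → Fin (Module.finrank ℝ V)) (J : Fin k → Fin (Module.finrank ℝ V)),
      |T (fun i => (innerₗ V (e (I i)) : Module.Dual ℝ V)) (fun i => e (J i))| ≤
        A ^ (r + k) * S := by
    intro I J
    have hI : (fun a => (innerₗ V (e (I a)) : Module.Dual ℝ V)) =
        fun a => ∑ i, inner ℝ (e (I a)) (b i) • c i :=
      funext fun a => (h.dual_sum_eq (innerₗ V (e (I a)))).symm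
    have hJ : (fun a => e (J a)) = fun a => ∑ i, c i (e (J a)) • b i :=
      funext fun a => (h.sum_eq (e (J a))).symm
    rw [hI, hJ]
    refine abs_tensor_le T _ _ _ _ (A := A) (fun i x => ?_) (fun i x => ?_)
    · refine (abs_real_inner_le_norm _ _).trans ?_
      simpa using hb x
    · simpa using hc x (e (J i))
  have h1 : √(tensorNormSq T) ≤ ∑ I : Fin r → Fin (Module.finrank ℝ V),
      ∑ J : Fin k → Fin (Module.finrank ℝ V),
      |T (fun i => (innerₗ V (e (I i)) : Module.Dual ℝ V)) (fun i => e (J i))| := by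
    exact sqrt_sum_sum_sq_le (fun (I : Fin r → Fin (Module.finrank ℝ V))
      (J : Fin k → Fin (Module.finrank ℝ V)) =>
      T (fun i => (innerₗ V (e (I i)) : Module.Dual ℝ V)) (fun i => e (J i)))
  refine h1.trans ((Finset.sum_le_sum fun I _ => Finset.sum_le_sum fun J _ =>
    hle I J).trans_eq ?_)
  simp [pow_add, mul_assoc]

end TensorNorm

/-! ### Coordinate frames and changes of charts -/

theorem isOpen_transition_domain {X Y : Type*} [TopologicalSpace X] [TopologicalSpace Y]
    {φ ψ : OpenPartialHomeomorph X Y} :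
    IsOpen (φ.target ∩ φ.symm ⁻¹' ψ.source) :=
  φ.symm.isOpen_inter_preimage ψ.open_source

section Frames

variable {n : ℕ} {M : Type*} [TopologicalSpace M] [ChartedSpace (Model n) M]
  {φ ψ : OpenPartialHomeomorph M (Model n)}

/-- The coordinate vector field `∂_i` of the chart `φ`, as a function on `M`. -/
def frameVec (φ : OpenPartialHomeomorph M (Model n)) (i : Fin n) (x : M) :
    TangentSpace (𝓡 n) x :=
  (mfderiv (𝓡 n) 𝓘(ℝ, Model n) φ x :
    TangentSpace (𝓡 n) x →L[ℝ] Model n).inverse (stdVec i)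

/-- The coordinate covector field `dx^i` of the chart `φ`, as a function on `M`. -/
def frameCovec (φ : OpenPartialHomeomorph M (Model n)) (i : Fin n) (x : M) :
    Module.Dual ℝ (TangentSpace (𝓡 n) x) :=
  (EuclideanSpace.proj i : Model n →L[ℝ] ℝ).toLinearMap ∘ₗ
    (mfderiv (𝓡 n) 𝓘(ℝ, Model n) φ x : TangentSpace (𝓡 n) x →L[ℝ] Model n).toLinearMap

theorem coordCovec_eq (i : Fin n) (z : Model n) :
    coordCovec φ i z = frameCovec φ i (φ.symm z) := rfl

instance (x : M) : FiniteDimensional ℝ (TangentSpace (𝓡 n) x) :=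
  inferInstanceAs (FiniteDimensional ℝ (Model n))

theorem finrank_tangentSpace (x : M) : Module.finrank ℝ (TangentSpace (𝓡 n) x) = n :=
  (finrank_euclideanSpace (𝕜 := ℝ) (ι := Fin n)).trans (Fintype.card_fin n)

theorem mdifferentiableAt_chart (hφ : φ ∈ IsManifold.maximalAtlas (𝓡 n) ∞ M) {x : M}
    (hx : x ∈ φ.source) : MDifferentiableAt (𝓡 n) 𝓘(ℝ, Model n) φ x :=
  ((contMDiffOn_of_mem_maximalAtlas hφ).contMDiffAt (φ.open_source.mem_nhds hx)).mdifferentiableAt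
    (by simp)

theorem mdifferentiableAt_chart_symm (hφ : φ ∈ IsManifold.maximalAtlas (𝓡 n) ∞ M) {z : Model n}
    (hz : z ∈ φ.target) : MDifferentiableAt 𝓘(ℝ, Model n) (𝓡 n) φ.symm z :=
  ((contMDiffOn_symm_of_mem_maximalAtlas hφ).contMDiffAt
    (φ.open_target.mem_nhds hz)).mdifferentiableAt (by simp)

theorem mfderiv_chart_comp_symm (hφ : φ ∈ IsManifold.maximalAtlas (𝓡 n) ∞ M) {z : Model n}
    (hz : z ∈ φ.target) :
    (mfderiv (𝓡 n) 𝓘(ℝ, Model n) φ (φ.symm z) :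
      TangentSpace (𝓡 n) (φ.symm z) →L[ℝ] Model n).comp
      (mfderiv 𝓘(ℝ, Model n) (𝓡 n) φ.symm z : Model n →L[ℝ] TangentSpace (𝓡 n) (φ.symm z)) =
      ContinuousLinearMap.id ℝ (Model n) := by
  have h1 := mfderiv_comp z (mdifferentiableAt_chart hφ (φ.map_target hz))
    (mdifferentiableAt_chart_symm hφ hz)
  have h2 : (φ ∘ φ.symm) =ᶠ[𝓝 z] id := by
    filter_upwards [φ.open_target.mem_nhds hz] with y hy using φ.right_inv hy
  rw [h2.mfderiv_eq, mfderiv_id] at h1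
  exact h1.symm

/-- A one-sided inverse between spaces of equal finite dimension is two-sided. -/
theorem mfderiv_symm_comp_chart (hφ : φ ∈ IsManifold.maximalAtlas (𝓡 n) ∞ M) {z : Model n}
    (hz : z ∈ φ.target) :
    (mfderiv 𝓘(ℝ, Model n) (𝓡 n) φ.symm z : Model n →L[ℝ] TangentSpace (𝓡 n) (φ.symm z)).comp
      (mfderiv (𝓡 n) 𝓘(ℝ, Model n) φ (φ.symm z) :
      TangentSpace (𝓡 n) (φ.symm z) →L[ℝ] Model n) =
      ContinuousLinearMap.id ℝ (TangentSpace (𝓡 n) (φ.symm z)) := by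
  set A : TangentSpace (𝓡 n) (φ.symm z) →L[ℝ] Model n :=
    mfderiv (𝓡 n) 𝓘(ℝ, Model n) φ (φ.symm z)
  set B : Model n →L[ℝ] TangentSpace (𝓡 n) (φ.symm z) := mfderiv 𝓘(ℝ, Model n) (𝓡 n) φ.symm z
  have h : ∀ v, A (B v) = v := fun v => DFunLike.congr_fun (mfderiv_chart_comp_symm hφ hz) v
  have hB : Function.Surjective B.toLinearMap :=
    (LinearMap.injective_iff_surjective_of_finrank_eq_finrank
      (by rw [finrank_tangentSpace, finrank_euclideanSpace, Fintype.card_fin])).1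
      (Function.LeftInverse.injective (g := A) h)
  refine ContinuousLinearMap.ext fun v => ?_
  obtain ⟨w, rfl⟩ := hB v
  exact congrArg B (h w)

theorem coordVec_eq (hφ : φ ∈ IsManifold.maximalAtlas (𝓡 n) ∞ M) {z : Model n}
    (hz : z ∈ φ.target) (i : Fin n) : coordVec φ i z = frameVec φ i (φ.symm z) := by
  exact (DFunLike.congr_fun (ContinuousLinearMap.inverse_eq (mfderiv_chart_comp_symm hφ hz)
    (mfderiv_symm_comp_chart hφ hz)) (stdVec i)).symm

theorem mfderiv_chart_frameVec (hφ : φ ∈ IsManifold.maximalAtlas (𝓡 n) ∞ M) {x : M}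
    (hx : x ∈ φ.source) (i : Fin n) :
    (mfderiv (𝓡 n) 𝓘(ℝ, Model n) φ x (frameVec φ i x) : Model n) = stdVec i := by
  obtain ⟨z, hz, rfl⟩ : ∃ z ∈ φ.target, φ.symm z = x := ⟨φ x, φ.map_source hx, φ.left_inv hx⟩
  rw [← coordVec_eq hφ hz]
  exact DFunLike.congr_fun (mfderiv_chart_comp_symm hφ hz) (stdVec i)

theorem isDualFrame (hφ : φ ∈ IsManifold.maximalAtlas (𝓡 n) ∞ M) {x : M} (hx : x ∈ φ.source) :
    IsDualFrame (fun i => frameVec φ i x) (fun i => frameCovec φ i x) := by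
  refine ⟨fun i j => ?_, fun v => ?_⟩
  · change (EuclideanSpace.proj i : Model n →L[ℝ] ℝ)
      (mfderiv (𝓡 n) 𝓘(ℝ, Model n) φ x (frameVec φ j x) : Model n) = _
    rw [mfderiv_chart_frameVec hφ hx j]
    simp
  · obtain ⟨z, hz, rfl⟩ : ∃ z ∈ φ.target, φ.symm z = x := ⟨φ x, φ.map_source hx, φ.left_inv hx⟩
    set A : TangentSpace (𝓡 n) (φ.symm z) →L[ℝ] Model n :=
      mfderiv (𝓡 n) 𝓘(ℝ, Model n) φ (φ.symm z) with hA
    set B : Model n →L[ℝ] TangentSpace (𝓡 n) (φ.symm z) :=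
      mfderiv 𝓘(ℝ, Model n) (𝓡 n) φ.symm z with hB
    have h : B (A v) = v := DFunLike.congr_fun (mfderiv_symm_comp_chart hφ hz) v
    have h1 : ∀ i, frameVec φ i (φ.symm z) = B (stdVec i) := fun i => (coordVec_eq hφ hz i).symm
    have h2 : ∀ i, frameCovec φ i (φ.symm z) v = (A v) i := fun i => rfl
    have h3 : A v = ∑ i, (A v) i • stdVec i := by
      conv_lhs => rw [← (EuclideanSpace.basisFun (Fin n) ℝ).sum_repr (A v)]
      simp
    simp only [h1, h2]
    rw [← h]
    conv_rhs => rw [h3, map_sum]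
    simp only [map_smul, h]

/-- The component of a section in the chart `φ`, as a function on `M`. -/
def compAt {ι : Type*} {r k : ι → ℕ} (φ : OpenPartialHomeomorph M (Model n))
    (u : TensorSection (n := n) M r k) (j : ι) (I : Fin (r j) → Fin n) (J : Fin (k j) → Fin n)
    (x : M) : ℝ :=
  u x j (fun a => frameCovec φ (I a) x) (fun b => frameVec φ (J b) x)

variable {ι : Type*} {r k : ι → ℕ}

theorem comp_eq_compAt (hφ : φ ∈ IsManifold.maximalAtlas (𝓡 n) ∞ M) {z : Model n}
    (hz : z ∈ φ.target) (u : TensorSection (n := n) M r k) (j : ι) (I : Fin (r j) → Fin n)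
    (J : Fin (k j) → Fin n) : comp φ u j I J z = compAt φ u j I J (φ.symm z) := by
  unfold comp compAt
  simp only [coordVec_eq hφ hz, coordCovec_eq]

theorem comp_chart (hφ : φ ∈ IsManifold.maximalAtlas (𝓡 n) ∞ M) {x : M}
    (hx : x ∈ φ.source) (u : TensorSection (n := n) M r k) (j : ι) (I : Fin (r j) → Fin n)
    (J : Fin (k j) → Fin n) : comp φ u j I J (φ x) = compAt φ u j I J x := by
  rw [comp_eq_compAt hφ (φ.map_source hx), φ.left_inv hx]

theorem section_ext_of_compAt (hφ : φ ∈ IsManifold.maximalAtlas (𝓡 n) ∞ M) {x : M}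
    (hx : x ∈ φ.source) {u v : TensorSection (n := n) M r k}
    (h : ∀ j I J, compAt φ u j I J x = compAt φ v j I J x) : u x = v x :=
  funext fun j => (isDualFrame hφ hx).tensor_ext (h j)

/-- The Jacobian of the change of coordinates from `φ` to `ψ`. -/
def jacobian (φ ψ : OpenPartialHomeomorph M (Model n)) (i j : Fin n) (x : M) : ℝ :=
  frameCovec ψ i x (frameVec φ j x)

theorem compAt_change (hψ : ψ ∈ IsManifold.maximalAtlas (𝓡 n) ∞ M) {x : M}
    (hx' : x ∈ ψ.source)
    (u : TensorSection (n := n) M r k) (j : ι) (I : Fin (r j) → Fin n) (J : Fin (k j) → Fin n) :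
    compAt φ u j I J x = ∑ I' : Fin (r j) → Fin n, ∑ J' : Fin (k j) → Fin n,
      ((∏ a, jacobian ψ φ (I a) (I' a) x) * ∏ b, jacobian φ ψ (J' b) (J b) x) *
        compAt ψ u j I' J' x := by
  unfold compAt
  have h1 : (fun a => frameCovec φ (I a) x) = fun a => ∑ i, jacobian ψ φ (I a) i x •
      frameCovec ψ i x := funext fun a => ((isDualFrame hψ hx').dual_sum_eq _).symm
  have h2 : (fun b => frameVec φ (J b) x) = fun b => ∑ i, jacobian φ ψ i (J b) x •
      frameVec ψ i x := funext fun b => ((isDualFrame hψ hx').sum_eq _).symm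
  rw [h1, h2, tensor_expand]

theorem jacobian_eq_fderiv (hφ : φ ∈ IsManifold.maximalAtlas (𝓡 n) ∞ M)
    (hψ : ψ ∈ IsManifold.maximalAtlas (𝓡 n) ∞ M) {z : Model n} (hz : z ∈ φ.target)
    (hz' : φ.symm z ∈ ψ.source) (i j : Fin n) :
    jacobian φ ψ i j (φ.symm z) = fderiv ℝ (ψ ∘ φ.symm) z (stdVec j) i := by
  have h1 := mfderiv_comp z (mdifferentiableAt_chart hψ hz') (mdifferentiableAt_chart_symm hφ hz)
  rw [mfderiv_eq_fderiv] at h1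
  rw [h1, jacobian, ← coordVec_eq hφ hz]
  rfl

theorem contDiffOn_transition (hφ : φ ∈ IsManifold.maximalAtlas (𝓡 n) ∞ M)
    (hψ : ψ ∈ IsManifold.maximalAtlas (𝓡 n) ∞ M) :
    ContDiffOn ℝ ∞ (ψ ∘ φ.symm) (φ.target ∩ φ.symm ⁻¹' ψ.source) := by
  rw [← contMDiffOn_iff_contDiffOn]
  exact (contMDiffOn_of_mem_maximalAtlas hψ).comp
    ((contMDiffOn_symm_of_mem_maximalAtlas hφ).mono inter_subset_left) fun z hz => hz.2

/-- Transition maps are differentiable, and differentiable maps of ℝⁿ into itself send null sets to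
null sets. This is what makes null sets independent of the chart. -/
theorem volume_transition_null (hφ : φ ∈ IsManifold.maximalAtlas (𝓡 n) ∞ M)
    (hψ : ψ ∈ IsManifold.maximalAtlas (𝓡 n) ∞ M) {S : Set (Model n)} (hS : volume S = 0) :
    volume (ψ.target ∩ ψ.symm ⁻¹' (φ.source ∩ φ ⁻¹' S)) = 0 := by
  have h1 : DifferentiableOn ℝ (ψ ∘ φ.symm) (S ∩ (φ.target ∩ φ.symm ⁻¹' ψ.source)) :=
    ((contDiffOn_transition hφ hψ).differentiableOn (by simp)).mono inter_subset_right
  refine measure_mono_null ?_ (addHaar_image_eq_zero_of_differentiableOn_of_addHaar_eq_zero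
    volume h1 (measure_mono_null inter_subset_left hS))
  rintro z ⟨hz, hz1, hz2⟩
  refine ⟨φ (ψ.symm z), ⟨hz2, φ.map_source hz1, ?_⟩, ?_⟩
  · simpa [φ.left_inv hz1] using ψ.map_target hz
  · simp [φ.left_inv hz1, ψ.right_inv hz]

theorem continuousOn_jacobian (hφ : φ ∈ IsManifold.maximalAtlas (𝓡 n) ∞ M)
    (hψ : ψ ∈ IsManifold.maximalAtlas (𝓡 n) ∞ M) (i j : Fin n) :
    ContinuousOn (fun z => jacobian φ ψ i j (φ.symm z)) (φ.target ∩ φ.symm ⁻¹' ψ.source) := by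
  have h1 : ContinuousOn (fderiv ℝ (ψ ∘ φ.symm)) (φ.target ∩ φ.symm ⁻¹' ψ.source) :=
    (contDiffOn_transition hφ hψ).continuousOn_fderiv_of_isOpen isOpen_transition_domain (by simp)
  have h2 : ContinuousOn (fun z => fderiv ℝ (ψ ∘ φ.symm) z (stdVec j) i)
      (φ.target ∩ φ.symm ⁻¹' ψ.source) :=
    (EuclideanSpace.proj i : Model n →L[ℝ] ℝ).continuous.comp_continuousOn
      (h1.clm_apply continuousOn_const)
  exact h2.congr fun z hz => jacobian_eq_fderiv hφ hψ hz.1 hz.2 i j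

theorem jacobian_inv_continuousOn (hφ : φ ∈ IsManifold.maximalAtlas (𝓡 n) ∞ M)
    (hψ : ψ ∈ IsManifold.maximalAtlas (𝓡 n) ∞ M) (i j : Fin n) :
    ContinuousOn (fun z => jacobian ψ φ i j (φ.symm z)) (φ.target ∩ φ.symm ⁻¹' ψ.source) := by
  have h := (continuousOn_jacobian hψ hφ i j).comp (contDiffOn_transition hφ hψ).continuousOn
    (t := ψ.target ∩ ψ.symm ⁻¹' φ.source) (fun z hz => ⟨ψ.map_source hz.2, by
      simpa [ψ.left_inv hz.2] using φ.map_target hz.1⟩)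
  refine h.congr fun z hz => ?_
  simp [ψ.left_inv hz.2]

/-- The coordinate field is the tangent map of the smooth map `φ.symm` applied to a constant field.
-/
theorem contMDiffOn_coordVec [IsManifold (𝓡 n) ∞ M]
    (hφ : φ ∈ IsManifold.maximalAtlas (𝓡 n) ∞ M) (i : Fin n) :
    ContMDiffOn 𝓘(ℝ, Model n) (𝓡 n).tangent ∞
      (fun z => (⟨φ.symm z, coordVec φ i z⟩ : TangentBundle (𝓡 n) M)) φ.target := by
  have h1 : ContMDiffOn 𝓘(ℝ, Model n).tangent (𝓡 n).tangent ∞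
      (tangentMapWithin 𝓘(ℝ, Model n) (𝓡 n) φ.symm φ.target) _ :=
    (contMDiffOn_symm_of_mem_maximalAtlas hφ).contMDiffOn_tangentMapWithin (m := ∞) (by simp)
      φ.open_target.uniqueMDiffOn
  have h2 : ContMDiff 𝓘(ℝ, Model n) 𝓘(ℝ, Model n).tangent ∞
      (fun z : Model n => (⟨z, stdVec i⟩ : TangentBundle 𝓘(ℝ, Model n) (Model n))) := by
    exact contMDiff_vectorSpace_iff_contDiff.2 contDiff_const
  refine (h1.comp h2.contMDiffOn fun z hz => hz).congr fun z hz => ?_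
  simp only [Function.comp, tangentMapWithin]
  rw [mfderivWithin_of_isOpen φ.open_target hz]
  rfl

end Frames

/-! ### Metric coefficients, Christoffel symbols and the pointwise norm in a chart -/

section Metric

variable {n : ℕ} {M : Type*} [TopologicalSpace M] [ChartedSpace (Model n) M]
  [RiemannianBundle (fun x : M => TangentSpace (𝓡 n) x)]
  {φ : OpenPartialHomeomorph M (Model n)}

theorem metricCoeff_eq_gram (z : Model n) :
    metricCoeff φ z = Matrix.gram ℝ (fun i => coordVec φ i z) := rfl

theorem metricCoeff_posDef (hφ : φ ∈ IsManifold.maximalAtlas (𝓡 n) ∞ M) {z : Model n}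
    (hz : z ∈ φ.target) : (metricCoeff φ z).PosDef := by
  rw [metricCoeff_eq_gram]
  refine Matrix.posDef_gram_of_linearIndependent ?_
  simp only [coordVec_eq hφ hz]
  exact (isDualFrame hφ (φ.map_target hz)).linearIndependent

theorem det_metricCoeff_pos (hφ : φ ∈ IsManifold.maximalAtlas (𝓡 n) ∞ M) {z : Model n}
    (hz : z ∈ φ.target) : 0 < (metricCoeff φ z).det :=
  (metricCoeff_posDef hφ hz).det_pos

theorem norm_coordVec (i : Fin n) (z : Model n) : ‖coordVec φ i z‖ = √(metricCoeff φ z i i) := by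
  rw [norm_eq_sqrt_real_inner]
  rfl

/-- Inverting the Gram matrix expresses the coframe by the frame, so the norms of frame and coframe
are controlled by the metric coefficients and their inverse alone. -/
theorem coordCovec_apply (hφ : φ ∈ IsManifold.maximalAtlas (𝓡 n) ∞ M) {z : Model n}
    (hz : z ∈ φ.target) (i : Fin n) (v : TangentSpace (𝓡 n) (φ.symm z)) :
    coordCovec φ i z v = ∑ h, (metricCoeff φ z)⁻¹ i h * inner ℝ (coordVec φ h z) v := by
  have hdet : IsUnit (metricCoeff φ z).det := (det_metricCoeff_pos hφ hz).ne'.isUnit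
  have h1 : (fun h => inner ℝ (coordVec φ h z) v) =
      (metricCoeff φ z).mulVec (fun i => coordCovec φ i z v) := by
    funext h
    conv_lhs => rw [← (isDualFrame hφ (φ.map_target hz)).sum_eq v, inner_sum]
    simp only [← coordVec_eq hφ hz, ← coordCovec_eq, inner_smul_right]
    simp [Matrix.mulVec, dotProduct, metricCoeff, mul_comm]
  have h2 : (metricCoeff φ z)⁻¹.mulVec (fun h => inner ℝ (coordVec φ h z) v) =
      fun i => coordCovec φ i z v := by
    rw [h1, Matrix.mulVec_mulVec, Matrix.nonsing_inv_mul _ hdet, Matrix.one_mulVec]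
  exact (congrFun h2 i).symm

theorem abs_coordCovec_le (hφ : φ ∈ IsManifold.maximalAtlas (𝓡 n) ∞ M) {z : Model n}
    (hz : z ∈ φ.target) (i : Fin n) (v : TangentSpace (𝓡 n) (φ.symm z)) :
    |coordCovec φ i z v| ≤
      (∑ h, |(metricCoeff φ z)⁻¹ i h| * √(metricCoeff φ z h h)) * ‖v‖ := by
  rw [coordCovec_apply hφ hz, Finset.sum_mul]
  refine (Finset.abs_sum_le_sum_abs _ _).trans (Finset.sum_le_sum fun h _ => ?_)
  rw [abs_mul, mul_assoc, ← norm_coordVec]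
  exact mul_le_mul_of_nonneg_left (abs_real_inner_le_norm _ _) (abs_nonneg _)

theorem christoffel_eq_zero {z : Model n} {s : Set (Model n)} (hs : s ∈ 𝓝 z)
    (h1 : ∀ y ∈ s, metricCoeff φ y = 1) (m i j : Fin n) : christoffel φ m i j z = 0 := by
  have hd : ∀ a b : Fin n, fderiv ℝ (fun y => metricCoeff φ y a b) z = 0 := by
    intro a b
    have : (fun y => metricCoeff φ y a b) =ᶠ[𝓝 z] fun _ => (1 : Matrix (Fin n) (Fin n) ℝ) a b := by
      filter_upwards [hs] with y hy
      rw [h1 y hy]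
    rw [this.fderiv_eq, fderiv_const_apply]
  simp [christoffel, hd]

variable [IsManifold (𝓡 n) ∞ M]
  [IsContMDiffRiemannianBundle (𝓡 n) ∞ (Model n) (fun x : M => TangentSpace (𝓡 n) x)]

theorem contDiffOn_metricCoeff (hφ : φ ∈ IsManifold.maximalAtlas (𝓡 n) ∞ M) (i j : Fin n) :
    ContDiffOn ℝ ∞ (fun z => metricCoeff φ z i j) φ.target := by
  rw [← contMDiffOn_iff_contDiffOn]
  exact (contMDiffOn_coordVec hφ i).inner_bundle (contMDiffOn_coordVec hφ j)

theorem continuousOn_metricCoeff (hφ : φ ∈ IsManifold.maximalAtlas (𝓡 n) ∞ M) :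
    ContinuousOn (metricCoeff φ) φ.target :=
  continuousOn_pi.2 fun i => continuousOn_pi.2 fun j => (contDiffOn_metricCoeff hφ i j).continuousOn

theorem continuousOn_metricCoeff_inv (hφ : φ ∈ IsManifold.maximalAtlas (𝓡 n) ∞ M) (i j : Fin n) :
    ContinuousOn (fun z => (metricCoeff φ z)⁻¹ i j) φ.target := by
  have hc := continuousOn_metricCoeff hφ
  have h1 : ContinuousOn (fun z => (metricCoeff φ z).det) φ.target :=
    (Continuous.matrix_det continuous_id).comp_continuousOn hc
  have h2 : ContinuousOn (fun z => (metricCoeff φ z).adjugate i j) φ.target :=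
    ((Continuous.matrix_adjugate continuous_id).matrix_elem i j).comp_continuousOn hc
  refine ((h1.inv₀ fun z hz => (det_metricCoeff_pos hφ hz).ne').mul h2).congr fun z hz => ?_
  rw [Matrix.inv_def, Ring.inverse_eq_inv']
  rfl

theorem continuousOn_christoffel (hφ : φ ∈ IsManifold.maximalAtlas (𝓡 n) ∞ M) (m i j : Fin n) :
    ContinuousOn (christoffel φ m i j) φ.target := by
  have hd : ∀ a b c : Fin n, ContinuousOn
      (fun z => fderiv ℝ (fun y => metricCoeff φ y a b) z (stdVec c)) φ.target := fun a b c =>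
    ((contDiffOn_metricCoeff hφ a b).continuousOn_fderiv_of_isOpen φ.open_target
      (by simp)).clm_apply continuousOn_const
  unfold christoffel
  refine continuousOn_const.mul (continuousOn_finsetSum _ fun h _ => ?_)
  exact (continuousOn_metricCoeff_inv hφ m h).mul (((hd _ _ _).add (hd _ _ _)).sub (hd _ _ _))

end Metric

section PointNorm

variable {n : ℕ} {M : Type*} [TopologicalSpace M] [ChartedSpace (Model n) M]
  [RiemannianBundle (fun x : M => TangentSpace (𝓡 n) x)]
  {φ : OpenPartialHomeomorph M (Model n)}
  {ι : Type*} [Fintype ι] {r k : ι → ℕ}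

/-- The coordinate frame of `φ` and its dual are bounded by `A` at `x`. -/
def FrameBound (φ : OpenPartialHomeomorph M (Model n)) (A : ℝ) (x : M) : Prop :=
  (∀ i, ‖frameVec φ i x‖ ≤ A) ∧ ∀ i v, |frameCovec φ i x v| ≤ A * ‖v‖

/-- The constant which compares the norm of a tensor with its components. -/
def normConst (n : ℕ) (r k : ι → ℕ) (A : ℝ) : ℝ :=
  ∑ j, (n : ℝ) ^ (r j + k j) * A ^ (r j + k j)

theorem normConst_nonneg {A : ℝ} (hA : 0 ≤ A) : 0 ≤ normConst n r k A :=
  Finset.sum_nonneg fun _ _ => by positivity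

theorem le_normConst {A : ℝ} (hA : 0 ≤ A) (j : ι) :
    (n : ℝ) ^ (r j + k j) * A ^ (r j + k j) ≤ normConst n r k A :=
  Finset.single_le_sum (f := fun j => (n : ℝ) ^ (r j + k j) * A ^ (r j + k j))
    (fun _ _ => by positivity) (Finset.mem_univ j)

theorem pointNorm_nonneg (u : TensorSection (n := n) M r k) (x : M) : 0 ≤ pointNorm u x :=
  Real.sqrt_nonneg _

theorem sqrt_tensorNormSq_le_pointNorm (u : TensorSection (n := n) M r k) (x : M) (j : ι) :
    √(tensorNormSq (V := TangentSpace (𝓡 n) x) (u x j)) ≤ pointNorm u x :=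
  Real.sqrt_le_sqrt (Finset.single_le_sum
    (f := fun j => tensorNormSq (V := TangentSpace (𝓡 n) x) (u x j))
    (fun _ _ => tensorNormSq_nonneg _) (Finset.mem_univ j))

theorem pointNorm_le_sum (u : TensorSection (n := n) M r k) (x : M) :
    pointNorm u x ≤ ∑ j, √(tensorNormSq (V := TangentSpace (𝓡 n) x) (u x j)) := by
  refine Real.sqrt_le_iff.2 ⟨Finset.sum_nonneg fun _ _ => Real.sqrt_nonneg _, ?_⟩
  have h := Finset.sum_sq_le_sq_sum_of_nonneg (s := Finset.univ)
    (f := fun j => √(tensorNormSq (V := TangentSpace (𝓡 n) x) (u x j)))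
    fun _ _ => Real.sqrt_nonneg _
  refine le_trans (le_of_eq ?_) h
  exact Finset.sum_congr rfl fun j _ => (Real.sq_sqrt (tensorNormSq_nonneg _)).symm

theorem FrameBound.abs_compAt_le {A : ℝ} (hA : 0 ≤ A) {x : M} (h : FrameBound φ A x)
    (u : TensorSection (n := n) M r k) (j : ι) (I : Fin (r j) → Fin n) (J : Fin (k j) → Fin n) :
    |compAt φ u j I J x| ≤ normConst n r k A * pointNorm u x := by
  refine (abs_comp_le_sqrt_tensorNormSq hA h.1 h.2 (u x j) I J).trans ?_
  rw [finrank_tangentSpace, mul_comm (A ^ _)]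
  exact mul_le_mul (le_normConst hA j) (sqrt_tensorNormSq_le_pointNorm u x j) (Real.sqrt_nonneg _)
    (normConst_nonneg hA)

theorem FrameBound.pointNorm_le {A : ℝ} (hA : 0 ≤ A)
    (hφ : φ ∈ IsManifold.maximalAtlas (𝓡 n) ∞ M) {x : M} (hx : x ∈ φ.source)
    (h : FrameBound φ A x) (u : TensorSection (n := n) M r k) :
    pointNorm u x ≤ normConst n r k A * ∑ j, ∑ I : Fin (r j) → Fin n, ∑ J : Fin (k j) → Fin n,
      |compAt φ u j I J x| := by
  refine (pointNorm_le_sum u x).trans ?_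
  rw [Finset.mul_sum]
  refine Finset.sum_le_sum fun j _ => ?_
  refine ((isDualFrame hφ hx).sqrt_tensorNormSq_le h.1 h.2 (u x j)).trans ?_
  rw [finrank_tangentSpace]
  exact mul_le_mul_of_nonneg_right (le_normConst hA j)
    (Finset.sum_nonneg fun _ _ => Finset.sum_nonneg fun _ _ => abs_nonneg _)

theorem frameBound_one (hφ : φ ∈ IsManifold.maximalAtlas (𝓡 n) ∞ M) {z : Model n}
    (hz : z ∈ φ.target) (h1 : metricCoeff φ z = 1) : FrameBound φ 1 (φ.symm z) := by
  refine ⟨fun i => ?_, fun i v => ?_⟩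
  · rw [← coordVec_eq hφ hz, norm_coordVec, h1]
    simp
  · rw [← coordCovec_eq]
    refine (abs_coordCovec_le hφ hz i v).trans (le_of_eq ?_)
    simp [h1, Matrix.one_apply, abs_ite]

theorem exists_frameBound [IsManifold (𝓡 n) ∞ M]
    [IsContMDiffRiemannianBundle (𝓡 n) ∞ (Model n) (fun x : M => TangentSpace (𝓡 n) x)]
    (hφ : φ ∈ IsManifold.maximalAtlas (𝓡 n) ∞ M) {K : Set (Model n)} (hK : IsCompact K)
    (hKφ : K ⊆ φ.target) : ∃ A : ℝ, 0 ≤ A ∧ ∀ z ∈ K, FrameBound φ A (φ.symm z) := by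
  have hs : ∀ h, ContinuousOn (fun z => √(metricCoeff φ z h h)) φ.target := fun h =>
    (contDiffOn_metricCoeff hφ h h).continuousOn.sqrt
  have h1 : ContinuousOn (fun z => (∑ h, √(metricCoeff φ z h h)) +
      ∑ i, ∑ h, |(metricCoeff φ z)⁻¹ i h| * √(metricCoeff φ z h h)) φ.target :=
    (continuousOn_finsetSum _ fun h _ => hs h).add (continuousOn_finsetSum _ fun i _ =>
      continuousOn_finsetSum _ fun h _ => (continuousOn_metricCoeff_inv hφ i h).abs.mul (hs h))
  obtain ⟨A, hA⟩ := (hK.bddAbove_image (h1.mono hKφ))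
  refine ⟨max A 0, le_max_right _ _, fun z hz => ?_⟩
  have hA' := (hA (mem_image_of_mem _ hz)).trans (le_max_left A 0)
  have e1 : 0 ≤ ∑ h, √(metricCoeff φ z h h) := Finset.sum_nonneg fun _ _ => Real.sqrt_nonneg _
  have e3 : ∀ i, 0 ≤ ∑ h, |(metricCoeff φ z)⁻¹ i h| * √(metricCoeff φ z h h) := fun i =>
    Finset.sum_nonneg fun _ _ => by positivity
  have e2 : 0 ≤ ∑ i, ∑ h, |(metricCoeff φ z)⁻¹ i h| * √(metricCoeff φ z h h) :=
    Finset.sum_nonneg fun i _ => e3 i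
  refine ⟨fun i => ?_, fun i v => ?_⟩
  · rw [← coordVec_eq hφ (hKφ hz), norm_coordVec]
    have := Finset.single_le_sum (f := fun h => √(metricCoeff φ z h h))
      (fun _ _ => Real.sqrt_nonneg _) (Finset.mem_univ i)
    refine this.trans (le_trans ?_ hA')
    exact le_add_of_nonneg_right e2
  · rw [← coordCovec_eq]
    refine (abs_coordCovec_le hφ (hKφ hz) i v).trans ?_
    refine mul_le_mul_of_nonneg_right ?_ (norm_nonneg _)
    have := Finset.single_le_sum
      (f := fun i => ∑ h, |(metricCoeff φ z)⁻¹ i h| * √(metricCoeff φ z h h))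
      (fun i _ => e3 i) (Finset.mem_univ i)
    refine this.trans (le_trans ?_ hA')
    exact le_add_of_nonneg_left e1

theorem continuousOn_sqrt_det [IsManifold (𝓡 n) ∞ M]
    [IsContMDiffRiemannianBundle (𝓡 n) ∞ (Model n) (fun x : M => TangentSpace (𝓡 n) x)]
    (hφ : φ ∈ IsManifold.maximalAtlas (𝓡 n) ∞ M) :
    ContinuousOn (fun z => √((metricCoeff φ z).det)) φ.target :=
  ((Continuous.matrix_det continuous_id).comp_continuousOn (continuousOn_metricCoeff hφ)).sqrt

theorem aemeasurable_density [IsManifold (𝓡 n) ∞ M]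
    [IsContMDiffRiemannianBundle (𝓡 n) ∞ (Model n) (fun x : M => TangentSpace (𝓡 n) x)]
    (hφ : φ ∈ IsManifold.maximalAtlas (𝓡 n) ∞ M) :
    AEMeasurable (fun z => ENNReal.ofReal √((metricCoeff φ z).det)) (volume.restrict φ.target) :=
  ((continuousOn_sqrt_det hφ).aemeasurable φ.open_target.measurableSet).ennreal_ofReal

end PointNorm

/-! ### The Riemannian volume in charts -/

section ChartMeasurable

variable {n : ℕ} {M : Type*} [TopologicalSpace M] [MeasurableSpace M] [BorelSpace M]
  {φ : OpenPartialHomeomorph M (Model n)}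

theorem measurable_chart_piecewise [∀ x, Decidable (x ∈ φ.source)] :
    Measurable (φ.source.piecewise φ (fun _ => 0)) :=
  φ.continuousOn.measurable_piecewise continuousOn_const φ.open_source.measurableSet

theorem measurableSet_chart_preimage {B : Set (Model n)} (hB : MeasurableSet B) :
    MeasurableSet (φ.source ∩ φ ⁻¹' B) := by
  classical
  have h1 : φ.source ∩ φ ⁻¹' B =
      φ.source ∩ (φ.source.piecewise φ (fun _ => 0)) ⁻¹' B := by
    ext x
    refine and_congr_right fun hx => ?_
    rw [mem_preimage, mem_preimage, piecewise_eq_of_mem _ _ _ hx]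
  rw [h1]
  exact φ.open_source.measurableSet.inter (measurable_chart_piecewise hB)

theorem aemeasurable_chart_symm {g : Model n → ℝ≥0∞} :
    AEMeasurable φ.symm ((volume.restrict φ.target).withDensity g) :=
  (φ.symm.continuousOn.aemeasurable φ.open_target.measurableSet).mono_ac
    (withDensity_absolutelyContinuous _ _)

end ChartMeasurable

section Volume

variable {n : ℕ} {M : Type*} [TopologicalSpace M] [ChartedSpace (Model n) M]
  [RiemannianBundle (fun x : M => TangentSpace (𝓡 n) x)]
  [MeasurableSpace M] {φ : OpenPartialHomeomorph M (Model n)}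

/-- The Riemannian volume measure of the domain of the chart `φ`. -/
def chartVolume (φ : OpenPartialHomeomorph M (Model n)) : Measure M :=
  Measure.map φ.symm ((volume.restrict φ.target).withDensity
    fun z => ENNReal.ofReal √((metricCoeff φ z).det))

theorem chartVolume_le (hφ : φ ∈ IsManifold.maximalAtlas (𝓡 n) ∞ M) :
    chartVolume φ ≤ riemVolume n M :=
  le_iSup (fun φ : IsManifold.maximalAtlas (𝓡 n) ∞ M => chartVolume φ.1) ⟨φ, hφ⟩

variable [BorelSpace M]

/-- The volume is a supremum over all charts, usually uncountably many, but a countable covering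
family decides null sets: the exceptional sets of the charts `c i` have a measurable null hull on M,
and it is null in every other chart because transition maps preserve null sets. -/
theorem ae_riemVolume_of_ae_chart {κ : Type*} [Countable κ]
    (c : κ → OpenPartialHomeomorph M (Model n))
    (hc : ∀ i, c i ∈ IsManifold.maximalAtlas (𝓡 n) ∞ M) (hcover : ⋃ i, (c i).source = univ)
    {P : M → Prop} (h : ∀ i, ∀ᵐ z ∂(volume.restrict (c i).target), P ((c i).symm z)) :
    ∀ᵐ x ∂(riemVolume n M), P x := by
  set S : κ → Set (Model n) := fun i =>
    toMeasurable volume {z | ¬ (z ∈ (c i).target → P ((c i).symm z))} with hSdef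
  have hS : ∀ i, volume (S i) = 0 := by
    intro i
    have := h i
    rw [ae_restrict_iff' (c i).open_target.measurableSet, ae_iff] at this
    rw [hSdef, measure_toMeasurable, this]
  set N : Set M := ⋃ i, (c i).source ∩ c i ⁻¹' S i with hN
  have hNm : MeasurableSet N :=
    MeasurableSet.iUnion fun i => measurableSet_chart_preimage (measurableSet_toMeasurable _ _)
  have hnull : ∀ φ ∈ IsManifold.maximalAtlas (𝓡 n) ∞ M, chartVolume φ N = 0 := by
    intro φ hφ
    rw [chartVolume, Measure.map_apply_of_aemeasurable aemeasurable_chart_symm hNm]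
    refine withDensity_absolutelyContinuous _ _ ?_
    rw [hN, preimage_iUnion, measure_iUnion_null_iff]
    intro i
    rw [Measure.restrict_apply' φ.open_target.measurableSet, inter_comm]
    exact volume_transition_null (hc i) hφ (hS i)
  -- No chart measure charges `N`, so each lies below the restriction of the volume to the
  -- complement of `N`; hence so does their supremum, which gives `N` measure 0.
  have hle : riemVolume n M ≤ (riemVolume n M).restrict Nᶜ := by
    refine iSup_le fun φ => ?_
    have h1 : (chartVolume φ.1).restrict Nᶜ = chartVolume φ.1 :=
      Measure.restrict_eq_self_of_ae_mem (measure_eq_zero_iff_ae_notMem.1 (hnull φ.1 φ.2))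
    change chartVolume φ.1 ≤ _
    rw [← h1]
    exact Measure.restrict_mono_measure (chartVolume_le φ.2) _
  have hN0 : riemVolume n M N = 0 := by
    refine le_antisymm ((hle N).trans ?_) zero_le
    rw [Measure.restrict_apply hNm]
    simp
  rw [ae_iff]
  refine measure_mono_null (fun x hx => ?_) hN0
  obtain ⟨i, hi⟩ := mem_iUnion.1 (hcover.symm ▸ mem_univ x : x ∈ ⋃ i, (c i).source)
  refine mem_iUnion.2 ⟨i, hi, subset_toMeasurable _ _ fun h' => hx ?_⟩
  simpa [(c i).left_inv hi] using h' ((c i).map_source hi)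

variable [IsManifold (𝓡 n) ∞ M]
    [IsContMDiffRiemannianBundle (𝓡 n) ∞ (Model n) (fun x : M => TangentSpace (𝓡 n) x)]

/-- The density √det e is positive on the chart, so a set that is null for the volume is Lebesgue
null in coordinates. -/
theorem ae_chart_of_ae_riemVolume (hφ : φ ∈ IsManifold.maximalAtlas (𝓡 n) ∞ M) {P : M → Prop}
    (h : ∀ᵐ x ∂(riemVolume n M), P x) : ∀ᵐ z ∂(volume.restrict φ.target), P (φ.symm z) := by
  have h1 : ∀ᵐ x ∂(chartVolume φ), P x := ae_mono (chartVolume_le hφ) h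
  have h2 := ae_of_ae_map aemeasurable_chart_symm h1
  rw [ae_withDensity_iff' (aemeasurable_density hφ)] at h2
  filter_upwards [h2, ae_restrict_mem φ.open_target.measurableSet] with z hz hzt
  refine hz ?_
  simpa using det_metricCoeff_pos hφ hzt

/-- A lower bound c for the density costs the factor c⁻¹. No measurability of `F` is assumed: the
lower integral in the chart is attained by a measurable minorant, which is carried to M and extended
by zero. -/
theorem setLIntegral_chart_le (hφ : φ ∈ IsManifold.maximalAtlas (𝓡 n) ∞ M) (F : M → ℝ≥0∞)
    {B : Set (Model n)} (hBm : MeasurableSet B) (hB : B ⊆ φ.target) {c : ℝ≥0∞} (hc0 : c ≠ 0)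
    (hc : ∀ z ∈ B, c ≤ ENNReal.ofReal √((metricCoeff φ z).det)) :
    ∫⁻ z in B, F (φ.symm z) ≤ c⁻¹ * ∫⁻ x, F x ∂(riemVolume n M) := by
  classical
  have hct : ∀ (_ : B.Nonempty), c ≠ ⊤ := fun ⟨z, hz⟩ h => by simpa [h] using hc z hz
  rcases B.eq_empty_or_nonempty with rfl | hBne
  · simp
  obtain ⟨g, hgm, hgF, hgi⟩ := exists_measurable_le_lintegral_eq (volume.restrict B)
    fun z => F (φ.symm z)
  rw [hgi, ← ENNReal.mul_le_iff_le_inv hc0 (hct hBne)]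
  set G : M → ℝ≥0∞ := (φ.source ∩ φ ⁻¹' B).indicator fun x => g (φ x) with hG
  have hGm : Measurable G := by
    have h1 : G = (φ.source ∩ φ ⁻¹' B).indicator
        fun x => g (φ.source.piecewise φ (fun _ => 0) x) := by
      refine indicator_congr fun x hx => ?_
      rw [piecewise_eq_of_mem _ _ _ hx.1]
    rw [h1]
    exact (hgm.comp measurable_chart_piecewise).indicator (measurableSet_chart_preimage hBm)
  have hGF : ∀ x, G x ≤ F x := by
    intro x
    by_cases hx : x ∈ φ.source ∩ φ ⁻¹' B
    · rw [hG, indicator_of_mem hx]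
      have := hgF (φ x)
      simpa [φ.left_inv hx.1] using this
    · simp [hG, hx]
  calc c * ∫⁻ z in B, g z = ∫⁻ z in B, c * g z := (lintegral_const_mul _ hgm).symm
    _ ≤ ∫⁻ z in B, ENNReal.ofReal √((metricCoeff φ z).det) * G (φ.symm z) := by
        refine setLIntegral_mono' hBm fun z hz => ?_
        have : φ.symm z ∈ φ.source ∩ φ ⁻¹' B :=
          ⟨φ.map_target (hB hz), by simpa [φ.right_inv (hB hz)] using hz⟩
        rw [hG, indicator_of_mem this, φ.right_inv (hB hz)]
        gcongr
        exact hc z hz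
    _ ≤ ∫⁻ z in φ.target, ENNReal.ofReal √((metricCoeff φ z).det) * G (φ.symm z) :=
        lintegral_mono_set hB
    _ = ∫⁻ x, G x ∂(chartVolume φ) := by
        rw [chartVolume, lintegral_map' hGm.aemeasurable aemeasurable_chart_symm,
          lintegral_withDensity_eq_lintegral_mul₀' (aemeasurable_density hφ)
          (g := fun z => G (φ.symm z)) (hGm.comp_aemeasurable aemeasurable_chart_symm)]
        rfl
    _ ≤ ∫⁻ x, G x ∂(riemVolume n M) := lintegral_mono' (chartVolume_le hφ) le_rfl
    _ ≤ ∫⁻ x, F x ∂(riemVolume n M) := lintegral_mono hGF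

end Volume

/-! ### Distances in a flat chart -/

theorem clm_apply_eq_sum_stdVec {n : ℕ} {V : Type*} [AddCommGroup V] [Module ℝ V]
    [TopologicalSpace V] (L : Model n →L[ℝ] V) (w : Model n) :
    L w = ∑ i, w i • L (stdVec i) := by
  conv_lhs => rw [← (EuclideanSpace.basisFun (Fin n) ℝ).sum_repr w, map_sum]
  simp

section FlatChart

variable {n : ℕ} {M : Type*} [TopologicalSpace M] [ChartedSpace (Model n) M]
  [RiemannianBundle (fun x : M => TangentSpace (𝓡 n) x)]
  {φ : OpenPartialHomeomorph M (Model n)}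

theorem norm_mfderiv_symm_of_flat {z : Model n} (h1 : metricCoeff φ z = 1) (w : Model n) :
    ‖(mfderiv 𝓘(ℝ, Model n) (𝓡 n) φ.symm z : Model n →L[ℝ] TangentSpace (𝓡 n) (φ.symm z)) w‖ =
      ‖w‖ := by
  have hon : Orthonormal ℝ (fun i => coordVec φ i z) := by
    rw [orthonormal_iff_ite]
    intro i j
    have := congrFun (congrFun h1 i) j
    rw [Matrix.one_apply] at this
    exact this
  have hw : (mfderiv 𝓘(ℝ, Model n) (𝓡 n) φ.symm z :
      Model n →L[ℝ] TangentSpace (𝓡 n) (φ.symm z)) w = ∑ i, w i • coordVec φ i z := by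
    exact clm_apply_eq_sum_stdVec _ w
  rw [hw, norm_eq_sqrt_real_inner, hon.inner_sum, EuclideanSpace.norm_eq]
  simp [sq]

theorem norm_mfderiv_of_flat (hφ : φ ∈ IsManifold.maximalAtlas (𝓡 n) ∞ M) {z : Model n}
    (hz : z ∈ φ.target) (h1 : metricCoeff φ z = 1) (v : TangentSpace (𝓡 n) (φ.symm z))
    {w : Model n} (hw : w = (mfderiv (𝓡 n) 𝓘(ℝ, Model n) φ (φ.symm z) :
      TangentSpace (𝓡 n) (φ.symm z) →L[ℝ] Model n) v) : ‖w‖ = ‖v‖ := by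
  set B : Model n →L[ℝ] TangentSpace (𝓡 n) (φ.symm z) := mfderiv 𝓘(ℝ, Model n) (𝓡 n) φ.symm z
  have h : B w = v := by
    rw [hw]
    exact DFunLike.congr_fun (mfderiv_symm_comp_chart hφ hz) v
  calc ‖w‖ = ‖B w‖ := (norm_mfderiv_symm_of_flat h1 w).symm
    _ = ‖v‖ := by rw [h]

end FlatChart

section Distance

variable {n : ℕ} {M : Type*} [MetricSpace M] [ChartedSpace (Model n) M]
  [RiemannianBundle (fun x : M => TangentSpace (𝓡 n) x)]
  [IsRiemannianManifold (𝓡 n) M]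
  {φ : OpenPartialHomeomorph M (Model n)}

/-- The segment, carried to M, is a curve whose Riemannian length is its Euclidean length. -/
theorem dist_symm_le_of_flat (hφ : φ ∈ IsManifold.maximalAtlas (𝓡 n) ∞ M)
    (h1 : ∀ z ∈ φ.target, metricCoeff φ z = 1) {z w : Model n}
    (hzw : segment ℝ z w ⊆ φ.target) : dist (φ.symm z) (φ.symm w) ≤ dist z w := by
  have hsub : ∀ t ∈ Icc (0 : ℝ) 1, AffineMap.lineMap z w t ∈ φ.target := fun t ht =>
    hzw (by rw [segment_eq_image_lineMap]; exact mem_image_of_mem _ ht)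
  let l : ℝ →ᴬ[ℝ] Model n := ContinuousAffineMap.lineMap z w
  have hl : ∀ t, l t = AffineMap.lineMap z w t := fun t => rfl
  have hlc : ContMDiff 𝓘(ℝ, ℝ) 𝓘(ℝ, Model n) 1 l := l.contDiff.contMDiff
  let γ : ℝ → M := fun t => φ.symm (l t)
  have hγ : ContMDiffOn 𝓘(ℝ, ℝ) (𝓡 n) 1 γ (Icc 0 1) :=
    ((contMDiffOn_symm_of_mem_maximalAtlas hφ).of_le (by simp)).comp hlc.contMDiffOn
      fun t ht => hsub t ht
  have key := riemannianEDist_le_pathELength (I := 𝓡 n) hγ (x := φ.symm z) (y := φ.symm w)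
    (by simp [γ, hl]) (by simp [γ, hl]) zero_le_one
  rw [← IsRiemannianManifold.out (I := 𝓡 n), pathELength_eq_lintegral_mfderiv_Ioo] at key
  have hder : ∀ t ∈ Ioo (0 : ℝ) 1,
      ‖(mfderiv 𝓘(ℝ, ℝ) (𝓡 n) γ t : ℝ →L[ℝ] TangentSpace (𝓡 n) (γ t)) 1‖ₑ = edist z w := by
    intro t ht
    have ht' := hsub t ⟨ht.1.le, ht.2.le⟩
    have hd : HasDerivAt l (w - z) t := by
      have := AffineMap.hasDerivAt_lineMap (a := z) (b := w) (x := t)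
      exact this
    have hc := mfderiv_comp t (mdifferentiableAt_chart_symm hφ ht')
      (hlc.mdifferentiableAt (by simp) (x := t))
    have hl1 : (mfderiv 𝓘(ℝ, ℝ) 𝓘(ℝ, Model n) l t : ℝ →L[ℝ] Model n) 1 = w - z := by
      rw [mfderiv_eq_fderiv]
      exact (fderiv_apply_one_eq_deriv).trans hd.deriv
    have h2 : (mfderiv 𝓘(ℝ, ℝ) (𝓡 n) γ t : ℝ →L[ℝ] TangentSpace (𝓡 n) (γ t)) 1 =
        (mfderiv 𝓘(ℝ, Model n) (𝓡 n) φ.symm (l t) :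
          Model n →L[ℝ] TangentSpace (𝓡 n) (φ.symm (l t))) (w - z) := by
      rw [← hl1]
      exact DFunLike.congr_fun hc 1
    rw [h2, edist_comm, edist_eq_enorm_sub, ← ofReal_norm, ← ofReal_norm]
    exact congrArg _ (norm_mfderiv_symm_of_flat (h1 _ ht') (w - z))
  rw [setLIntegral_congr_fun measurableSet_Ioo hder] at key
  simp only [lintegral_const, Measure.restrict_apply MeasurableSet.univ, univ_inter,
    Real.volume_Ioo, sub_zero, ENNReal.ofReal_one, mul_one] at key
  rwa [edist_dist, edist_dist, ENNReal.ofReal_le_ofReal_iff dist_nonneg] at key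

/-- A curve from the centre of length less than ρ cannot leave the image of the ball: while it stays
there its reading in the chart has the same length, so it remains strictly inside the sphere of
radius ρ. This is a continuity argument along the curve. -/
theorem ball_subset_image_of_flat [IsManifold (𝓡 n) ∞ M]
    (hφ : φ ∈ IsManifold.maximalAtlas (𝓡 n) ∞ M)
    (h1 : ∀ z ∈ φ.target, metricCoeff φ z = 1) {z : Model n} {ρ : ℝ}
    (hρ : Metric.closedBall z ρ ⊆ φ.target) {y : M} (hy : dist (φ.symm z) y < ρ) :
    y ∈ φ.symm '' Metric.closedBall z ρ := by
  have hρ0 : 0 < ρ := dist_nonneg.trans_lt hy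
  set u := φ.symm '' Metric.closedBall z ρ with hu
  have hzu : z ∈ Metric.closedBall z ρ := Metric.mem_closedBall_self hρ0.le
  have hus : u ⊆ φ.source := by
    rintro _ ⟨w, hw, rfl⟩
    exact φ.map_target (hρ hw)
  have u_closed : IsClosed u :=
    ((isCompact_closedBall z ρ).image_of_continuousOn (φ.symm.continuousOn.mono hρ)).isClosed
  set v := φ.source ∩ φ ⁻¹' Metric.ball z ρ with hv
  have v_open : IsOpen v := φ.isOpen_inter_preimage Metric.isOpen_ball
  have hvu : v ⊆ u := fun x hx => ⟨φ x, Metric.ball_subset_closedBall hx.2, φ.left_inv hx.1⟩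
  have hlt : riemannianEDist (𝓡 n) (φ.symm z) y < ENNReal.ofReal ρ := by
    rw [← IsRiemannianManifold.out (I := 𝓡 n), edist_dist]
    exact (ENNReal.ofReal_lt_ofReal_iff hρ0).2 hy
  obtain ⟨γ, hγx, hγy, γ_smooth, hγ, -⟩ :=
    exists_lt_locally_constant_of_riemannianEDist_lt hlt zero_lt_one
  let A := γ ⁻¹' u
  have zero_mem : 0 ∈ A := by
    change γ 0 ∈ u
    rw [hγx]
    exact mem_image_of_mem _ hzu
  have A_closed : IsClosed (A ∩ Icc 0 1) :=
    (u_closed.preimage γ_smooth.continuous).inter isClosed_Icc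
  suffices h : Icc 0 1 ⊆ A by
    have : 1 ∈ A := h ⟨zero_le_one, le_rfl⟩
    rw [← hγy]
    exact this
  apply A_closed.Icc_subset_of_forall_mem_nhdsGT_of_Icc_subset zero_mem
  rintro t₁ ⟨ht₁0, ht₁1⟩ t₁_mem
  -- At time `t₁` the curve is even in the open set `v`, hence stays in `u` for a while longer.
  suffices h : γ t₁ ∈ v from
    γ_smooth.continuous.continuousWithinAt <| mem_of_superset (v_open.mem_nhds h) hvu
  let γ' : ℝ → Model n := φ ∘ γ
  have hC : ContMDiffOn 𝓘(ℝ, ℝ) 𝓘(ℝ, Model n) 1 γ' (Icc 0 t₁) :=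
    ((contMDiffOn_of_mem_maximalAtlas hφ).of_le (by simp)).comp
      γ_smooth.contMDiffOn (fun t' ht' ↦ hus <| t₁_mem ht')
  have hfin : ‖γ' t₁ - γ' 0‖ₑ < ENNReal.ofReal ρ := by
    rcases ht₁0.eq_or_lt with rfl | htpos
    · simpa using hρ0
    calc
      ‖γ' t₁ - γ' 0‖ₑ
    _ ≤ ∫⁻ t' in Icc 0 t₁, ‖derivWithin γ' (Icc 0 t₁) t'‖ₑ := by
      apply enorm_sub_le_lintegral_derivWithin_Icc_of_contDiffOn_Icc _ ht₁0
      rwa [← contMDiffOn_iff_contDiffOn]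
    _ = ∫⁻ t' in Icc 0 t₁, ‖mfderivWithin 𝓘(ℝ, ℝ) (𝓡 n) γ (Icc 0 t₁) t' 1‖ₑ := by
      refine setLIntegral_congr_fun measurableSet_Icc fun t' ht' ↦ ?_
      have e1 : mfderivWithin 𝓘(ℝ, ℝ) 𝓘(ℝ, Model n) γ' (Icc 0 t₁) t' =
          (mfderiv (𝓡 n) 𝓘(ℝ, Model n) φ (γ t')) ∘L
            (mfderivWithin 𝓘(ℝ, ℝ) (𝓡 n) γ (Icc 0 t₁) t') := by
        apply mfderiv_comp_mfderivWithin
        · exact mdifferentiableAt_chart hφ (hus (t₁_mem ht'))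
        · exact (γ_smooth.mdifferentiable one_ne_zero).mdifferentiableOn _ ht'
        · rw [uniqueMDiffWithinAt_iff_uniqueDiffWithinAt]
          exact uniqueDiffOn_Icc htpos _ ht'
      have e2 : derivWithin γ' (Icc 0 t₁) t' =
          (mfderiv (𝓡 n) 𝓘(ℝ, Model n) φ (γ t') : TangentSpace (𝓡 n) (γ t') →L[ℝ] Model n)
            (mfderivWithin 𝓘(ℝ, ℝ) (𝓡 n) γ (Icc 0 t₁) t' 1) := by
        rw [← fderivWithin_derivWithin, ← mfderivWithin_eq_fderivWithin]
        exact DFunLike.congr_fun e1 1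
      rw [e2]
      obtain ⟨w, hw, hwγ⟩ : γ t' ∈ u := t₁_mem ht'
      generalize (mfderivWithin 𝓘(ℝ, ℝ) (𝓡 n) γ (Icc 0 t₁) t' 1) = b
      revert b
      rw [← hwγ]
      intro b
      set a : Model n := (mfderiv (𝓡 n) 𝓘(ℝ, Model n) φ (φ.symm w) :
        TangentSpace (𝓡 n) (φ.symm w) →L[ℝ] Model n) b
      have e3 : ‖a‖ = ‖b‖ := norm_mfderiv_of_flat hφ (hρ hw) (h1 w (hρ hw)) b rfl
      change ‖a‖ₑ = ‖b‖ₑ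
      rw [← ofReal_norm, ← ofReal_norm, e3]
    _ = pathELength (𝓡 n) γ 0 t₁ := by
      rw [pathELength_eq_lintegral_mfderivWithin_Icc]
    _ ≤ pathELength (𝓡 n) γ 0 1 := pathELength_mono le_rfl ht₁1.le
    _ < ENNReal.ofReal ρ := hγ
  refine ⟨hus (t₁_mem ⟨ht₁0, le_rfl⟩), ?_⟩
  rw [mem_preimage, Metric.mem_ball, dist_eq_norm]
  have h0 : γ' 0 = z := by simp [γ', hγx, φ.right_inv (hρ hzu)]
  rw [h0, ← ofReal_norm, ENNReal.ofReal_lt_ofReal_iff hρ0] at hfin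
  exact hfin

end Distance

/-! ### The weight, and balls of comparable radius with controlled geometry -/

section Weight

variable {M : Type*} [MetricSpace M]

theorem one_le_weight (o x : M) : 1 ≤ weight o x := by
  rw [weight, Real.one_le_sqrt]
  nlinarith [sq_nonneg (dist x o)]

theorem weight_pos (o x : M) : 0 < weight o x := zero_lt_one.trans_le (one_le_weight o x)

theorem continuous_weight (o : M) : Continuous (weight o) := by
  unfold weight
  fun_prop

theorem dist_le_weight (o x : M) : dist x o ≤ weight o x := by
  rw [weight]
  exact Real.le_sqrt_of_sq_le (by linarith)

theorem weight_le_one_add (o x : M) : weight o x ≤ 1 + dist x o := by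
  rw [weight, Real.sqrt_le_left (by positivity)]
  nlinarith [dist_nonneg (x := x) (y := o)]

theorem weight_le_add_dist (o x y : M) : weight o x ≤ weight o y + dist x y := by
  have h1 := weight_pos o y
  have h2 := dist_le_weight o y
  have h3 := dist_triangle x y o
  have h4 : weight o y ^ 2 = 1 + dist y o ^ 2 := Real.sq_sqrt (by positivity)
  have h5 := dist_nonneg (x := x) (y := y)
  have h6 := dist_nonneg (x := x) (y := o)
  rw [weight, Real.sqrt_le_left (by positivity)]
  nlinarith

end Weight

section GoodBall

variable {n : ℕ} {M : Type*} [MetricSpace M] [ChartedSpace (Model n) M]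
  [RiemannianBundle (fun x : M => TangentSpace (𝓡 n) x)]
  {φ : OpenPartialHomeomorph M (Model n)} {o : M}

/-- In the chart `φ`, the geometry of the ball of radius `T` around `x` is controlled by `Λ`. -/
structure GoodBall (o : M) (Λ : ℝ) (φ : OpenPartialHomeomorph M (Model n)) (T : ℝ) (x : M) :
    Prop where
  mem_atlas : φ ∈ IsManifold.maximalAtlas (𝓡 n) ∞ M
  mem_source : x ∈ φ.source
  radius_pos : 0 < T
  closedBall_subset : Metric.closedBall (φ x) T ⊆ φ.target
  frame : ∀ z ∈ Metric.closedBall (φ x) T, FrameBound φ Λ (φ.symm z)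
  density : ∀ z ∈ Metric.closedBall (φ x) T, 1 ≤ Λ * √((metricCoeff φ z).det)
  christoffel_le : ∀ z ∈ Metric.closedBall (φ x) T, ∀ m i j, T * |christoffel φ m i j z| ≤ Λ
  radius_le : T ≤ Λ * weight o x
  weight_le_radius : weight o x ≤ Λ * T
  weight_le : ∀ z ∈ Metric.closedBall (φ x) T, weight o (φ.symm z) ≤ Λ * weight o x
  le_weight : ∀ z ∈ Metric.closedBall (φ x) T, weight o x ≤ Λ * weight o (φ.symm z)

theorem GoodBall.mono {Λ Λ' T : ℝ} {x : M} (h : GoodBall o Λ φ T x) (hΛ : Λ ≤ Λ') :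
    GoodBall o Λ' φ T x where
  mem_atlas := h.mem_atlas
  mem_source := h.mem_source
  radius_pos := h.radius_pos
  closedBall_subset := h.closedBall_subset
  frame z hz := ⟨fun i => ((h.frame z hz).1 i).trans hΛ, fun i v =>
    ((h.frame z hz).2 i v).trans (mul_le_mul_of_nonneg_right hΛ (norm_nonneg _))⟩
  density z hz := (h.density z hz).trans (mul_le_mul_of_nonneg_right hΛ (Real.sqrt_nonneg _))
  christoffel_le z hz m i j := (h.christoffel_le z hz m i j).trans hΛ
  radius_le := h.radius_le.trans (mul_le_mul_of_nonneg_right hΛ (weight_pos _ _).le)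
  weight_le_radius := h.weight_le_radius.trans (mul_le_mul_of_nonneg_right hΛ h.radius_pos.le)
  weight_le z hz := (h.weight_le z hz).trans (mul_le_mul_of_nonneg_right hΛ (weight_pos _ _).le)
  le_weight z hz := (h.le_weight z hz).trans (mul_le_mul_of_nonneg_right hΛ (weight_pos _ _).le)

theorem GoodBall.one_le {Λ T : ℝ} {x : M} (h : GoodBall o Λ φ T x) : 1 ≤ Λ := by
  have h1 := h.weight_le _ (Metric.mem_closedBall_self h.radius_pos.le)
  rw [φ.left_inv h.mem_source] at h1
  exact (le_mul_iff_one_le_left (weight_pos _ _)).1 h1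

variable [IsManifold (𝓡 n) ∞ M]
  [IsContMDiffRiemannianBundle (𝓡 n) ∞ (Model n) (fun x : M => TangentSpace (𝓡 n) x)]

/-- All the quantities to be controlled are continuous, hence bounded, on a compact coordinate ball
of radius ρ about x₀; balls of radius ρ / 2 about nearby points stay inside it, so one `Λ` and one
`T` serve a whole neighbourhood. -/
theorem exists_goodBall_near (o : M) (hφ : φ ∈ IsManifold.maximalAtlas (𝓡 n) ∞ M) {x₀ : M}
    (hx₀ : x₀ ∈ φ.source) : ∃ Λ T, ∀ᶠ x in 𝓝 x₀, GoodBall o Λ φ T x := by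
  obtain ⟨ρ, hρ, hρφ⟩ := Metric.nhds_basis_closedBall.mem_iff.1
    (φ.open_target.mem_nhds (φ.map_source hx₀))
  set B := Metric.closedBall (φ x₀) ρ with hBdef
  have hB : IsCompact B := isCompact_closedBall _ _
  obtain ⟨A, hA0, hA⟩ := exists_frameBound hφ hB hρφ
  have hdetinv : ContinuousOn (fun z => (√((metricCoeff φ z).det))⁻¹) φ.target :=
    (continuousOn_sqrt_det hφ).inv₀ fun z hz => (Real.sqrt_pos.2 (det_metricCoeff_pos hφ hz)).ne'
  obtain ⟨D, hD⟩ := hB.bddAbove_image (hdetinv.mono hρφ)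
  have hchr : ContinuousOn (fun z => ∑ m, ∑ i, ∑ j, |christoffel φ m i j z|) φ.target :=
    continuousOn_finsetSum _ fun m _ => continuousOn_finsetSum _ fun i _ =>
      continuousOn_finsetSum _ fun j _ => (continuousOn_christoffel hφ m i j).abs
  obtain ⟨G, hG⟩ := hB.bddAbove_image (hchr.mono hρφ)
  obtain ⟨S, hS⟩ := hB.bddAbove_image
    (((continuous_weight o).comp_continuousOn φ.symm.continuousOn).mono hρφ)
  set T := ρ / 2 with hT
  have hT0 : 0 < T := half_pos hρ
  have hxB : φ x₀ ∈ B := Metric.mem_closedBall_self hρ.le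
  have hS1 : 1 ≤ S := (one_le_weight o _).trans (hS (mem_image_of_mem _ hxB))
  have hG0 : 0 ≤ G := le_trans (Finset.sum_nonneg fun _ _ => Finset.sum_nonneg fun _ _ =>
    Finset.sum_nonneg fun _ _ => abs_nonneg _) (hG (mem_image_of_mem _ hxB))
  have hD0 : 0 ≤ D := le_trans (inv_nonneg.2 (Real.sqrt_nonneg _)) (hD (mem_image_of_mem _ hxB))
  -- One summand per requirement, in order: frame, density, Christoffel symbols, `T` against the
  -- weight (which is at least 1), the weight against `T`, and the two comparisons of weights.
  set Λ := A + D + T * G + T + S / T + S with hΛ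
  have hST : 0 ≤ S / T := by positivity
  have hTG : 0 ≤ T * G := by positivity
  have hΛA : A ≤ Λ := by linarith
  have hΛD : D ≤ Λ := by linarith
  have hΛG : T * G ≤ Λ := by linarith
  have hΛT : T ≤ Λ := by linarith
  have hΛST : S / T ≤ Λ := by linarith
  have hΛS : S ≤ Λ := by linarith
  have hΛ0 : 0 ≤ Λ := by linarith
  refine ⟨Λ, T, ?_⟩
  filter_upwards [φ.open_source.mem_nhds hx₀,
    (φ.continuousAt hx₀).preimage_mem_nhds (Metric.ball_mem_nhds _ hT0)] with x hx hxT
  have hsub : Metric.closedBall (φ x) T ⊆ B := Metric.closedBall_subset_closedBall' (by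
    have := Metric.mem_ball.1 hxT
    linarith)
  have hwS : ∀ z ∈ B, weight o (φ.symm z) ≤ S := fun z hz => hS (mem_image_of_mem _ hz)
  have hwx : weight o x ≤ S := by
    have := hwS (φ x) (hsub (Metric.mem_closedBall_self hT0.le))
    rwa [φ.left_inv hx] at this
  refine ⟨hφ, hx, hT0, hsub.trans hρφ, fun z hz => ?_, fun z hz => ?_, fun z hz m i j => ?_, ?_, ?_,
    fun z hz => ?_, fun z hz => ?_⟩
  · have h := hA z (hsub hz)
    exact ⟨fun i => (h.1 i).trans hΛA, fun i v =>
      (h.2 i v).trans (mul_le_mul_of_nonneg_right hΛA (norm_nonneg _))⟩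
  · have h1 := Real.sqrt_pos.2 (det_metricCoeff_pos hφ (hρφ (hsub hz)))
    have h2 : (√((metricCoeff φ z).det))⁻¹ ≤ Λ := (hD (mem_image_of_mem _ (hsub hz))).trans hΛD
    calc 1 = (√((metricCoeff φ z).det))⁻¹ * √((metricCoeff φ z).det) :=
          (inv_mul_cancel₀ h1.ne').symm
      _ ≤ _ := mul_le_mul_of_nonneg_right h2 h1.le
  · refine le_trans (mul_le_mul_of_nonneg_left ?_ hT0.le) hΛG
    refine le_trans ?_ (hG (mem_image_of_mem _ (hsub hz)))
    have e1 := Finset.single_le_sum (f := fun j => |christoffel φ m i j z|)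
      (fun _ _ => abs_nonneg _) (Finset.mem_univ j)
    have e2 := Finset.single_le_sum (f := fun i => ∑ j, |christoffel φ m i j z|)
      (fun _ _ => Finset.sum_nonneg fun _ _ => abs_nonneg _) (Finset.mem_univ i)
    have e3 := Finset.single_le_sum (f := fun m => ∑ i, ∑ j, |christoffel φ m i j z|)
      (fun _ _ => Finset.sum_nonneg fun _ _ => Finset.sum_nonneg fun _ _ => abs_nonneg _)
      (Finset.mem_univ m)
    exact e1.trans (e2.trans e3)
  · exact hΛT.trans (le_mul_of_one_le_right hΛ0 (one_le_weight _ _))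
  · refine hwx.trans ?_
    rwa [← div_le_iff₀ hT0]
  · exact (hwS z (hsub hz)).trans (hΛS.trans (le_mul_of_one_le_right hΛ0 (one_le_weight _ _)))
  · exact hwx.trans (hΛS.trans (le_mul_of_one_le_right hΛ0 (one_le_weight _ _)))

theorem exists_goodBall_compact (o : M) {K : Set M} (hK : IsCompact K) :
    ∃ Λ : ℝ, ∀ x ∈ K, ∃ (φ : OpenPartialHomeomorph M (Model n)) (T : ℝ), GoodBall o Λ φ T x := by
  refine hK.induction_on (p := fun s => ∃ Λ : ℝ, ∀ x ∈ s,
    ∃ (φ : OpenPartialHomeomorph M (Model n)) (T : ℝ), GoodBall o Λ φ T x) ⟨0, by simp⟩ ?_ ?_ ?_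
  · rintro s t hst ⟨Λ, h⟩
    exact ⟨Λ, fun x hx => h x (hst hx)⟩
  · rintro s t ⟨Λ, h⟩ ⟨Λ', h'⟩
    refine ⟨max Λ Λ', fun x hx => ?_⟩
    rcases hx with hx | hx
    · obtain ⟨φ, T, hg⟩ := h x hx
      exact ⟨φ, T, hg.mono (le_max_left _ _)⟩
    · obtain ⟨φ, T, hg⟩ := h' x hx
      exact ⟨φ, T, hg.mono (le_max_right _ _)⟩
  · intro x _
    obtain ⟨Λ, T, h⟩ := exists_goodBall_near o
      (IsManifold.chart_mem_maximalAtlas (I := 𝓡 n) (n := ∞) x) (mem_chart_source (Model n) x)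
    exact ⟨_, mem_nhdsWithin_of_mem_nhds h, Λ, fun y hy => ⟨_, T, hy⟩⟩

end GoodBall

/-! ### The ends: compactness of the core and uniform control of the geometry -/

section Ends

variable {n : ℕ} {M : Type*} [MetricSpace M] [ChartedSpace (Model n) M]
  [RiemannianBundle (fun x : M => TangentSpace (𝓡 n) x)]

/-- The data of the definition of a manifold which is Euclidean at infinity. -/
structure IsEnds (K : Set M) {N : ℕ} (R : Fin N → ℝ)
    (Φ : Fin N → OpenPartialHomeomorph M (Model n)) : Prop where
  compact : IsCompact K
  compl_eq : Kᶜ = ⋃ i, (Φ i).source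
  pos : ∀ i, 0 < R i
  mem_atlas : ∀ i, Φ i ∈ IsManifold.maximalAtlas (𝓡 n) ∞ M
  target_eq : ∀ i, (Φ i).target = (Metric.closedBall 0 (R i))ᶜ
  flat : ∀ i, ∀ z ∈ (Φ i).target, metricCoeff (Φ i) z = 1

/-- The points outside the parts `{A < |z|}` of the ends. -/
def core {N : ℕ} (Φ : Fin N → OpenPartialHomeomorph M (Model n)) (A : ℝ) : Set M :=
  (⋃ i, (Φ i).source ∩ Φ i ⁻¹' {z | A < ‖z‖})ᶜ

variable {K : Set M} {N : ℕ} {R : Fin N → ℝ} {Φ : Fin N → OpenPartialHomeomorph M (Model n)}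

theorem IsEnds.mem_target (h : IsEnds K R Φ) {i : Fin N} {z : Model n} :
    z ∈ (Φ i).target ↔ R i < ‖z‖ := by
  rw [h.target_eq]
  simp

theorem IsEnds.segment_smul_subset (h : IsEnds K R Φ) {i : Fin N} {z : Model n} {s t : ℝ}
    (hs : R i < s * ‖z‖) (ht : R i < t * ‖z‖) : segment ℝ (s • z) (t • z) ⊆ (Φ i).target := by
  rintro _ ⟨a, b, ha, hb, hab, rfl⟩
  rw [h.mem_target, smul_smul, smul_smul, ← add_smul, norm_smul]
  have h1 : a * (s * ‖z‖) + b * (t * ‖z‖) ≤ ‖a * s + b * t‖ * ‖z‖ := by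
    rw [Real.norm_eq_abs]
    have := mul_le_mul_of_nonneg_right (le_abs_self (a * s + b * t)) (norm_nonneg z)
    linarith
  refine lt_of_lt_of_le ?_ h1
  have h2 : a * R i + b * R i = R i := by rw [← add_mul, hab, one_mul]
  rw [← h2]
  rcases ha.eq_or_lt with rfl | ha'
  · have : b = 1 := by linarith
    subst this
    linarith
  · have := mul_lt_mul_of_pos_left hs ha'
    have := mul_le_mul_of_nonneg_left ht.le hb
    linarith

variable [IsRiemannianManifold (𝓡 n) M]

theorem IsEnds.dist_smul_le (h : IsEnds K R Φ) {i : Fin N} {x : M} (hx : x ∈ (Φ i).source) {t : ℝ}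
    (ht : R i < t * ‖Φ i x‖) : dist x ((Φ i).symm (t • Φ i x)) ≤ |1 - t| * ‖Φ i x‖ := by
  have h0 : R i < ‖Φ i x‖ := h.mem_target.1 ((Φ i).map_source hx)
  have h1 := dist_symm_le_of_flat (h.mem_atlas i) (h.flat i)
    (h.segment_smul_subset (s := 1) (by simpa using h0) ht)
  rw [one_smul, (Φ i).left_inv hx, dist_eq_norm] at h1
  refine h1.trans_eq ?_
  rw [← Real.norm_eq_abs, ← norm_smul, sub_smul, one_smul]

/-- The core is closed in a complete space, so total boundedness suffices. Its part in an end is the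
shell R < |z| ≤ A, which is not closed at the inner sphere; moving points radially outward by η
changes distances by at most η and puts them into the compact shell R + η ≤ |z| ≤ A + η. -/
theorem IsEnds.isCompact_core [CompleteSpace M] (h : IsEnds K R Φ) (A : ℝ) :
    IsCompact (core Φ A) := by
  refine TotallyBounded.isCompact_of_isClosed ?_ ?_
  · rw [Metric.totallyBounded_iff]
    intro ε hε
    set η := ε / 4 with hη
    have hη0 : 0 < η := by positivity
    set C : Set M := K ∪ ⋃ i, (Φ i).symm '' {z | R i + η ≤ ‖z‖ ∧ ‖z‖ ≤ A + η} with hC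
    have hCc : IsCompact C := by
      refine h.compact.union (isCompact_iUnion fun i => ?_)
      have : IsCompact {z : Model n | R i + η ≤ ‖z‖ ∧ ‖z‖ ≤ A + η} := by
        refine (isCompact_closedBall (0 : Model n) (A + η)).of_isClosed_subset ?_ fun z hz => ?_
        · exact (isClosed_le continuous_const continuous_norm).inter
            (isClosed_le continuous_norm continuous_const)
        · simpa using hz.2
      refine this.image_of_continuousOn ((Φ i).symm.continuousOn.mono fun z hz => ?_)
      exact h.mem_target.2 (by linarith [hz.1])
    obtain ⟨t, ht, htC⟩ := Metric.totallyBounded_iff.1 hCc.totallyBounded (ε / 2) (half_pos hε)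
    refine ⟨t, ht, fun x hx => ?_⟩
    obtain ⟨y, hy, hxy⟩ : ∃ y ∈ C, dist x y ≤ η := by
      by_cases hxK : x ∈ K
      · exact ⟨x, Or.inl hxK, by simpa using hη0.le⟩
      · have hx' : x ∈ ⋃ i, (Φ i).source := h.compl_eq ▸ hxK
        obtain ⟨i, hi⟩ := mem_iUnion.1 hx'
        set z := Φ i x with hz
        have hzR : R i < ‖z‖ := h.mem_target.1 ((Φ i).map_source hi)
        have hz0 : 0 < ‖z‖ := (h.pos i).trans hzR
        have hzA : ‖z‖ ≤ A := by
          by_contra hlt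
          exact hx (mem_iUnion.2 ⟨i, hi, not_le.1 hlt⟩)
        have e1 : (1 + η / ‖z‖) * ‖z‖ = ‖z‖ + η := by field_simp
        refine ⟨(Φ i).symm ((1 + η / ‖z‖) • z), Or.inr (mem_iUnion.2 ⟨i, mem_image_of_mem _ ?_⟩), ?_⟩
        · change _ ≤ ‖(1 + η / ‖z‖) • z‖ ∧ ‖(1 + η / ‖z‖) • z‖ ≤ _
          rw [norm_smul, Real.norm_of_nonneg (by positivity), e1]
          constructor <;> linarith
        · refine (h.dist_smul_le hi (by rw [e1]; linarith)).trans_eq ?_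
          rw [sub_add_cancel_left, abs_neg, abs_of_pos (by positivity), ← hz]
          field_simp
    obtain ⟨w, hw, hyw⟩ := mem_iUnion₂.1 (htC hy)
    refine mem_iUnion₂.2 ⟨w, hw, ?_⟩
    rw [Metric.mem_ball] at hyw ⊢
    linarith [dist_triangle x y w]
  · exact (isOpen_iUnion fun i => (Φ i).isOpen_inter_preimage
      (isOpen_lt continuous_const continuous_norm)).isClosed_compl

/-- Going radially from x to the sphere |z| = A costs ‖Φ x‖ - A, and the images of these spheres are
compact, hence at bounded distance from o. -/
theorem IsEnds.exists_weight_le (h : IsEnds K R Φ) (o : M) {A : ℝ} (hA : ∀ i, R i < A) :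
    ∃ C : ℝ, 1 ≤ C ∧ ∀ i, ∀ x ∈ (Φ i).source, A < ‖Φ i x‖ → weight o x ≤ C * ‖Φ i x‖ := by
  have hcomp : IsCompact (⋃ i, (Φ i).symm '' Metric.sphere (0 : Model n) A) := by
    refine isCompact_iUnion fun i => (isCompact_sphere _ _).image_of_continuousOn
      ((Φ i).symm.continuousOn.mono fun z hz => h.mem_target.2 ?_)
    have : ‖z‖ = A := by simpa using hz
    rw [this]
    exact hA i
  obtain ⟨S, hS⟩ := hcomp.bddAbove_image (f := fun x => dist x o) (by fun_prop)
  -- Without ends `A` need not be positive, but then the claim is empty.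
  by_cases hN : ∃ i : Fin N, True
  swap
  · exact ⟨1, le_rfl, fun i => absurd ⟨i, trivial⟩ hN⟩
  obtain ⟨i₀, -⟩ := hN
  have hA0 : 0 < A := (h.pos i₀).trans (hA i₀)
  refine ⟨1 + (1 + |S|) / A, by simp; positivity, fun i x hx hxA => ?_⟩
  set z := Φ i x with hz
  have hz0 : 0 < ‖z‖ := hA0.trans hxA
  have e1 : A / ‖z‖ * ‖z‖ = A := by field_simp
  have h1 := h.dist_smul_le hx (t := A / ‖z‖) (by rw [e1]; exact hA i)
  have h2 : |1 - A / ‖z‖| * ‖z‖ = ‖z‖ - A := by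
    rw [abs_of_nonneg (by rw [sub_nonneg, div_le_one hz0]; exact hxA.le), sub_mul, e1, one_mul]
  have h3 : dist ((Φ i).symm ((A / ‖z‖) • z)) o ≤ S := by
    refine hS (mem_image_of_mem _ (mem_iUnion.2 ⟨i, mem_image_of_mem _ ?_⟩))
    rw [mem_sphere_zero_iff_norm, norm_smul, Real.norm_of_nonneg (by positivity), e1]
  have h4 := dist_triangle x ((Φ i).symm ((A / ‖z‖) • z)) o
  have h5 := weight_le_one_add o x
  have h6 : (1 + |S|) ≤ (1 + |S|) / A * ‖z‖ := by
    rw [div_mul_eq_mul_div, le_div_iff₀ hA0]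
    exact mul_le_mul_of_nonneg_left hxA.le (by positivity)
  have h7 := le_abs_self S
  rw [← hz, h2] at h1
  linarith

variable [IsManifold (𝓡 n) ∞ M]

theorem IsEnds.exists_core_of_dist (h : IsEnds K R Φ) (o : M) (ρ : ℝ) :
    ∃ A : ℝ, ∀ x, x ∉ core Φ A → ρ ≤ dist x o := by
  -- Beyond R + |ρ| the ball of radius ρ about x stays in the end; the summand `‖Φ i o‖` keeps o out
  -- of that ball.
  refine ⟨∑ i, (R i + |ρ| + ‖Φ i o‖), fun x hx => ?_⟩
  obtain ⟨i, hi, hiA⟩ := mem_iUnion.1 (not_not.1 hx)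
  by_contra hlt
  rw [not_le] at hlt
  have hA : R i + |ρ| + ‖Φ i o‖ ≤ ∑ i, (R i + |ρ| + ‖Φ i o‖) :=
    Finset.single_le_sum (f := fun i => R i + |ρ| + ‖Φ i o‖)
      (fun i _ => by have := h.pos i; positivity) (Finset.mem_univ i)
  have hiA' : R i + |ρ| + ‖Φ i o‖ < ‖Φ i x‖ := hA.trans_lt hiA
  have hρ := le_abs_self ρ
  have hsub : Metric.closedBall (Φ i x) ρ ⊆ (Φ i).target := by
    intro w hw
    rw [h.mem_target]
    rw [Metric.mem_closedBall, dist_eq_norm] at hw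
    have := norm_sub_norm_le (Φ i x) w
    rw [norm_sub_rev] at this
    linarith [norm_nonneg (Φ i o)]
  obtain ⟨w, hw, hwo⟩ := ball_subset_image_of_flat (h.mem_atlas i) (h.flat i) hsub (y := o)
    (by rwa [(Φ i).left_inv hi])
  rw [← hwo, (Φ i).right_inv (hsub hw)] at hiA'
  rw [Metric.mem_closedBall, dist_eq_norm] at hw
  have := norm_sub_norm_le (Φ i x) w
  rw [norm_sub_rev] at this
  linarith [h.pos i]

theorem IsEnds.exists_compact_dist [CompleteSpace M] (h : IsEnds K R Φ) (o : M) (ρ : ℝ) :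
    ∃ S : Set M, IsCompact S ∧ ∀ x ∉ S, ρ ≤ dist x o := by
  obtain ⟨A, hA⟩ := h.exists_core_of_dist o ρ
  exact ⟨core Φ A, h.isCompact_core A, hA⟩

/-- Finitely many charts cover M: the ends, and a finite subcover of the compact set that remains.
-/
theorem IsEnds.ae_riemVolume [CompleteSpace M] [MeasurableSpace M] [BorelSpace M]
    (h : IsEnds K R Φ) {P : M → Prop}
    (hP : ∀ φ ∈ IsManifold.maximalAtlas (𝓡 n) ∞ M, ∀ᵐ z ∂(volume.restrict φ.target),
      P (φ.symm z)) : ∀ᵐ x ∂(riemVolume n M), P x := by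
  obtain ⟨t, -, ht⟩ := (h.isCompact_core 0).elim_nhds_subcover
    (fun x => (chartAt (Model n) x).source) fun x _ => chart_source_mem_nhds (Model n) x
  have hmem : ∀ c : t ⊕ Fin N, Sum.elim (fun x : t => chartAt (Model n) (x : M)) Φ c ∈
      IsManifold.maximalAtlas (𝓡 n) ∞ M := by
    rintro (x | i)
    · exact IsManifold.chart_mem_maximalAtlas _
    · exact h.mem_atlas i
  refine ae_riemVolume_of_ae_chart _ hmem ?_ fun c => hP _ (hmem c)
  refine eq_univ_of_forall fun x => mem_iUnion.2 ?_
  by_cases hx : x ∈ core Φ 0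
  · obtain ⟨y, hy, hxy⟩ := mem_iUnion₂.1 (ht hx)
    exact ⟨Sum.inl ⟨y, hy⟩, hxy⟩
  · obtain ⟨i, hi, -⟩ := mem_iUnion.1 (not_not.1 hx)
    exact ⟨Sum.inr i, hi⟩

variable [IsContMDiffRiemannianBundle (𝓡 n) ∞ (Model n) (fun x : M => TangentSpace (𝓡 n) x)]

/-- Far out in an end, take the Euclidean ball of radius σ / (4C). Since σ ≤ C ‖Φ x‖ it stays in the
end, where the metric is flat, and there σ changes by at most a quarter. The remaining points form a
compact core. -/
theorem IsEnds.exists_goodBall [CompleteSpace M] (h : IsEnds K R Φ) (o : M) :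
    ∃ Λ : ℝ, ∀ x, ∃ (φ : OpenPartialHomeomorph M (Model n)) (T : ℝ), GoodBall o Λ φ T x := by
  -- Points beyond A satisfy ‖Φ x‖ > 2R, so a ball of radius at most ‖Φ x‖ / 4 does not reach the
  -- sphere of radius R.
  set A := 2 * ∑ i, R i + 1 with hAdef
  have hA' : ∀ i, R i ≤ ∑ i, R i := fun i => Finset.single_le_sum (f := R)
    (fun i _ => (h.pos i).le) (Finset.mem_univ i)
  have hA : ∀ i, R i < A := fun i => by linarith [hA' i, h.pos i]
  obtain ⟨Λ₀, hΛ₀⟩ := exists_goodBall_compact (n := n) o (h.isCompact_core A)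
  obtain ⟨C, hC1, hC⟩ := h.exists_weight_le o hA
  refine ⟨max Λ₀ (4 * C), fun x => ?_⟩
  by_cases hx : x ∈ core Φ A
  · obtain ⟨φ, T, hg⟩ := hΛ₀ x hx
    exact ⟨φ, T, hg.mono (le_max_left _ _)⟩
  obtain ⟨i, hi, hiA⟩ := mem_iUnion.1 (not_not.1 hx)
  set σ := weight o x with hσ
  have hσ0 : 0 < σ := weight_pos _ _
  have hσC : σ ≤ C * ‖Φ i x‖ := hC i x hi hiA
  set T := σ / (4 * C) with hT
  have hTσ : 4 * C * T = σ := by rw [hT]; field_simp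
  have hT0 : 0 < T := by positivity
  have hTz : T ≤ ‖Φ i x‖ / 4 := by
    rw [hT, div_le_iff₀ (by positivity)]
    linarith
  have hTσ' : T ≤ σ / 4 := by nlinarith
  have hiA' : 2 * R i < ‖Φ i x‖ := by
    have : A < ‖Φ i x‖ := hiA
    linarith [hA' i]
  have hsub : Metric.closedBall (Φ i x) T ⊆ (Φ i).target := by
    intro w hw
    rw [h.mem_target]
    rw [Metric.mem_closedBall, dist_eq_norm] at hw
    have := norm_sub_norm_le (Φ i x) w
    rw [norm_sub_rev] at this
    linarith [h.pos i]
  have hdist : ∀ z ∈ Metric.closedBall (Φ i x) T, dist x ((Φ i).symm z) ≤ T := by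
    intro z hz
    have h1 := dist_symm_le_of_flat (h.mem_atlas i) (h.flat i) (z := Φ i x) (w := z)
      (((convex_closedBall _ _).segment_subset (Metric.mem_closedBall_self hT0.le) hz).trans hsub)
    rw [(Φ i).left_inv hi] at h1
    refine h1.trans ?_
    rwa [dist_comm]
  refine ⟨Φ i, T, GoodBall.mono (Λ := 4 * C) ?_ (le_max_right _ _)⟩
  refine ⟨h.mem_atlas i, hi, hT0, hsub, fun z hz => ?_, fun z hz => ?_, fun z hz a b c => ?_, ?_, ?_,
    fun z hz => ?_, fun z hz => ?_⟩
  · have h1 := frameBound_one (h.mem_atlas i) (hsub hz) (h.flat i z (hsub hz))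
    have hC4 : 1 ≤ 4 * C := by linarith
    exact ⟨fun j => (h1.1 j).trans hC4, fun j v => (h1.2 j v).trans
      (mul_le_mul_of_nonneg_right hC4 (norm_nonneg _))⟩
  · rw [h.flat i z (hsub hz)]
    simp
    linarith
  · rw [christoffel_eq_zero ((Φ i).open_target.mem_nhds (hsub hz)) (h.flat i)]
    simp
    linarith
  · nlinarith
  · exact hTσ.ge
  · have h1 := weight_le_add_dist o ((Φ i).symm z) x
    rw [dist_comm] at h1
    have h2 := hdist z hz
    nlinarith
  · have h1 := weight_le_add_dist o x ((Φ i).symm z)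
    have h2 := hdist z hz
    have h3 := weight_pos o ((Φ i).symm z)
    nlinarith

end Ends

/-! ### From weighted norms to local Lᵖ norms of components -/

section SobolevPair

theorem rpow_le_rpow_abs_mul {a b L : ℝ} (ha : 0 < a) (hb : 0 < b) (hL : 1 ≤ L)
    (hab : a ≤ L * b) (hba : b ≤ L * a) (t : ℝ) : a ^ t ≤ L ^ |t| * b ^ t := by
  have hL0 : 0 < L := by linarith
  rcases le_total 0 t with ht | ht
  · rw [abs_of_nonneg ht, ← Real.mul_rpow hL0.le hb.le]
    exact Real.rpow_le_rpow ha.le hab ht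
  · rw [abs_of_nonpos ht, Real.rpow_neg hL0.le, ← div_eq_inv_mul, le_div_iff₀ (by positivity),
      mul_comm, ← Real.mul_rpow hL0.le ha.le]
    exact Real.rpow_le_rpow_of_nonpos hb hba ht

variable {n : ℕ} {M : Type*} [MetricSpace M] [ChartedSpace (Model n) M]
  [RiemannianBundle (fun x : M => TangentSpace (𝓡 n) x)]
  {φ : OpenPartialHomeomorph M (Model n)} {o : M}
  {ι : Type*} {r k : ι → ℕ}

/-- The partial derivative `∂_l` of a component of `u`, expressed by the covariant derivative `v`. -/
def chartGrad {M : Type*} [TopologicalSpace M] [ChartedSpace (Model n) M]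
    [RiemannianBundle (fun x : M => TangentSpace (𝓡 n) x)] (φ : OpenPartialHomeomorph M (Model n)) (u : TensorSection (n := n) M r k)
    (v : TensorSection (n := n) M r (fun j => k j + 1)) (j : ι) (I : Fin (r j) → Fin n)
    (J : Fin (k j) → Fin n) (l : Fin n) (z : Model n) : ℝ :=
  comp φ v j I (Fin.cons l J) z - connectionTerm φ u j I J l z

theorem IsLocInt.connectionTerm [IsManifold (𝓡 n) ∞ M]
    [IsContMDiffRiemannianBundle (𝓡 n) ∞ (Model n) (fun x : M => TangentSpace (𝓡 n) x)]
    {u : TensorSection (n := n) M r k} (hu : IsLocInt u)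
    (hφ : φ ∈ IsManifold.maximalAtlas (𝓡 n) ∞ M) (j : ι) (I : Fin (r j) → Fin n)
    (J : Fin (k j) → Fin n) (l : Fin n) :
    LocallyIntegrableOn (connectionTerm φ u j I J l) φ.target volume := by
  have hmul : ∀ m i i' I J, LocallyIntegrableOn (fun z => christoffel φ m i i' z *
      comp φ u j I J z) φ.target volume := fun m i i' I J =>
    (hu φ hφ j I J).continuousOn_mul (continuousOn_christoffel hφ m i i')
      φ.open_target.isLocallyClosed
  have hsum : ∀ {κ : Type} (s : Finset κ) (f : κ → Model n → ℝ),
      (∀ c, LocallyIntegrableOn (f c) φ.target volume) →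
      LocallyIntegrableOn (fun z => ∑ c ∈ s, f c z) φ.target volume := by
    intro κ s f hf
    classical
    induction s using Finset.induction_on with
    | empty => simpa using locallyIntegrableOn_zero
    | insert c s hc ih =>
      simp only [Finset.sum_insert hc]
      exact (hf c).add ih
  exact (hsum _ _ fun a => hsum _ _ fun m => hmul _ _ _ _ _).sub
    (hsum _ _ fun a => hsum _ _ fun m => hmul _ _ _ _ _)

variable [Fintype ι]

theorem GoodBall.abs_comp_le {Λ T : ℝ} {x : M} (h : GoodBall o Λ φ T x)
    (u : TensorSection (n := n) M r k) (j : ι) (I : Fin (r j) → Fin n) (J : Fin (k j) → Fin n)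
    {z : Model n} (hz : z ∈ Metric.closedBall (φ x) T) :
    |comp φ u j I J z| ≤ normConst n r k Λ * pointNorm u (φ.symm z) := by
  rw [comp_eq_compAt h.mem_atlas (h.closedBall_subset hz)]
  exact (h.frame z hz).abs_compAt_le (zero_le_one.trans h.one_le) u j I J

theorem GoodBall.abs_connectionTerm_le {Λ T : ℝ} {x : M} (h : GoodBall o Λ φ T x)
    (u : TensorSection (n := n) M r k) (j : ι) (I : Fin (r j) → Fin n) (J : Fin (k j) → Fin n)
    (l : Fin n) {z : Model n} (hz : z ∈ Metric.closedBall (φ x) T) :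
    |connectionTerm φ u j I J l z| ≤
      (r j + k j) * n * (Λ / T) * normConst n r k Λ * pointNorm u (φ.symm z) := by
  have hΛ := h.one_le
  have hT := h.radius_pos
  set P := normConst n r k Λ * pointNorm u (φ.symm z) with hP
  have hP0 : 0 ≤ P := mul_nonneg (normConst_nonneg (by linarith)) (pointNorm_nonneg _ _)
  have hterm : ∀ m i i' I J, |christoffel φ m i i' z * comp φ u j I J z| ≤ Λ / T * P := by
    intro m i i' I J
    rw [abs_mul]
    refine mul_le_mul ?_ (h.abs_comp_le u j I J hz) (abs_nonneg _) (by positivity)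
    rw [le_div_iff₀ hT, mul_comm]
    exact h.christoffel_le z hz m i i'
  have hsum : ∀ (d : ℕ) (f : Fin d → Fin n → ℝ), (∀ a m, |f a m| ≤ Λ / T * P) →
      |∑ a, ∑ m, f a m| ≤ d * (n * (Λ / T * P)) := by
    intro d f hf
    refine (Finset.abs_sum_le_sum_abs _ _).trans ?_
    refine (Finset.sum_le_card_nsmul _ _ (n * (Λ / T * P)) fun a _ => ?_).trans (by simp)
    refine (Finset.abs_sum_le_sum_abs _ _).trans ?_
    exact (Finset.sum_le_card_nsmul _ _ (Λ / T * P) fun m _ => hf a m).trans (by simp)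
  unfold EucInf.connectionTerm
  refine (abs_sub _ _).trans ?_
  refine (add_le_add (hsum _ _ fun a m => hterm _ _ _ _ _)
    (hsum _ _ fun a m => hterm _ _ _ _ _)).trans (le_of_eq ?_)
  rw [hP]
  ring

variable [MeasurableSpace M]

/-- `v` is the generalized covariant derivative of `u`, and the weighted `L^p` norms of `u` and `v`
are at most `N`. -/
structure SobolevPair (o : M) (p δ N : ℝ) (u : TensorSection (n := n) M r k)
    (v : TensorSection (n := n) M r (fun j => k j + 1)) : Prop where
  nonneg : 0 ≤ N
  locInt : IsLocInt u
  locInt_deriv : IsLocInt v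
  weak : IsWeakCovDeriv u v
  lintegral_le : ∫⁻ y, ENNReal.ofReal (pointNorm u y ^ p * weight o y ^ (p * δ))
    ∂(riemVolume n M) ≤ ENNReal.ofReal (N ^ p)
  lintegral_deriv_le : ∫⁻ y, ENNReal.ofReal (pointNorm v y ^ p * weight o y ^ (p * (δ + 1)))
    ∂(riemVolume n M) ≤ ENNReal.ofReal (N ^ p)

variable [IsManifold (𝓡 n) ∞ M]
  [IsContMDiffRiemannianBundle (𝓡 n) ∞ (Model n) (fun x : M => TangentSpace (𝓡 n) x)]

theorem SobolevPair.hasWeakGrad {p δ N : ℝ} {u : TensorSection (n := n) M r k}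
    {v : TensorSection (n := n) M r (fun j => k j + 1)} (h : SobolevPair o p δ N u v)
    (hφ : φ ∈ IsManifold.maximalAtlas (𝓡 n) ∞ M) (j : ι) (I : Fin (r j) → Fin n)
    (J : Fin (k j) → Fin n) :
    HasWeakGrad φ.target (comp φ u j I J) (chartGrad φ u v j I J) where
  locInt := h.locInt φ hφ j I J
  locInt_grad l := (h.locInt_deriv φ hφ j I (Fin.cons l J)).sub (h.locInt.connectionTerm hφ j I J l)
  weak l ψ h1 h2 h3 := h.weak φ hφ j I J l ψ h1 h2 h3

variable [BorelSpace M]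

/-- On a good ball the weight may be frozen at its centre. The factor `Λ ^ |s|` is the price of
freezing it, and `Λ ^ (1 / p)` that of replacing the Riemannian volume by Lebesgue measure. -/
theorem GoodBall.eLpNorm_le {Λ T : ℝ} {x : M} (h : GoodBall o Λ φ T x) {p s N a : ℝ} (hp : 0 < p)
    (hN : 0 ≤ N) (ha : 0 ≤ a) {w : TensorSection (n := n) M r k}
    (hw : ∫⁻ y, ENNReal.ofReal (pointNorm w y ^ p * weight o y ^ (p * s)) ∂(riemVolume n M) ≤
      ENNReal.ofReal (N ^ p)) {f : Model n → ℝ}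
    (hf : ∀ z ∈ Metric.closedBall (φ x) T, |f z| ≤ a * pointNorm w (φ.symm z)) :
    eLpNorm f (ENNReal.ofReal p) (volume.restrict (Metric.closedBall (φ x) T)) ≤
      ENNReal.ofReal (a * Λ ^ |s| * Λ ^ (1 / p) * (weight o x ^ (-s) * N)) := by
  have hΛ := h.one_le
  have hΛ0 : 0 < Λ := by linarith
  have hσ := weight_pos o x
  set c := a * Λ ^ |s| * weight o x ^ (-s) with hc
  have hc0 : 0 ≤ c := by positivity
  have hpt : ∀ z ∈ Metric.closedBall (φ x) T, ‖f z‖ₑ ^ p ≤ ENNReal.ofReal (c ^ p) *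
      ENNReal.ofReal (pointNorm w (φ.symm z) ^ p * weight o (φ.symm z) ^ (p * s)) := by
    intro z hz
    have hσz := weight_pos o (φ.symm z)
    have hP := pointNorm_nonneg w (φ.symm z)
    rw [Real.enorm_eq_ofReal_abs, ENNReal.ofReal_rpow_of_nonneg (abs_nonneg _) hp.le,
      ← ENNReal.ofReal_mul (by positivity)]
    refine ENNReal.ofReal_le_ofReal ?_
    rw [mul_comm p s, Real.rpow_mul hσz.le, ← Real.mul_rpow hP (by positivity),
      ← Real.mul_rpow hc0 (by positivity)]
    refine Real.rpow_le_rpow (abs_nonneg _) ((hf z hz).trans ?_) hp.le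
    have h1 : 1 ≤ Λ ^ |s| * weight o x ^ (-s) * weight o (φ.symm z) ^ s := by
      have h2 := rpow_le_rpow_abs_mul hσ hσz hΛ (h.le_weight z hz) (h.weight_le z hz) s
      rw [Real.rpow_neg hσ.le, mul_right_comm, ← div_eq_mul_inv, one_le_div (by positivity)]
      exact h2
    calc a * pointNorm w (φ.symm z) = a * pointNorm w (φ.symm z) * 1 := (mul_one _).symm
      _ ≤ a * pointNorm w (φ.symm z) *
          (Λ ^ |s| * weight o x ^ (-s) * weight o (φ.symm z) ^ s) :=
        mul_le_mul_of_nonneg_left h1 (by positivity)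
      _ = _ := by rw [hc]; ring
  have hp1 : ENNReal.ofReal p ≠ 0 := by simpa using hp
  rw [eLpNorm_eq_lintegral_rpow_enorm_toReal hp1 ENNReal.ofReal_ne_top, ENNReal.toReal_ofReal hp.le]
  have hInt : ∫⁻ z in Metric.closedBall (φ x) T, ‖f z‖ₑ ^ p ≤
      ENNReal.ofReal (c ^ p * (Λ * N ^ p)) := by
    calc ∫⁻ z in Metric.closedBall (φ x) T, ‖f z‖ₑ ^ p
        ≤ ∫⁻ z in Metric.closedBall (φ x) T, ENNReal.ofReal (c ^ p) *
          ENNReal.ofReal (pointNorm w (φ.symm z) ^ p * weight o (φ.symm z) ^ (p * s)) :=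
          setLIntegral_mono' Metric.isClosed_closedBall.measurableSet hpt
      _ = ENNReal.ofReal (c ^ p) * ∫⁻ z in Metric.closedBall (φ x) T,
          ENNReal.ofReal (pointNorm w (φ.symm z) ^ p * weight o (φ.symm z) ^ (p * s)) :=
          lintegral_const_mul' _ _ ENNReal.ofReal_ne_top
      _ ≤ ENNReal.ofReal (c ^ p) * ((ENNReal.ofReal Λ⁻¹)⁻¹ * ENNReal.ofReal (N ^ p)) := by
          gcongr
          refine (setLIntegral_chart_le (c := ENNReal.ofReal Λ⁻¹) h.mem_atlas
            (fun y => ENNReal.ofReal (pointNorm w y ^ p * weight o y ^ (p * s)))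
            Metric.isClosed_closedBall.measurableSet h.closedBall_subset ?_ fun z hz => ?_).trans ?_
          · simpa using hΛ0
          · refine ENNReal.ofReal_le_ofReal ?_
            rw [inv_le_iff_one_le_mul₀' hΛ0]
            exact h.density z hz
          · gcongr
      _ = _ := by
          rw [← ENNReal.ofReal_inv_of_pos (by positivity), inv_inv,
            ← ENNReal.ofReal_mul hΛ0.le, ← ENNReal.ofReal_mul (by positivity)]
  refine (ENNReal.rpow_le_rpow hInt (by positivity)).trans ?_
  rw [ENNReal.ofReal_rpow_of_nonneg (by positivity) (by positivity)]
  refine ENNReal.ofReal_le_ofReal (le_of_eq ?_)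
  rw [Real.mul_rpow (by positivity) (by positivity), Real.mul_rpow hΛ0.le (by positivity),
    ← Real.rpow_mul hc0, ← Real.rpow_mul hN, mul_one_div_cancel hp.ne', Real.rpow_one,
    Real.rpow_one, hc]
  ring

end SobolevPair

/-! ### Uniqueness and construction of continuous representatives -/

section Representative

variable {n : ℕ} {M : Type*} [MetricSpace M] [ChartedSpace (Model n) M]
  [RiemannianBundle (fun x : M => TangentSpace (𝓡 n) x)]
  [IsManifold (𝓡 n) ∞ M]
  [IsContMDiffRiemannianBundle (𝓡 n) ∞ (Model n) (fun x : M => TangentSpace (𝓡 n) x)]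
  [MeasurableSpace M] [BorelSpace M]
  {φ : OpenPartialHomeomorph M (Model n)} {o : M}
  {ι : Type*} {r k : ι → ℕ}

theorem IsCont.comp_eqOn {w w' : TensorSection (n := n) M r k} (hw : IsCont w) (hw' : IsCont w')
    (h : ∀ᵐ x ∂(riemVolume n M), w x = w' x) (hφ : φ ∈ IsManifold.maximalAtlas (𝓡 n) ∞ M)
    (j : ι) (I : Fin (r j) → Fin n) (J : Fin (k j) → Fin n) :
    EqOn (comp φ w j I J) (comp φ w' j I J) φ.target := by
  refine Measure.eqOn_open_of_ae_eq (μ := volume) ?_ φ.open_target (hw φ hφ j I J) (hw' φ hφ j I J)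
  filter_upwards [ae_chart_of_ae_riemVolume hφ h] with z hz
  unfold comp
  rw [hz]

theorem IsCont.eq_of_ae_eq {w w' : TensorSection (n := n) M r k} (hw : IsCont w) (hw' : IsCont w')
    (h : ∀ᵐ x ∂(riemVolume n M), w x = w' x) : w = w' := by
  funext x
  have hφ := IsManifold.chart_mem_maximalAtlas (I := 𝓡 n) (n := ∞) x
  have hx := mem_chart_source (Model n) x
  refine section_ext_of_compAt hφ hx fun j I J => ?_
  rw [← comp_chart hφ hx, ← comp_chart hφ hx]
  exact hw.comp_eqOn hw' h hφ j I J ((chartAt (Model n) x).map_source hx)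

variable [Fintype ι]

variable (M r k) in
-- A partial derivative is a component of `v` minus Christoffel symbols times components of `u`. The
-- first carries the extra weight σ⁻¹ ≤ Λ/T, the second the factor |Γ| ≤ Λ/T, so both are of size
-- σ^(-δ) N / T, the scale-invariant form that Morrey's inequality wants.
theorem exists_eLpNorm_le (o : M) {p : ℝ} (hp : 1 ≤ p) (δ : ℝ) {Λ : ℝ} (hΛ : 1 ≤ Λ) :
    ∃ C : ℝ, 0 ≤ C ∧ ∀ (φ : OpenPartialHomeomorph M (Model n)) (T : ℝ) (x : M) (N : ℝ)
      (u : TensorSection (n := n) M r k) (v : TensorSection (n := n) M r (fun j => k j + 1)),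
      GoodBall o Λ φ T x → SobolevPair o p δ N u v → ∀ j I J,
      eLpNorm (comp φ u j I J) (ENNReal.ofReal p) (volume.restrict (Metric.closedBall (φ x) T)) ≤
        ENNReal.ofReal (C * (weight o x ^ (-δ) * N)) ∧
      ∀ l, eLpNorm (chartGrad φ u v j I J l) (ENNReal.ofReal p)
        (volume.restrict (Metric.closedBall (φ x) T)) ≤
        ENNReal.ofReal (C * (weight o x ^ (-δ) * N) / T) := by
  have hp0 : 0 < p := by linarith
  have hΛ0 : 0 < Λ := by linarith
  set Q := normConst n r k Λ with hQ
  have hQ0 : 0 ≤ Q := normConst_nonneg hΛ0.le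
  set Q' := normConst n r (fun j => k j + 1) Λ with hQ'
  have hQ'0 : 0 ≤ Q' := normConst_nonneg hΛ0.le
  set S : ℝ := ∑ j, ((r j : ℝ) + k j) with hS
  have hS0 : 0 ≤ S := Finset.sum_nonneg fun _ _ => by positivity
  set L := Λ ^ |δ| * Λ ^ (1 / p) with hL
  set L' := Λ ^ |δ + 1| * Λ ^ (1 / p) with hL'
  have hL0 : 0 ≤ L := by positivity
  have hL'0 : 0 ≤ L' := by positivity
  refine ⟨Q * L + (Q' * L' * Λ + S * n * Λ * Q * L), by positivity, ?_⟩
  intro φ T x N u v hB h j I J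
  have hN := h.nonneg
  have hT := hB.radius_pos
  have hσ := weight_pos o x
  set X := weight o x ^ (-δ) * N with hX
  have hX0 : 0 ≤ X := by positivity
  have hZ : 0 ≤ Q' * L' * Λ + S * n * Λ * Q * L := by positivity
  refine ⟨?_, fun l => ?_⟩
  · refine (hB.eLpNorm_le hp0 hN hQ0 h.lintegral_le fun z hz => hB.abs_comp_le u j I J hz).trans ?_
    refine ENNReal.ofReal_le_ofReal ?_
    rw [← hX, mul_assoc Q, ← hL]
    nlinarith
  · have hsub : volume.restrict (Metric.closedBall (φ x) T) ≤ volume.restrict φ.target :=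
      Measure.restrict_mono hB.closedBall_subset le_rfl
    have hmv := ((h.locInt_deriv φ hB.mem_atlas j I (Fin.cons l J)).aestronglyMeasurable).mono_measure
      hsub
    have hmc := ((h.locInt.connectionTerm hB.mem_atlas j I J l).aestronglyMeasurable).mono_measure
      hsub
    have hSj : (r j : ℝ) + k j ≤ S := Finset.single_le_sum (f := fun j => (r j : ℝ) + k j)
      (fun _ _ => by positivity) (Finset.mem_univ j)
    have e1 := hB.eLpNorm_le hp0 hN hQ'0 h.lintegral_deriv_le
      fun z hz => hB.abs_comp_le v j I (Fin.cons l J) hz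
    have e2 := hB.eLpNorm_le (a := S * n * (Λ / T) * Q) hp0 hN (by positivity) h.lintegral_le
      (f := connectionTerm φ u j I J l) fun z hz => by
        refine (hB.abs_connectionTerm_le u j I J l hz).trans ?_
        have := pointNorm_nonneg u (φ.symm z)
        gcongr
    have e3 : eLpNorm (chartGrad φ u v j I J l) (ENNReal.ofReal p)
        (volume.restrict (Metric.closedBall (φ x) T)) ≤ _ :=
      (eLpNorm_sub_le hmv hmc (ENNReal.one_le_ofReal.2 hp)).trans (add_le_add e1 e2)
    refine e3.trans ?_
    rw [← ENNReal.ofReal_add (by positivity) (by positivity)]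
    refine ENNReal.ofReal_le_ofReal ?_
    have hσT : weight o x ^ (-(δ + 1)) ≤ weight o x ^ (-δ) * (Λ / T) := by
      rw [neg_add, Real.rpow_add hσ, Real.rpow_neg_one]
      have : (weight o x)⁻¹ ≤ Λ / T := by
        rw [le_div_iff₀ hT, inv_mul_le_iff₀ hσ, mul_comm]
        exact hB.radius_le
      gcongr
    have e4 : Q' * L' * (weight o x ^ (-(δ + 1)) * N) ≤ Q' * L' * ((Λ / T) * X) := by
      refine mul_le_mul_of_nonneg_left ?_ (by positivity)
      calc weight o x ^ (-(δ + 1)) * N ≤ weight o x ^ (-δ) * (Λ / T) * N :=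
            mul_le_mul_of_nonneg_right hσT hN
        _ = _ := by rw [hX]; ring
    calc Q' * Λ ^ |δ + 1| * Λ ^ (1 / p) * (weight o x ^ (-(δ + 1)) * N) +
          S * n * (Λ / T) * Q * Λ ^ |δ| * Λ ^ (1 / p) * X
        = Q' * L' * (weight o x ^ (-(δ + 1)) * N) + S * n * Λ * Q * L * X / T := by
          rw [hL, hL']; ring
      _ ≤ Q' * L' * ((Λ / T) * X) + S * n * Λ * Q * L * X / T + Q * L * X / T := by
          have : 0 ≤ Q * L * X / T := by positivity
          linarith
      _ = _ := by ring

variable (M r k) in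
/-- The local form of the embedding: bounds for the components of the continuous representative and
their oscillation on good balls, and existence of continuous components. -/
theorem exists_comp_bounds (o : M) {p : ℝ} (hp1 : 1 ≤ p) (hp : (n : ℝ) < p) (δ : ℝ) {Λ : ℝ}
    (hΛ : 1 ≤ Λ) :
    ∃ C : ℝ, 0 ≤ C ∧ ∀ (N : ℝ) (u : TensorSection (n := n) M r k)
      (v : TensorSection (n := n) M r (fun j => k j + 1)), SobolevPair o p δ N u v →
      ∀ φ ∈ IsManifold.maximalAtlas (𝓡 n) ∞ M, ∀ j I J, ∃ F : Model n → ℝ,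
      ContinuousOn F φ.target ∧ (∀ᵐ z ∂volume.restrict φ.target, F z = comp φ u j I J z) ∧
      ∀ (T : ℝ) (x : M), GoodBall o Λ φ T x →
        |F (φ x)| ≤ C * (weight o x ^ (-(δ + n / p)) * N) ∧
        ∀ (y : Model n) (τ : ℝ), 0 < τ → 3 * τ ≤ T → ‖y - φ x‖ ≤ τ →
          |F y - F (φ x)| ≤ C * (τ ^ (1 - n / p) * (weight o x ^ (-δ) * N) / T) := by
  have hp0 : 0 < p := by linarith
  have hΛ0 : 0 < Λ := by linarith
  obtain ⟨C₀, hC₀, hM⟩ := exists_morrey n hp1 hp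
  obtain ⟨C₁, hC₁, hE⟩ := exists_eLpNorm_le (n := n) M r k o hp1 δ hΛ
  have hcst : 0 ≤ 2 * C₀ * C₁ * Λ ^ (n / p : ℝ) := by positivity
  refine ⟨2 * C₀ * C₁ * Λ ^ (n / p : ℝ) + C₀ * C₁, by positivity, ?_⟩
  intro N u v h φ hφ j I J
  have hN := h.nonneg
  obtain ⟨F, hFc, hFu, hFs, hFo⟩ := hM φ.target _ _ φ.open_target (h.hasWeakGrad hφ j I J) (by
    -- Morrey's inequality only asks for some ball with finite norm about each point, so the
    -- constant of the good ball used here need not be `Λ`.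
    intro z hz
    obtain ⟨Λ', T, hB⟩ := exists_goodBall_near o hφ (φ.map_target hz)
    have hB := hB.self_of_nhds
    obtain ⟨C₂, hC₂, hE₂⟩ := exists_eLpNorm_le (n := n) M r k o hp1 δ hB.one_le
    have hT := hB.radius_pos
    have hσ := weight_pos o (φ.symm z)
    have hsub := hB.closedBall_subset
    have hEz := (hE₂ φ T _ N u v hB h j I J).2
    rw [φ.right_inv hz] at hsub hEz
    exact ⟨T, _, hT, by positivity, hsub, hEz⟩)
  refine ⟨F, hFc, hFu, fun T x hB => ?_⟩
  have hT := hB.radius_pos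
  have hσ := weight_pos o x
  obtain ⟨e1, e2⟩ := hE φ T x N u v hB h j I J
  set X := weight o x ^ (-δ) * N with hX
  have hX0 : 0 ≤ X := by positivity
  refine ⟨?_, fun y τ hτ hτT hy => ?_⟩
  · refine (hFs (φ x) T (C₁ * X) (C₁ * X / T) hT (by positivity) (by positivity)
      hB.closedBall_subset e1 e2).trans ?_
    have h1 : T ^ (-(n / p) : ℝ) ≤ Λ ^ (n / p : ℝ) * weight o x ^ (-(n / p) : ℝ) := by
      rw [Real.rpow_neg hT.le, Real.rpow_neg hσ.le, ← div_eq_mul_inv,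
        inv_le_comm₀ (by positivity) (by positivity), inv_div, div_le_iff₀ (by positivity),
        ← Real.mul_rpow hT.le hΛ0.le]
      refine Real.rpow_le_rpow hσ.le ?_ (by positivity)
      rw [mul_comm]
      exact hB.weight_le_radius
    have h2 : weight o x ^ (-(δ + n / p)) * N = weight o x ^ (-(n / p) : ℝ) * X := by
      rw [neg_add, Real.rpow_add hσ, hX]
      ring
    rw [h2]
    -- The gradient bound is the function bound over T, so both terms of Morrey's estimate
    -- contribute equally.
    have h3 : C₁ * X + T * (C₁ * X / T) = 2 * C₁ * X := by field_simp; ring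
    rw [h3]
    have h4 : 0 ≤ C₀ * C₁ * (weight o x ^ (-(n / p) : ℝ) * X) := by positivity
    calc C₀ * (T ^ (-(n / p) : ℝ) * (2 * C₁ * X))
        ≤ C₀ * (Λ ^ (n / p : ℝ) * weight o x ^ (-(n / p) : ℝ) * (2 * C₁ * X)) := by gcongr
      _ ≤ _ := by nlinarith
  · refine (hFo (φ x) y τ (C₁ * X / T) hτ (by positivity)
      ((Metric.closedBall_subset_closedBall hτT).trans hB.closedBall_subset) hy fun l =>
        (eLpNorm_mono_measure _ (Measure.restrict_mono
          (Metric.closedBall_subset_closedBall hτT) le_rfl)).trans (e2 l)).trans ?_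
    have h5 : 0 ≤ τ ^ (1 - n / p : ℝ) * X / T := by positivity
    calc C₀ * (τ ^ (1 - n / p : ℝ) * (C₁ * X / T)) = C₀ * C₁ * (τ ^ (1 - n / p : ℝ) * X / T) := by
          ring
      _ ≤ _ := by
          rw [add_mul]
          have := mul_nonneg hcst h5
          linarith

/-- A section with prescribed components in the preferred chart at every point. -/
theorem exists_section (n : ℕ) {M : Type*} [TopologicalSpace M] [ChartedSpace (Model n) M]
    [IsManifold (𝓡 n) ∞ M] {ι : Type*} (r k : ι → ℕ)
    (t : M → ∀ j, (Fin (r j) → Fin n) → (Fin (k j) → Fin n) → ℝ) :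
    ∃ w : TensorSection (n := n) M r k, ∀ x j I J,
      compAt (chartAt (Model n) x) w j I J x = t x j I J := by
  have h : ∀ x j, ∃ S : TensorAt (r j) (k j) (TangentSpace (𝓡 n) x), ∀ I J,
      S (fun a => frameCovec (chartAt (Model n) x) (I a) x)
        (fun b => frameVec (chartAt (Model n) x) (J b) x) = t x j I J := fun x j =>
    (isDualFrame (IsManifold.chart_mem_maximalAtlas x) (mem_chart_source _ x)).exists_tensor (t x j)
  choose w hw using h
  exact ⟨w, hw⟩

/-- Components that transform as those of a tensor define a section. -/
theorem exists_section_of_compatible (n : ℕ) {M : Type*} [TopologicalSpace M]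
    [ChartedSpace (Model n) M] [IsManifold (𝓡 n) ∞ M] {ι : Type*} (r k : ι → ℕ)
    (F : OpenPartialHomeomorph M (Model n) → ∀ j, (Fin (r j) → Fin n) → (Fin (k j) → Fin n) →
      M → ℝ)
    (hF : ∀ φ ∈ IsManifold.maximalAtlas (𝓡 n) ∞ M, ∀ ψ ∈ IsManifold.maximalAtlas (𝓡 n) ∞ M,
      ∀ j I J, ∀ x ∈ φ.source, x ∈ ψ.source →
      F φ j I J x = ∑ I' : Fin (r j) → Fin n, ∑ J' : Fin (k j) → Fin n,
      ((∏ a, jacobian ψ φ (I a) (I' a) x) * ∏ b, jacobian φ ψ (J' b) (J b) x) * F ψ j I' J' x) :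
    ∃ w : TensorSection (n := n) M r k, ∀ φ ∈ IsManifold.maximalAtlas (𝓡 n) ∞ M,
      ∀ j I J, ∀ x ∈ φ.source, compAt φ w j I J x = F φ j I J x := by
  obtain ⟨w, hw⟩ := exists_section n r k fun x j I J => F (chartAt (Model n) x) j I J x
  refine ⟨w, fun φ hφ j I J x hx => ?_⟩
  have hψ := IsManifold.chart_mem_maximalAtlas (I := 𝓡 n) (n := ∞) x
  have hx' := mem_chart_source (Model n) x
  rw [compAt_change hψ hx', hF φ hφ _ hψ j I J x hx hx']
  simp only [hw]

/-- Morrey's inequality gives continuous components in each chart separately. They obey the tensor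
transformation law almost everywhere on overlaps, because those of `u` do, and both sides of the law
are continuous, so it holds everywhere and the components glue to a section. -/
theorem SobolevPair.exists_isCont {p δ N : ℝ} (hp1 : 1 ≤ p) (hp : (n : ℝ) < p)
    {u : TensorSection (n := n) M r k}
    {v : TensorSection (n := n) M r (fun j => k j + 1)} (h : SobolevPair o p δ N u v) :
    ∃ w : TensorSection (n := n) M r k, IsCont w ∧
      ∀ φ ∈ IsManifold.maximalAtlas (𝓡 n) ∞ M, ∀ᵐ z ∂volume.restrict φ.target,
        u (φ.symm z) = w (φ.symm z) := by
  -- Only the existence of the continuous components is used here, so `Λ = 1` is as good as any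
  -- value.
  obtain ⟨C, -, hC⟩ := exists_comp_bounds (n := n) M r k o hp1 hp δ le_rfl
  choose! F hFc hFu _ using hC N u v h
  obtain ⟨w, hw⟩ := exists_section_of_compatible n r k (fun φ j I J x => F φ j I J (φ x)) (by
    intro φ hφ ψ hψ j I J x hx hx'
    have hdom : IsOpen (φ.target ∩ φ.symm ⁻¹' ψ.source) := isOpen_transition_domain
    set D := φ.target ∩ φ.symm ⁻¹' ψ.source with hD
    have hFψ : ∀ I' J', ContinuousOn (fun z => F ψ j I' J' (ψ (φ.symm z))) D := fun I' J' =>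
      (hFc ψ hψ j I' J').comp (contDiffOn_transition hφ hψ).continuousOn
        fun z hz => ψ.map_source hz.2
    have hrhs : ContinuousOn (fun z => ∑ I' : Fin (r j) → Fin n, ∑ J' : Fin (k j) → Fin n,
        ((∏ a, jacobian ψ φ (I a) (I' a) (φ.symm z)) *
          ∏ b, jacobian φ ψ (J' b) (J b) (φ.symm z)) * F ψ j I' J' (ψ (φ.symm z))) D :=
      continuousOn_finsetSum _ fun I' _ => continuousOn_finsetSum _ fun J' _ =>
        ((continuousOn_finsetProd _ fun a _ => jacobian_inv_continuousOn hφ hψ _ _).mul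
          (continuousOn_finsetProd _ fun b _ => continuousOn_jacobian hφ hψ _ _)).mul (hFψ I' J')
    have hae : F φ j I J =ᵐ[volume.restrict D] fun z =>
        ∑ I' : Fin (r j) → Fin n, ∑ J' : Fin (k j) → Fin n,
        ((∏ a, jacobian ψ φ (I a) (I' a) (φ.symm z)) *
          ∏ b, jacobian φ ψ (J' b) (J b) (φ.symm z)) * F ψ j I' J' (ψ (φ.symm z)) := by
      have hψae : ∀ᵐ z ∂(volume.restrict D), ∀ I' J',
          F ψ j I' J' (ψ (φ.symm z)) = comp ψ u j I' J' (ψ (φ.symm z)) := by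
        rw [ae_all_iff]; intro I'
        rw [ae_all_iff]; intro J'
        have h0 := (ae_restrict_iff' ψ.open_target.measurableSet).1 (hFu ψ hψ j I' J')
        have h1 := volume_transition_null hψ hφ (ae_iff.1 h0)
        rw [ae_restrict_iff' hdom.measurableSet]
        refine measure_mono_null (fun z hz => ?_) h1
        simp only [mem_compl_iff, mem_ofPred_eq, Classical.not_imp] at hz
        refine ⟨hz.1.1, hz.1.2, ?_⟩
        simp only [mem_preimage, mem_ofPred_eq, Classical.not_imp]
        exact ⟨ψ.map_source hz.1.2, hz.2⟩
      filter_upwards [hψae, ae_restrict_of_ae_restrict_of_subset inter_subset_left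
        (hFu φ hφ j I J), ae_restrict_mem hdom.measurableSet] with z h1 h2 h3
      rw [h2, comp_eq_compAt hφ h3.1, compAt_change hψ h3.2]
      simp only [h1, comp_chart hψ h3.2]
    have heq := Measure.eqOn_open_of_ae_eq (μ := volume) hae hdom
      ((hFc φ hφ j I J).mono inter_subset_left) hrhs
      (show φ x ∈ D from ⟨φ.map_source hx, by simpa [φ.left_inv hx] using hx'⟩)
    simpa only [φ.left_inv hx] using heq)
  have hcomp : ∀ φ ∈ IsManifold.maximalAtlas (𝓡 n) ∞ M, ∀ j I J,
      EqOn (comp φ w j I J) (F φ j I J) φ.target := fun φ hφ j I J z hz => by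
    rw [comp_eq_compAt hφ hz, hw φ hφ j I J _ (φ.map_target hz), φ.right_inv hz]
  refine ⟨w, fun φ hφ j I J => (hFc φ hφ j I J).congr (hcomp φ hφ j I J), fun φ hφ => ?_⟩
  have hall : ∀ᵐ z ∂volume.restrict φ.target, ∀ j I J, F φ j I J z = comp φ u j I J z := by
    simp only [ae_all_iff]
    exact fun j I J => hFu φ hφ j I J
  filter_upwards [hall, ae_restrict_mem φ.open_target.measurableSet] with z h1 h2
  refine section_ext_of_compAt hφ (φ.map_target h2) fun j I J => ?_
  rw [← comp_eq_compAt hφ h2, ← comp_eq_compAt hφ h2, hcomp φ hφ j I J h2, h1]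

end Representative

/-! ### Weighted supremum bounds, equicontinuity and classical derivatives -/

section Estimates

variable {n : ℕ} {M : Type*} [MetricSpace M] [ChartedSpace (Model n) M]
  [RiemannianBundle (fun x : M => TangentSpace (𝓡 n) x)]
  {φ : OpenPartialHomeomorph M (Model n)} {o : M}
  {ι : Type*} [Fintype ι] {r k : ι → ℕ}

/-- The constant which bounds the norm of a tensor by the largest of its components. -/
def compConst (n : ℕ) (r k : ι → ℕ) (A : ℝ) : ℝ :=
  normConst n r k A * ∑ j, (n : ℝ) ^ r j * (n : ℝ) ^ k j

theorem compConst_nonneg {A : ℝ} (hA : 0 ≤ A) : 0 ≤ compConst n r k A :=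
  mul_nonneg (normConst_nonneg hA) (Finset.sum_nonneg fun _ _ => by positivity)

theorem GoodBall.frameBound {Λ T : ℝ} {x : M} (h : GoodBall o Λ φ T x) : FrameBound φ Λ x := by
  have := h.frame _ (Metric.mem_closedBall_self h.radius_pos.le)
  rwa [φ.left_inv h.mem_source] at this

theorem GoodBall.pointNorm_le {Λ T : ℝ} {x : M} (h : GoodBall o Λ φ T x)
    {w : TensorSection (n := n) M r k} {c : ℝ} (hc : ∀ j I J, |compAt φ w j I J x| ≤ c) :
    pointNorm w x ≤ compConst n r k Λ * c := by
  have hΛ : 0 ≤ Λ := zero_le_one.trans h.one_le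
  refine (h.frameBound.pointNorm_le hΛ h.mem_atlas h.mem_source w).trans ?_
  rw [compConst, mul_assoc, Finset.sum_mul]
  refine mul_le_mul_of_nonneg_left (Finset.sum_le_sum fun j _ => ?_) (normConst_nonneg hΛ)
  refine (Finset.sum_le_card_nsmul _ _ ((n : ℝ) ^ k j * c) fun I _ => ?_).trans (le_of_eq ?_)
  · refine (Finset.sum_le_card_nsmul _ _ c fun J _ => hc j I J).trans (le_of_eq ?_)
    simp
  · simp [mul_assoc]

variable [IsManifold (𝓡 n) ∞ M]
  [IsContMDiffRiemannianBundle (𝓡 n) ∞ (Model n) (fun x : M => TangentSpace (𝓡 n) x)]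
  [MeasurableSpace M] [BorelSpace M]

variable (M r k) in
-- In a chart, a continuous function is determined by its values almost everywhere, so the bounds
-- for Morrey's representative hold for any continuous representative.
theorem exists_isCont_bounds (o : M) {p : ℝ} (hp1 : 1 ≤ p) (hp : (n : ℝ) < p) (δ : ℝ) {Λ : ℝ}
    (hΛ : 1 ≤ Λ) :
    ∃ C : ℝ, 0 ≤ C ∧ ∀ (N : ℝ) (u w : TensorSection (n := n) M r k)
      (v : TensorSection (n := n) M r (fun j => k j + 1)), SobolevPair o p δ N u v →
      IsCont w → (∀ᵐ x ∂(riemVolume n M), u x = w x) →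
      ∀ (φ : OpenPartialHomeomorph M (Model n)) (T : ℝ) (x : M), GoodBall o Λ φ T x → ∀ j I J,
        |comp φ w j I J (φ x)| ≤ C * (weight o x ^ (-(δ + n / p)) * N) ∧
        ∀ (y : Model n) (τ : ℝ), 0 < τ → 3 * τ ≤ T → ‖y - φ x‖ ≤ τ →
          |comp φ w j I J y - comp φ w j I J (φ x)| ≤
            C * (τ ^ (1 - n / p) * (weight o x ^ (-δ) * N) / T) := by
  obtain ⟨C, hC0, hC⟩ := exists_comp_bounds (n := n) M r k o hp1 hp δ hΛ
  refine ⟨C, hC0, fun N u w v h hw huw φ T x hB j I J => ?_⟩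
  obtain ⟨F, hFc, hFu, hF⟩ := hC N u v h φ hB.mem_atlas j I J
  have heq : EqOn F (comp φ w j I J) φ.target := by
    refine Measure.eqOn_open_of_ae_eq (μ := volume) ?_ φ.open_target hFc (hw φ hB.mem_atlas j I J)
    filter_upwards [hFu, ae_chart_of_ae_riemVolume hB.mem_atlas huw] with z h1 h2
    rw [h1]
    unfold comp
    rw [h2]
  obtain ⟨h1, h2⟩ := hF T x hB
  have hx := φ.map_source hB.mem_source
  rw [heq hx] at h1 h2
  refine ⟨h1, fun y τ hτ hτT hy => ?_⟩
  have := h2 y τ hτ hτT hy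
  rwa [heq (hB.closedBall_subset (mem_closedBall_iff_norm.2 (by linarith)))] at this

/-- The weighted supremum bound. -/
theorem exists_pointNorm_le {p : ℝ} (hp1 : 1 ≤ p) (hp : (n : ℝ) < p) (δ : ℝ) {Λ : ℝ}
    (hΛ : ∀ x : M, ∃ φ T, GoodBall (n := n) o Λ φ T x) :
    ∃ C : ℝ, 0 ≤ C ∧ ∀ (N : ℝ) (u w : TensorSection (n := n) M r k)
      (v : TensorSection (n := n) M r (fun j => k j + 1)), SobolevPair o p δ N u v →
      IsCont w → (∀ᵐ x ∂(riemVolume n M), u x = w x) →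
      ∀ x, pointNorm w x ≤ C * N * weight o x ^ (-(δ + n / p)) := by
  obtain ⟨φ₀, T₀, h₀⟩ := hΛ o
  have h1 := h₀.one_le
  obtain ⟨C, hC0, hC⟩ := exists_isCont_bounds (n := n) M r k o hp1 hp δ h1
  refine ⟨compConst n r k Λ * C, mul_nonneg (compConst_nonneg (by linarith)) hC0, ?_⟩
  intro N u w v h hw huw x
  obtain ⟨φ, T, hB⟩ := hΛ x
  refine (hB.pointNorm_le fun j I J => ?_).trans (le_of_eq ?_) (b := compConst n r k Λ *
    (C * (weight o x ^ (-(δ + n / p)) * N)))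
  · rw [← comp_chart hB.mem_atlas hB.mem_source]
    exact (hC N u w v h hw huw φ T x hB j I J).1
  · ring

/-- Equicontinuity of a sequence of sections. -/
def IsEquicont {M : Type*} [TopologicalSpace M] [ChartedSpace (Model n) M] {ι : Type*}
    {r k : ι → ℕ} (w : ℕ → TensorSection (n := n) M r k) : Prop :=
  ∀ φ ∈ IsManifold.maximalAtlas (𝓡 n) ∞ M, ∀ (j : ι) (I : Fin (r j) → Fin n)
    (J : Fin (k j) → Fin n), ∀ z ∈ φ.target, ∀ ε > 0, ∀ᶠ y in 𝓝 z, ∀ i,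
      |comp φ (w i) j I J y - comp φ (w i) j I J z| ≤ ε

/-- On a fixed good ball about the point, the Hölder modulus depends on the sections only through
the common bound `N`. -/
theorem isEquicont_of_sobolevPair {p : ℝ} (hp1 : 1 ≤ p) (hp : (n : ℝ) < p) {δ N : ℝ}
    {u w : ℕ → TensorSection (n := n) M r k}
    {v : ℕ → TensorSection (n := n) M r (fun j => k j + 1)}
    (h : ∀ i, SobolevPair o p δ N (u i) (v i)) (hw : ∀ i, IsCont (w i))
    (huw : ∀ i, ∀ᵐ x ∂(riemVolume n M), u i x = w i x) : IsEquicont w := by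
  intro φ hφ j I J z hz ε hε
  obtain ⟨Λ, T, hB⟩ := exists_goodBall_near o hφ (φ.map_target hz)
  have hB := hB.self_of_nhds
  obtain ⟨C, hC0, hC⟩ := exists_isCont_bounds (n := n) M r k o hp1 hp δ hB.one_le
  have hα : 0 < 1 - n / p := by
    rw [sub_pos, div_lt_one (by linarith)]
    exact hp
  have hlim : Tendsto (fun τ : ℝ => C * (τ ^ (1 - n / p : ℝ) *
      (weight o (φ.symm z) ^ (-δ) * N) / T)) (𝓝[>] 0) (𝓝 0) := by
    have h1 : Tendsto (fun τ : ℝ => τ ^ (1 - n / p : ℝ)) (𝓝[>] 0) (𝓝 0) := by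
      have := (Real.continuousAt_rpow_const 0 (1 - n / p : ℝ) (Or.inr hα.le)).tendsto
      rw [Real.zero_rpow hα.ne'] at this
      exact this.mono_left nhdsWithin_le_nhds
    simpa using ((h1.mul_const (weight o (φ.symm z) ^ (-δ) * N)).div_const T).const_mul C
  have hT : ∀ᶠ τ : ℝ in 𝓝[>] 0, τ < T / 3 :=
    nhdsWithin_le_nhds (Iio_mem_nhds (by linarith [hB.radius_pos]))
  obtain ⟨τ, hτ1, hτ2, hτ3⟩ := ((hlim.eventually (Iio_mem_nhds hε)).and
    (hT.and self_mem_nhdsWithin)).exists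
  filter_upwards [Metric.closedBall_mem_nhds z hτ3] with y hy i
  have := (hC N (u i) (w i) (v i) (h i) (hw i) (huw i) φ T _ hB j I J).2 y τ hτ3 (by linarith)
    (by rw [φ.right_inv hz]; exact mem_closedBall_iff_norm.1 hy)
  rw [φ.right_inv hz] at this
  exact this.trans (le_of_lt hτ1)

/-- Passing to the representatives changes no integral, so in a chart `w` has a weak gradient built
from `w` and `w'`. This gradient is continuous, and a continuous weak gradient is a classical one.
-/
theorem SobolevPair.isCovDeriv {p δ N : ℝ} {u w : TensorSection (n := n) M r k}
    {v w' : TensorSection (n := n) M r (fun j => k j + 1)} (h : SobolevPair o p δ N u v)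
    (hw : IsCont w) (hw' : IsCont w') (huw : ∀ᵐ x ∂(riemVolume n M), u x = w x)
    (hvw : ∀ᵐ x ∂(riemVolume n M), v x = w' x) : IsCovDeriv w w' := by
  intro φ hφ j I J z hz
  have hu := ae_chart_of_ae_riemVolume hφ huw
  have hv := ae_chart_of_ae_riemVolume hφ hvw
  have hconn : ∀ l, ContinuousOn (connectionTerm φ w j I J l) φ.target := fun l =>
    (continuousOn_finsetSum _ fun a _ => continuousOn_finsetSum _ fun m _ =>
      (continuousOn_christoffel hφ _ _ _).mul (hw φ hφ j _ _)).sub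
    (continuousOn_finsetSum _ fun a _ => continuousOn_finsetSum _ fun m _ =>
      (continuousOn_christoffel hφ _ _ _).mul (hw φ hφ j _ _))
  have hgrad : ∀ l, ContinuousOn (chartGrad φ w w' j I J l) φ.target := fun l =>
    (hw' φ hφ j I (Fin.cons l J)).sub (hconn l)
  have hG : HasWeakGrad φ.target (comp φ w j I J) (chartGrad φ w w' j I J) := by
    refine ⟨(hw φ hφ j I J).locallyIntegrableOn φ.open_target.measurableSet,
      fun l => (hgrad l).locallyIntegrableOn φ.open_target.measurableSet, fun l ψ h1 h2 h3 => ?_⟩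
    have e1 : ∫ z in φ.target, comp φ w j I J z * fderiv ℝ ψ z (stdVec l) =
        ∫ z in φ.target, comp φ u j I J z * fderiv ℝ ψ z (stdVec l) := by
      refine integral_congr_ae ?_
      filter_upwards [hu] with z hz
      unfold comp
      rw [hz]
    have e2 : ∫ z in φ.target, chartGrad φ w w' j I J l z * ψ z =
        ∫ z in φ.target, chartGrad φ u v j I J l z * ψ z := by
      refine integral_congr_ae ?_
      filter_upwards [hu, hv] with z hz hz'
      unfold chartGrad connectionTerm comp
      rw [hz, hz']
    rw [e1, e2]
    exact (h.hasWeakGrad hφ j I J).weak l ψ h1 h2 h3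
  have hd := hG.hasFDerivAt φ.open_target (hw φ hφ j I J) hgrad hz
  refine ⟨hd.differentiableAt, fun l => ?_⟩
  rw [hd.fderiv]
  simp [chartGrad]

end Estimates

/-! ### Locally uniform limits of sections and of their covariant derivatives -/

section Limit

variable {n : ℕ} {M : Type*} [TopologicalSpace M] [ChartedSpace (Model n) M]
  {ι : Type*} {r k : ι → ℕ}

/-- Locally uniform convergence of the components of sections. -/
def TendstoLocUnif (w : ℕ → TensorSection (n := n) M r k) (l : Filter ℕ)
    (w₀ : TensorSection (n := n) M r k) : Prop :=
  ∀ φ ∈ IsManifold.maximalAtlas (𝓡 n) ∞ M, ∀ (j : ι) (I : Fin (r j) → Fin n)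
    (J : Fin (k j) → Fin n), ∀ z ∈ φ.target,
    Tendsto (fun q : ℕ × Model n => comp φ (w q.1) j I J q.2 - comp φ w₀ j I J q.2)
      (l ×ˢ 𝓝 z) (𝓝 0)

/-- Along an ultrafilter every bounded sequence of numbers converges, so all components at all
points have limits at once; the transformation law passes to them, and equicontinuity upgrades
pointwise to locally uniform convergence. -/
theorem IsEquicont.exists_limit [IsManifold (𝓡 n) ∞ M] {w : ℕ → TensorSection (n := n) M r k} (hw : IsEquicont w)
    (𝒰 : Ultrafilter ℕ)
    (hb : ∀ φ ∈ IsManifold.maximalAtlas (𝓡 n) ∞ M, ∀ j I J, ∀ x ∈ φ.source, ∃ A, ∀ i,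
      |compAt φ (w i) j I J x| ≤ A) :
    ∃ w₀ : TensorSection (n := n) M r k, IsCont w₀ ∧ TendstoLocUnif w 𝒰 w₀ ∧
      ∀ φ ∈ IsManifold.maximalAtlas (𝓡 n) ∞ M, ∀ j I J, ∀ x ∈ φ.source,
        Tendsto (fun i => compAt φ (w i) j I J x) 𝒰 (𝓝 (compAt φ w₀ j I J x)) := by
  have hlim : ∀ φ ∈ IsManifold.maximalAtlas (𝓡 n) ∞ M, ∀ j I J, ∀ x ∈ φ.source, ∃ c,
      Tendsto (fun i => compAt φ (w i) j I J x) 𝒰 (𝓝 c) := by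
    intro φ hφ j I J x hx
    obtain ⟨A, hA⟩ := hb φ hφ j I J x hx
    obtain ⟨c, -, hc⟩ := (isCompact_Icc (a := -A) (b := A)).ultrafilter_le_nhds
      (𝒰.map fun i => compAt φ (w i) j I J x) (by
        rw [Ultrafilter.coe_map, le_principal_iff, mem_map]
        exact Eventually.of_forall (f := (𝒰 : Filter ℕ)) fun i => abs_le.1 (hA i))
    exact ⟨c, hc⟩
  choose! F hF using hlim
  obtain ⟨w₀, hw₀⟩ := exists_section_of_compatible n r k F (by
    intro φ hφ ψ hψ j I J x hx hx'
    refine tendsto_nhds_unique (hF φ hφ j I J x hx) ?_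
    simp only [fun i => compAt_change (φ := φ) hψ hx' (w i) j I J]
    exact tendsto_finsetSum _ fun I' _ => tendsto_finsetSum _ fun J' _ =>
      (hF ψ hψ j I' J' x hx').const_mul _)
  have hpt : ∀ φ ∈ IsManifold.maximalAtlas (𝓡 n) ∞ M, ∀ j I J, ∀ x ∈ φ.source,
      Tendsto (fun i => compAt φ (w i) j I J x) 𝒰 (𝓝 (compAt φ w₀ j I J x)) := by
    intro φ hφ j I J x hx
    rw [hw₀ φ hφ j I J x hx]
    exact hF φ hφ j I J x hx
  have hpt' : ∀ φ ∈ IsManifold.maximalAtlas (𝓡 n) ∞ M, ∀ j I J, ∀ z ∈ φ.target,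
      Tendsto (fun i => comp φ (w i) j I J z) 𝒰 (𝓝 (comp φ w₀ j I J z)) := by
    intro φ hφ j I J z hz
    simp only [comp_eq_compAt hφ hz]
    exact hpt φ hφ j I J _ (φ.map_target hz)
  have hosc : ∀ φ ∈ IsManifold.maximalAtlas (𝓡 n) ∞ M, ∀ j I J, ∀ z ∈ φ.target, ∀ ε > 0,
      ∀ᶠ y in 𝓝 z, |comp φ w₀ j I J y - comp φ w₀ j I J z| ≤ ε := by
    intro φ hφ j I J z hz ε hε
    filter_upwards [hw φ hφ j I J z hz ε hε, φ.open_target.mem_nhds hz] with y hy hyt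
    exact le_of_tendsto ((hpt' φ hφ j I J y hyt).sub (hpt' φ hφ j I J z hz)).abs
      (Eventually.of_forall hy)
  refine ⟨w₀, fun φ hφ j I J z hz => ContinuousAt.continuousWithinAt ?_, ?_, hpt⟩
  · refine Metric.continuousAt_iff'.2 fun ε hε => ?_
    filter_upwards [hosc φ hφ j I J z hz (ε / 2) (half_pos hε)] with y hy
    rw [Real.dist_eq]
    linarith
  · intro φ hφ j I J z hz
    refine Metric.tendsto_nhds.2 fun ε hε => ?_
    have hε' : 0 < ε / 4 := by positivity
    have h1 : ∀ᶠ i in (𝒰 : Filter ℕ), |comp φ (w i) j I J z - comp φ w₀ j I J z| < ε / 4 := by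
      simpa [Real.dist_eq] using Metric.tendsto_nhds.1 (hpt' φ hφ j I J z hz) _ hε'
    filter_upwards [h1.prod_mk ((hw φ hφ j I J z hz _ hε').and (hosc φ hφ j I J z hz _ hε'))]
      with q hq
    obtain ⟨a1, a2, a3⟩ := hq
    rw [Real.dist_eq, sub_zero]
    have a2 := abs_le.1 (a2 q.1)
    have a3 := abs_le.1 a3
    have a1 := abs_lt.1 a1
    rw [abs_lt]
    constructor <;> linarith

/-- In a chart the full derivative of a component is a component of the covariant derivative minus
the connection term. Both converge locally uniformly, the latter because Γ is continuous, so the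
theorem on limits of derivatives applies. -/
theorem IsCovDeriv.of_tendstoLocUnif [IsManifold (𝓡 n) ∞ M]
    [RiemannianBundle (fun x : M => TangentSpace (𝓡 n) x)]
    [IsContMDiffRiemannianBundle (𝓡 n) ∞ (Model n) (fun x : M => TangentSpace (𝓡 n) x)]
    {l : Filter ℕ} [NeBot l]
    {w : ℕ → TensorSection (n := n) M r k} {w₀ : TensorSection (n := n) M r k}
    {v : ℕ → TensorSection (n := n) M r (fun j => k j + 1)}
    {v₀ : TensorSection (n := n) M r (fun j => k j + 1)} (h : ∀ i, IsCovDeriv (w i) (v i))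
    (hw : TendstoLocUnif w l w₀) (hv : TendstoLocUnif v l v₀) : IsCovDeriv w₀ v₀ := by
  intro φ hφ j I J z hz
  let G : TensorSection (n := n) M r k → TensorSection (n := n) M r (fun j => k j + 1) →
    Model n → Model n →L[ℝ] ℝ := fun a b y =>
    ∑ l, chartGrad φ a b j I J l y • (EuclideanSpace.proj l : Model n →L[ℝ] ℝ)
  have hder : ∀ i, ∀ y ∈ φ.target, HasFDerivAt (comp φ (w i) j I J) (G (w i) (v i) y) y := by
    intro i y hy
    obtain ⟨h1, h2⟩ := h i φ hφ j I J y hy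
    convert h1.hasFDerivAt using 1
    ext a
    rw [apply_eq_sum_stdVec (fderiv ℝ (comp φ (w i) j I J) y) a]
    simp only [G, _root_.sum_apply, _root_.smul_apply, chartGrad, h2, smul_eq_mul]
    refine Finset.sum_congr rfl fun l _ => ?_
    simp [mul_comm]
  have hconn : ∀ l', Tendsto (fun q : ℕ × Model n => connectionTerm φ (w q.1) j I J l' q.2 -
      connectionTerm φ w₀ j I J l' q.2) (l ×ˢ 𝓝 z) (𝓝 0) := by
    intro l'
    have hterm : ∀ m i i' I J, Tendsto (fun q : ℕ × Model n => christoffel φ m i i' q.2 *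
        comp φ (w q.1) j I J q.2 - christoffel φ m i i' q.2 * comp φ w₀ j I J q.2)
        (l ×ˢ 𝓝 z) (𝓝 0) := by
      intro m i i' I J
      have h1 : Tendsto (fun q : ℕ × Model n => christoffel φ m i i' q.2) (l ×ˢ 𝓝 z)
          (𝓝 (christoffel φ m i i' z)) :=
        ((continuousOn_christoffel hφ m i i').continuousAt (φ.open_target.mem_nhds hz)).tendsto.comp
          tendsto_snd
      simpa [mul_sub] using h1.mul (hw φ hφ j I J z hz)
    have hsum : ∀ (d : ℕ) (f g : Fin d → Fin n → ℕ × Model n → ℝ),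
        (∀ a m, Tendsto (fun q => f a m q - g a m q) (l ×ˢ 𝓝 z) (𝓝 0)) →
        Tendsto (fun q => (∑ a, ∑ m, f a m q) - ∑ a, ∑ m, g a m q) (l ×ˢ 𝓝 z) (𝓝 0) := by
      intro d f g hfg
      simp only [← Finset.sum_sub_distrib]
      simpa using tendsto_finsetSum Finset.univ fun a _ =>
        tendsto_finsetSum Finset.univ fun m _ => hfg a m
    have := (hsum (r j) _ _ fun a m => hterm (I a) l' m (Function.update I a m) J).sub
      (hsum (k j) _ _ fun b m => hterm m l' (J b) I (Function.update J b m))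
    rw [sub_zero] at this
    refine this.congr fun q => ?_
    unfold connectionTerm
    ring
  have hgrad : ∀ l', Tendsto (fun q : ℕ × Model n => chartGrad φ (w q.1) (v q.1) j I J l' q.2 -
      chartGrad φ w₀ v₀ j I J l' q.2) (l ×ˢ 𝓝 z) (𝓝 0) := by
    intro l'
    have := (hv φ hφ j I (Fin.cons l' J) z hz).sub (hconn l')
    rw [sub_zero] at this
    refine this.congr fun q => ?_
    unfold chartGrad
    ring
  have hunif : TendstoUniformlyOnFilter (fun i => G (w i) (v i)) (G w₀ v₀) l (𝓝 z) := by
    have h0 : Tendsto (fun q : ℕ × Model n => G w₀ v₀ q.2 - G (w q.1) (v q.1) q.2)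
        (l ×ˢ 𝓝 z) (𝓝 0) := by
      have h1 := tendsto_finsetSum Finset.univ fun l' _ =>
        ((hgrad l').neg).smul_const (EuclideanSpace.proj l' : Model n →L[ℝ] ℝ)
      simp only [neg_zero, zero_smul, Finset.sum_const_zero] at h1
      refine h1.congr fun q => ?_
      simp only [G, ← Finset.sum_sub_distrib, sub_smul, neg_sub]
    rw [Metric.tendstoUniformlyOnFilter_iff]
    intro ε hε
    filter_upwards [Metric.tendsto_nhds.1 h0 ε hε] with q hq
    rw [dist_eq_norm]
    simpa using hq
  have hd : HasFDerivAt (comp φ w₀ j I J) (G w₀ v₀ z) z := by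
    refine hasFDerivAt_of_tendstoUniformlyOnFilter (f := fun i => comp φ (w i) j I J) hunif ?_ ?_
    · filter_upwards [tendsto_snd.eventually (φ.open_target.mem_nhds hz)] with q hq
      exact hder q.1 q.2 hq
    · filter_upwards [φ.open_target.mem_nhds hz] with y hy
      have h1 := (hw φ hφ j I J y hy).comp (tendsto_id.prodMk
        (tendsto_const_nhds (x := y) (f := l)))
      simpa using (h1.add_const (comp φ w₀ j I J y))
  refine ⟨hd.differentiableAt, fun l' => ?_⟩
  rw [hd.fderiv]
  simp [G, chartGrad]

end Limit

/-! ### Convergence in weighted supremum norms -/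

section Compactness

variable {n : ℕ} {M : Type*} [MetricSpace M] [ChartedSpace (Model n) M]
  [RiemannianBundle (fun x : M => TangentSpace (𝓡 n) x)]
  [IsManifold (𝓡 n) ∞ M]
  [IsContMDiffRiemannianBundle (𝓡 n) ∞ (Model n) (fun x : M => TangentSpace (𝓡 n) x)]
  {o : M} {ι : Type*} [Fintype ι] {r k : ι → ℕ}

theorem compAt_sub {M : Type*} [TopologicalSpace M] [ChartedSpace (Model n) M] {ι : Type*}
    {r k : ι → ℕ} (φ : OpenPartialHomeomorph M (Model n)) (u v : TensorSection (n := n) M r k)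
    (j : ι) (I : Fin (r j) → Fin n) (J : Fin (k j) → Fin n) (x : M) :
    compAt φ (u - v) j I J x = compAt φ u j I J x - compAt φ v j I J x := rfl

theorem TendstoLocUnif.eventually_pointNorm_le {w : ℕ → TensorSection (n := n) M r k}
    {l : Filter ℕ} {w₀ : TensorSection (n := n) M r k} (h : TendstoLocUnif w l w₀) {S : Set M}
    (hS : IsCompact S) {ε : ℝ} (hε : 0 < ε) :
    ∀ᶠ i in l, ∀ x ∈ S, pointNorm (w i - w₀) x ≤ ε := by
  refine hS.induction_on (p := fun S => ∀ᶠ i in l, ∀ x ∈ S, pointNorm (w i - w₀) x ≤ ε)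
    (by simp) (fun s t hst ht => ht.mono fun i hi x hx => hi x (hst hx))
    (fun s t hs ht => by
      filter_upwards [hs, ht] with i h1 h2 x hx
      exact hx.elim (h1 x) (h2 x)) fun x₀ _ => ?_
  have hφ := IsManifold.chart_mem_maximalAtlas (I := 𝓡 n) (n := ∞) x₀
  have hx₀ := mem_chart_source (Model n) x₀
  set φ := chartAt (Model n) x₀
  obtain ⟨Λ, T, hB⟩ := exists_goodBall_near x₀ hφ hx₀
  have hΛ : 0 ≤ Λ := zero_le_one.trans hB.self_of_nhds.one_le
  set Q := compConst n r k Λ with hQ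
  have hQ0 : 0 ≤ Q := compConst_nonneg hΛ
  -- `Q` compares the norm with the largest component; it may vanish, hence the `+ 1`.
  set η := ε / (Q + 1) with hη
  have hη0 : 0 < η := by positivity
  have hall : ∀ᶠ q : ℕ × Model n in l ×ˢ 𝓝 (φ x₀), ∀ j I J,
      |comp φ (w q.1) j I J q.2 - comp φ w₀ j I J q.2| ≤ η := by
    simp only [eventually_all]
    intro j I J
    filter_upwards [Metric.tendsto_nhds.1 (h φ hφ j I J _ (φ.map_source hx₀)) η hη0] with q hq
    rw [Real.dist_eq, sub_zero] at hq
    exact hq.le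
  obtain ⟨pa, hpa, pb, hpb, hab⟩ := eventually_prod_iff.1 hall
  refine ⟨{x | GoodBall x₀ Λ φ T x ∧ pb (φ x)},
    nhdsWithin_le_nhds (hB.and ((φ.continuousAt hx₀).eventually hpb)), ?_⟩
  filter_upwards [hpa] with i hi x hx
  obtain ⟨hx1, hx2⟩ := hx
  refine (hx1.pointNorm_le fun j I J => ?_).trans (b := Q * η) ?_
  · rw [compAt_sub, ← comp_chart hφ hx1.mem_source, ← comp_chart hφ hx1.mem_source]
    exact hab hi hx2 j I J
  · rw [hη, mul_div_assoc', div_le_iff₀ (by positivity)]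
    nlinarith

/-- The strict inequality β < β₀ handles infinity: where σ ≥ ρ the quantity is at most |A| ρ^(-(β₀ -
β)), uniformly in the sequence. On the remaining compact set locally uniform convergence suffices,
as the weight is bounded there. -/
theorem TendstoLocUnif.tendsto_iSup {w : ℕ → TensorSection (n := n) M r k}
    {l : Filter ℕ} {w₀ : TensorSection (n := n) M r k} (h : TendstoLocUnif w l w₀)
    (hcore : ∀ ρ : ℝ, ∃ S : Set M, IsCompact S ∧ ∀ x ∉ S, ρ ≤ dist x o) {A β₀ β : ℝ}
    (hA : ∀ i x, pointNorm (w i - w₀) x ≤ A * weight o x ^ (-β₀)) (hβ : β < β₀) :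
    Tendsto (fun i => ⨆ x, ENNReal.ofReal (pointNorm (w i - w₀) x * weight o x ^ β)) l (𝓝 0) := by
  rw [ENNReal.tendsto_nhds_zero]
  intro ε hε
  obtain ⟨e, he0, heε⟩ := ENNReal.lt_iff_exists_nnreal_btwn.1 hε
  have he : (0 : ℝ) < e := by exact_mod_cast he0
  have hlim : Tendsto (fun t : ℝ => |A| * t ^ (-(β₀ - β))) atTop (𝓝 0) := by
    simpa using (tendsto_rpow_neg_atTop (sub_pos.2 hβ)).const_mul |A|
  obtain ⟨ρ, hρ1, hρ⟩ := ((eventually_ge_atTop (1 : ℝ)).and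
    (hlim.eventually (Iio_mem_nhds he))).exists
  obtain ⟨S, hS, hSρ⟩ := hcore ρ
  obtain ⟨B, hB⟩ := hS.bddAbove_image (f := fun x => weight o x ^ β)
    ((continuous_weight o).rpow_const fun x => Or.inl (weight_pos o x).ne').continuousOn
  have hB' : ∀ x ∈ S, weight o x ^ β ≤ |B| + 1 := fun x hx =>
    (hB (mem_image_of_mem _ hx)).trans ((le_abs_self B).trans (by linarith))
  have hB0 : 0 < |B| + 1 := by positivity
  filter_upwards [h.eventually_pointNorm_le hS (div_pos he hB0)] with i hi
  refine le_trans (iSup_le fun x => ?_) heε.le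
  rw [← ENNReal.ofReal_coe_nnreal]
  refine ENNReal.ofReal_le_ofReal ?_
  have hσ := weight_pos o x
  by_cases hx : x ∈ S
  · calc pointNorm (w i - w₀) x * weight o x ^ β ≤ e / (|B| + 1) * (|B| + 1) :=
          mul_le_mul (hi x hx) (hB' x hx) (by positivity) (by positivity)
      _ = e := div_mul_cancel₀ _ hB0.ne'
  · have hρx : ρ ≤ weight o x := (hSρ x hx).trans (dist_le_weight o x)
    calc pointNorm (w i - w₀) x * weight o x ^ β
        ≤ |A| * weight o x ^ (-β₀) * weight o x ^ β := by
          refine mul_le_mul_of_nonneg_right ((hA i x).trans ?_) (by positivity)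
          exact mul_le_mul_of_nonneg_right (le_abs_self A) (by positivity)
      _ = |A| * weight o x ^ (-(β₀ - β)) := by
          rw [mul_assoc, ← Real.rpow_add hσ]
          ring_nf
      _ ≤ |A| * ρ ^ (-(β₀ - β)) := by
          refine mul_le_mul_of_nonneg_left ?_ (abs_nonneg A)
          exact Real.rpow_le_rpow_of_nonpos (by linarith) hρx (by linarith)
      _ ≤ e := le_of_lt hρ

/-- Equicontinuous sequences with a weighted bound have limits along ultrafilters, uniformly with
respect to every smaller weight. -/
theorem IsEquicont.exists_weighted_limit {w : ℕ → TensorSection (n := n) M r k}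
    (hw : IsEquicont w) (𝒰 : Ultrafilter ℕ) {Λ : ℝ}
    (hΛ : ∀ x : M, ∃ φ T, GoodBall (n := n) o Λ φ T x)
    (hcore : ∀ ρ : ℝ, ∃ S : Set M, IsCompact S ∧ ∀ x ∉ S, ρ ≤ dist x o) {A β₀ : ℝ}
    (hA : ∀ i x, pointNorm (w i) x ≤ A * weight o x ^ (-β₀)) :
    ∃ w₀ : TensorSection (n := n) M r k, IsCont w₀ ∧ TendstoLocUnif w 𝒰 w₀ ∧
      (∃ A', ∀ x, pointNorm w₀ x ≤ A' * weight o x ^ (-β₀)) ∧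
      ∀ β < β₀, Tendsto (fun i => ⨆ x,
        ENNReal.ofReal (pointNorm (w i - w₀) x * weight o x ^ β)) 𝒰 (𝓝 0) := by
  obtain ⟨w₀, hw₀, hloc, hpt⟩ := hw.exists_limit 𝒰 (by
    intro φ hφ j I J x hx
    obtain ⟨Λ', T, hB⟩ := exists_goodBall_near x hφ hx
    have hB := hB.self_of_nhds
    have h1 := zero_le_one.trans hB.one_le
    exact ⟨normConst n r k Λ' * (A * weight o x ^ (-β₀)), fun i =>
      (hB.frameBound.abs_compAt_le h1 (w i) j I J).trans
        (mul_le_mul_of_nonneg_left (hA i x) (normConst_nonneg h1))⟩)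
  set Q := normConst n r k Λ with hQ
  set Q' := compConst n r k Λ with hQ'
  have hbound : ∀ x, ∃ φ T, GoodBall (n := n) o Λ φ T x ∧
      (∀ i j I J, |compAt φ (w i) j I J x| ≤ Q * (A * weight o x ^ (-β₀))) ∧
      ∀ j I J, |compAt φ w₀ j I J x| ≤ Q * (A * weight o x ^ (-β₀)) := by
    intro x
    obtain ⟨φ, T, hB⟩ := hΛ x
    have h1 := zero_le_one.trans hB.one_le
    have h2 : ∀ i j I J, |compAt φ (w i) j I J x| ≤ Q * (A * weight o x ^ (-β₀)) :=
      fun i j I J => (hB.frameBound.abs_compAt_le h1 (w i) j I J).trans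
        (mul_le_mul_of_nonneg_left (hA i x) (normConst_nonneg h1))
    exact ⟨φ, T, hB, h2, fun j I J => le_of_tendsto (hpt φ hB.mem_atlas j I J x hB.mem_source).abs
      (Eventually.of_forall fun i => h2 i j I J)⟩
  refine ⟨w₀, hw₀, hloc, ⟨Q' * (Q * A), fun x => ?_⟩, fun β hβ =>
    hloc.tendsto_iSup (A := Q' * (2 * (Q * A))) hcore (fun i x => ?_) hβ⟩
  · obtain ⟨φ, T, hB, -, h2⟩ := hbound x
    exact (hB.pointNorm_le (h2)).trans (le_of_eq (by ring))
  · obtain ⟨φ, T, hB, h1, h2⟩ := hbound x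
    refine (hB.pointNorm_le (c := 2 * (Q * (A * weight o x ^ (-β₀)))) fun j I J => ?_).trans
      (le_of_eq (by ring))
    rw [compAt_sub]
    have e1 := h1 i j I J
    have e2 := h2 j I J
    refine (abs_sub _ _).trans ?_
    linarith

end Compactness

/-- The hyperfilter is finer than the cofinite filter, so its limit is a cluster point of the
sequence, and in a first countable space a cluster point is the limit of a subsequence. -/
theorem exists_subseq_of_tendsto_hyperfilter {f : ℕ → ℝ≥0∞}
    (h : Tendsto f (hyperfilter ℕ) (𝓝 0)) :
    ∃ θ : ℕ → ℕ, StrictMono θ ∧ Tendsto (fun i => f (θ i)) atTop (𝓝 0) := by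
  have h1 : MapClusterPt 0 atTop f := by
    refine h.mapClusterPt.mono ?_
    rw [← Nat.cofinite_eq_atTop]
    exact hyperfilter_le_cofinite
  exact h1.tendsto_subseq

/-! ### Estimating the norms, which are infima over jets -/

section Norms

variable {n : ℕ} {M : Type*} [MetricSpace M] [ChartedSpace (Model n) M]
  [RiemannianBundle (fun x : M => TangentSpace (𝓡 n) x)]
  {o : M} {ι : Type*} [Fintype ι] {r k : ι → ℕ}

/-- `sup |u| σ^β`. -/
def weightedSup (o : M) (β : ℝ) (u : TensorSection (n := n) M r k) : ℝ≥0∞ :=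
  ⨆ x : M, ENNReal.ofReal (pointNorm u x * weight o x ^ β)

theorem weightedSup_le {β β₀ A : ℝ} (hβ : β ≤ β₀) (hA : 0 ≤ A)
    {u : TensorSection (n := n) M r k}
    (h : ∀ x, pointNorm u x ≤ A * weight o x ^ (-β₀)) :
    weightedSup o β u ≤ ENNReal.ofReal A := by
  refine iSup_le fun x => ENNReal.ofReal_le_ofReal ?_
  have hσ := weight_pos o x
  calc pointNorm u x * weight o x ^ β ≤ A * weight o x ^ (-β₀) * weight o x ^ β :=
        mul_le_mul_of_nonneg_right (h x) (by positivity)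
    _ = A * weight o x ^ (-(β₀ - β)) := by
        rw [mul_assoc, ← Real.rpow_add hσ]
        ring_nf
    _ ≤ A * 1 := by
        refine mul_le_mul_of_nonneg_left ?_ hA
        exact Real.rpow_le_one_of_one_le_of_nonpos (one_le_weight o x) (by linarith)
    _ = A := mul_one A

theorem weightedSup_lt_top {β β₀ A : ℝ} (hβ : β ≤ β₀) {u : TensorSection (n := n) M r k}
    (h : ∀ x, pointNorm u x ≤ A * weight o x ^ (-β₀)) : weightedSup o β u < ⊤ := by
  refine (weightedSup_le (A := |A|) hβ (abs_nonneg A) fun x => (h x).trans ?_).trans_lt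
    ENNReal.ofReal_lt_top
  exact mul_le_mul_of_nonneg_right (le_abs_self A) (Real.rpow_nonneg (weight_pos o x).le _)

theorem isCont_of_weightedCNorm_lt_top {s : ℕ} {β : ℝ} {u : TensorSection (n := n) M r k}
    (h : weightedCNorm o s β u < ⊤) : IsCont u := by
  obtain ⟨D, hD⟩ := iInf_lt_iff.1 h
  obtain ⟨⟨h0, hc, -⟩, -⟩ := iInf_lt_iff.1 hD
  rw [← h0]
  exact hc 0 (Nat.zero_le s)

theorem weightedCNorm_zero_le {β : ℝ} {u : TensorSection (n := n) M r k} (hu : IsCont u) :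
    weightedCNorm o 0 β u ≤ weightedSup o β u := by
  -- The norm does not see entries above the order 0, so they are filled with zero.
  let D : ∀ m : ℕ, TensorSection (n := n) M r (fun j => k j + m) := fun m =>
    match m with
    | 0 => u
    | _ + 1 => 0
  have hD : IsClassicalJet 0 u D := by
    refine ⟨rfl, fun m hm => ?_, fun m hm => absurd hm (Nat.not_lt_zero m)⟩
    obtain rfl : m = 0 := Nat.le_zero.1 hm
    exact hu
  refine (iInf₂_le D hD).trans ?_
  simp only [zero_add, Finset.sum_range_one, Nat.cast_zero, add_zero]
  exact le_rfl

theorem weightedCNorm_one_le {β : ℝ} {u : TensorSection (n := n) M r k}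
    {v : TensorSection (n := n) M r (fun j => k j + 1)} (hu : IsCont u) (hv : IsCont v)
    (huv : IsCovDeriv u v) :
    weightedCNorm o 1 β u ≤ weightedSup o β u + weightedSup o (β + 1) v := by
  let D : ∀ m : ℕ, TensorSection (n := n) M r (fun j => k j + m) := fun m =>
    match m with
    | 0 => u
    | 1 => v
    | _ + 2 => 0
  have hD : IsClassicalJet 1 u D := by
    refine ⟨rfl, fun m hm => ?_, fun m hm => ?_⟩
    · obtain rfl | rfl := Nat.le_one_iff_eq_zero_or_eq_one.1 hm
      · exact hu
      · exact hv
    · obtain rfl := Nat.lt_one_iff.1 hm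
      exact huv
  refine (iInf₂_le D hD).trans ?_
  rw [Finset.sum_range_succ, Finset.sum_range_one]
  simp only [Nat.cast_zero, add_zero, Nat.cast_one]
  exact le_rfl

theorem comp_sub {M : Type*} [TopologicalSpace M] [ChartedSpace (Model n) M] {ι : Type*}
    {r k : ι → ℕ} (φ : OpenPartialHomeomorph M (Model n)) (u v : TensorSection (n := n) M r k)
    (j : ι) (I : Fin (r j) → Fin n) (J : Fin (k j) → Fin n) :
    comp φ (u - v) j I J = comp φ u j I J - comp φ v j I J := rfl

theorem IsCont.sub {M : Type*} [TopologicalSpace M] [ChartedSpace (Model n) M] {ι : Type*}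
    {r k : ι → ℕ} {u v : TensorSection (n := n) M r k} (hu : IsCont u) (hv : IsCont v) :
    IsCont (u - v) := fun φ hφ j I J => (hu φ hφ j I J).sub (hv φ hφ j I J)

theorem IsCovDeriv.sub {M : Type*} [TopologicalSpace M] [ChartedSpace (Model n) M]
    [RiemannianBundle (fun x : M => TangentSpace (𝓡 n) x)] {ι : Type*} {r k : ι → ℕ}
    {u v : TensorSection (n := n) M r k}
    {u' v' : TensorSection (n := n) M r (fun j => k j + 1)} (hu : IsCovDeriv u u')
    (hv : IsCovDeriv v v') : IsCovDeriv (u - v) (u' - v') := by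
  intro φ hφ j I J z hz
  obtain ⟨h1, h2⟩ := hu φ hφ j I J z hz
  obtain ⟨h3, h4⟩ := hv φ hφ j I J z hz
  refine ⟨h1.sub h3, fun l => ?_⟩
  have hconn : connectionTerm φ (u - v) j I J l z =
      connectionTerm φ u j I J l z - connectionTerm φ v j I J l z := by
    unfold connectionTerm
    simp only [comp_sub, Pi.sub_apply, mul_sub, Finset.sum_sub_distrib]
    ring
  rw [hconn, comp_sub, comp_sub, fderiv_sub h1 h3, Pi.sub_apply, h2, h4]
  simp only [_root_.sub_apply]
  ring

variable [MeasurableSpace M]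

/-- The Sobolev norm computed with a given sequence of generalized derivatives. -/
def jetNorm (o : M) (p : ℝ) (s : ℕ) (δ : ℝ)
    (D : ∀ m : ℕ, TensorSection (n := n) M r (fun j => k j + m)) : ℝ≥0∞ :=
  (∑ m ∈ Finset.range (s + 1), ∫⁻ x, ENNReal.ofReal
      (pointNorm (D m) x ^ p * weight o x ^ (p * (m + δ))) ∂(riemVolume n M)) ^ (1 / p)

/-- Reduces higher order to first order: each derivative D^m u with m < s is treated as a section
with weight exponent m + δ. -/
theorem IsWeakJet.sobolevPair {p δ N : ℝ} {s : ℕ} {u : TensorSection (n := n) M r k}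
    {D : ∀ m : ℕ, TensorSection (n := n) M r (fun j => k j + m)} (h : IsWeakJet s u D)
    (hp : 0 < p) (hN : 0 ≤ N) (hD : jetNorm o p s δ D ≤ ENNReal.ofReal N) {m : ℕ} (hm : m < s) :
    SobolevPair o p (m + δ) N (D m) (D (m + 1)) := by
  have hsum : ∑ m ∈ Finset.range (s + 1), ∫⁻ x, ENNReal.ofReal
      (pointNorm (D m) x ^ p * weight o x ^ (p * (m + δ))) ∂(riemVolume n M) ≤
      ENNReal.ofReal (N ^ p) := by
    rw [← ENNReal.ofReal_rpow_of_nonneg hN hp.le]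
    rw [jetNorm, one_div] at hD
    exact (ENNReal.rpow_inv_le_iff hp).1 hD
  have hInt : ∀ m ≤ s, ∫⁻ x, ENNReal.ofReal
      (pointNorm (D m) x ^ p * weight o x ^ (p * (m + δ))) ∂(riemVolume n M) ≤
      ENNReal.ofReal (N ^ p) := fun m hm =>
    (Finset.single_le_sum (f := fun m => ∫⁻ x, ENNReal.ofReal
      (pointNorm (D m) x ^ p * weight o x ^ (p * (m + δ))) ∂(riemVolume n M))
      (fun _ _ => zero_le) (Finset.mem_range.2 (Nat.lt_succ_of_le hm))).trans hsum
  refine ⟨hN, h.2.1 m hm.le, h.2.1 (m + 1) hm, h.2.2 m hm, hInt m hm.le, ?_⟩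
  have h1 : (m : ℝ) + δ + 1 = ((m + 1 : ℕ) : ℝ) + δ := by push_cast; ring
  rw [h1]
  exact hInt (m + 1) hm

theorem exists_jet_of_sobolevNorm_lt {p δ : ℝ} {s : ℕ} {u : TensorSection (n := n) M r k}
    {c : ℝ≥0∞} (h : sobolevNorm o p s δ u < c) :
    ∃ D, IsWeakJet s u D ∧ jetNorm o p s δ D < c := by
  obtain ⟨D, hD⟩ := iInf_lt_iff.1 h
  obtain ⟨h1, h2⟩ := iInf_lt_iff.1 hD
  exact ⟨D, h1, h2⟩

/-- A bound for every jet passes to the infimum. Jets of infinite norm impose no condition because C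
> 0 makes C · ∞ = ∞. -/
theorem le_mul_sobolevNorm {p δ C : ℝ} {s : ℕ} {u : TensorSection (n := n) M r k} {X : ℝ≥0∞}
    (hC : 0 < C) (h : ∀ D N, IsWeakJet s u D → 0 ≤ N → jetNorm o p s δ D ≤ ENNReal.ofReal N →
      X ≤ ENNReal.ofReal (C * N)) : X ≤ ENNReal.ofReal C * sobolevNorm o p s δ u := by
  have hC0 : ENNReal.ofReal C ≠ 0 := by simpa using hC
  rw [mul_comm, ← ENNReal.div_le_iff hC0 ENNReal.ofReal_ne_top]
  refine le_iInf₂ fun D hD => ?_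
  change _ ≤ jetNorm o p s δ D
  rw [ENNReal.div_le_iff hC0 ENNReal.ofReal_ne_top, mul_comm]
  by_cases htop : jetNorm o p s δ D = ⊤
  · rw [htop, ENNReal.mul_top hC0]
    exact le_top
  · refine (h D (jetNorm o p s δ D).toReal hD ENNReal.toReal_nonneg ?_).trans (le_of_eq ?_)
    · rw [ENNReal.ofReal_toReal htop]
    · rw [ENNReal.ofReal_mul hC.le, ENNReal.ofReal_toReal htop]

end Norms

/-! ### The two compact embeddings -/

section Embedding

variable {n : ℕ} {M : Type*} [MetricSpace M] [ChartedSpace (Model n) M] [IsManifold (𝓡 n) ∞ M]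
  [RiemannianBundle (fun x : M => TangentSpace (𝓡 n) x)]
  [IsContMDiffRiemannianBundle (𝓡 n) ∞ (Model n) (fun x : M => TangentSpace (𝓡 n) x)]
  [IsRiemannianManifold (𝓡 n) M] [CompleteSpace M] [MeasurableSpace M] [BorelSpace M]
  {K : Set M} {N : ℕ} {R : Fin N → ℝ} {Φ : Fin N → OpenPartialHomeomorph M (Model n)}
  {ι : Type*} [Fintype ι] {r k : ι → ℕ} {p δ δ' : ℝ}

theorem IsEnds.exists_representative (h : IsEnds K R Φ) {o : M} (hp1 : 1 ≤ p) (hp : (n : ℝ) < p)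
    {B : ℝ} {u : TensorSection (n := n) M r k} {v : TensorSection (n := n) M r (fun j => k j + 1)}
    (huv : SobolevPair o p δ B u v) :
    ∃ w : TensorSection (n := n) M r k, IsCont w ∧ ∀ᵐ x ∂(riemVolume n M), u x = w x := by
  obtain ⟨w, hw, huw⟩ := huv.exists_isCont hp1 hp
  exact ⟨w, hw, h.ae_riemVolume huw⟩

theorem IsEnds.isCompactEmbedding_one (h : IsEnds K R Φ) (o : M) (hp1 : 1 ≤ p) (hp : (n : ℝ) < p)
    (hδ : δ' < δ) :
    IsCompactEmbedding (n := n) (M := M) (r := r) (k := k)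
      (sobolevNorm o p 1 δ) (weightedCNorm o 0 (δ' + n / p)) := by
  have hp0 : 0 < p := by linarith
  obtain ⟨Λ, hΛ⟩ := h.exists_goodBall o
  obtain ⟨C, hC0, hC⟩ := exists_pointNorm_le (r := r) (k := k) hp1 hp δ hΛ
  have hβ : δ' + n / p < δ + n / p := by linarith
  have hpair : ∀ {B : ℝ} {u : TensorSection (n := n) M r k} {D}, IsWeakJet 1 u D → 0 ≤ B →
      jetNorm o p 1 δ D ≤ ENNReal.ofReal B → SobolevPair o p δ B u (D 1) := by
    intro B u D hD hB hDB
    have := hD.sobolevPair hp0 hB hDB Nat.zero_lt_one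
    rw [Nat.cast_zero, zero_add, hD.1] at this
    exact this
  have hsup : ∀ {B : ℝ} {u w : TensorSection (n := n) M r k} {D}, IsWeakJet 1 u D → 0 ≤ B →
      jetNorm o p 1 δ D ≤ ENNReal.ofReal B → IsCont w → (∀ᵐ x ∂(riemVolume n M), u x = w x) →
      weightedCNorm o 0 (δ' + n / p) w ≤ ENNReal.ofReal (C * B) := by
    intro B u w D hD hB hDB hw huw
    exact (weightedCNorm_zero_le hw).trans
      (weightedSup_le hβ.le (by positivity) (hC B u w (D 1) (hpair hD hB hDB) hw huw))
  -- The `+ 1` provides the positive constant required by `le_mul_sobolevNorm`.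
  refine ⟨fun u hu => ?_, ⟨(C + 1).toNNReal, fun u v hu hv huv => ?_⟩, fun B u v hu hv huv => ?_⟩
  · obtain ⟨D, hD, hDt⟩ := exists_jet_of_sobolevNorm_lt hu
    have hDB := (ENNReal.ofReal_toReal hDt.ne).ge
    obtain ⟨w, hw, huw⟩ := h.exists_representative hp1 hp (hpair hD ENNReal.toReal_nonneg hDB)
    refine ⟨w, ⟨(hsup hD ENNReal.toReal_nonneg hDB hw huw).trans_lt ENNReal.ofReal_lt_top, huw⟩,
      fun w' hw' => ?_⟩
    refine (isCont_of_weightedCNorm_lt_top hw'.1).eq_of_ae_eq hw ?_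
    filter_upwards [hw'.2, huw] with x h1 h2
    rw [← h1, h2]
  · refine le_mul_sobolevNorm (C := C + 1) (by linarith) fun D A hD hA hDA => ?_
    refine (hsup hD hA hDA (isCont_of_weightedCNorm_lt_top hv) huv).trans
      (ENNReal.ofReal_le_ofReal ?_)
    nlinarith
  -- The infimum in the norm need not be attained; a strictly larger bound makes it possible to
  -- choose a jet for each `i`.
  · have hlt : ∀ i, sobolevNorm o p 1 δ (u i) < ENNReal.ofReal (B + 1) := fun i =>
      (hu i).trans_lt (by
        rw [← ENNReal.ofReal_coe_nnreal]
        exact (ENNReal.ofReal_lt_ofReal_iff (by positivity)).2 (by linarith))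
    choose D hD hDB using fun i => exists_jet_of_sobolevNorm_lt (hlt i)
    have hB : (0 : ℝ) ≤ B + 1 := by positivity
    have hP : ∀ i, SobolevPair o p δ (B + 1) (u i) (D i 1) := fun i =>
      hpair (hD i) hB (hDB i).le
    have hvc : ∀ i, IsCont (v i) := fun i => isCont_of_weightedCNorm_lt_top (hv i)
    obtain ⟨w, hw, -, ⟨A, hA⟩, hlim⟩ := (isEquicont_of_sobolevPair hp1 hp hP hvc huv).exists_weighted_limit
      (hyperfilter ℕ) hΛ (h.exists_compact_dist o)
      (fun i => hC (B + 1) (u i) (v i) (D i 1) (hP i) (hvc i) (huv i))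
    obtain ⟨θ, hθ, hlimθ⟩ := exists_subseq_of_tendsto_hyperfilter (hlim _ hβ)
    refine ⟨w, θ, (weightedCNorm_zero_le hw).trans_lt (weightedSup_lt_top hβ.le hA), hθ, ?_⟩
    exact tendsto_of_tendsto_of_tendsto_of_le_of_le tendsto_const_nhds hlimθ (fun _ => zero_le)
      fun i => weightedCNorm_zero_le ((hvc _).sub hw)

theorem IsEnds.isCompactEmbedding_two (h : IsEnds K R Φ) (o : M) (hp1 : 1 ≤ p) (hp : (n : ℝ) < p)
    (hδ : δ' < δ) :
    IsCompactEmbedding (n := n) (M := M) (r := r) (k := k)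
      (sobolevNorm o p 2 δ) (weightedCNorm o 1 (δ' + n / p)) := by
  have hp0 : 0 < p := by linarith
  obtain ⟨Λ, hΛ⟩ := h.exists_goodBall o
  obtain ⟨C, hC0, hC⟩ := exists_pointNorm_le (r := r) (k := k) hp1 hp δ hΛ
  obtain ⟨C', hC'0, hC'⟩ := exists_pointNorm_le (r := r) (k := fun j => k j + 1) hp1 hp (1 + δ) hΛ
  have hβ : δ' + n / p < δ + n / p := by linarith
  -- The derivative is measured with exponent (δ' + n/p) + 1, while Du, lying in the space of weight
  -- 1 + δ, decays with exponent 1 + δ + n/p; the gain δ - δ' is the same as for u.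
  have hβ' : δ' + n / p + 1 < 1 + δ + n / p := by linarith
  have hpair : ∀ {B : ℝ} {u : TensorSection (n := n) M r k} {D}, IsWeakJet 2 u D → 0 ≤ B →
      jetNorm o p 2 δ D ≤ ENNReal.ofReal B →
      SobolevPair o p δ B u (D 1) ∧ SobolevPair o p (1 + δ) B (D 1) (D 2) := by
    intro B u D hD hB hDB
    have h0 := hD.sobolevPair hp0 hB hDB Nat.zero_lt_two
    have h1 := hD.sobolevPair hp0 hB hDB Nat.one_lt_two
    rw [Nat.cast_zero, zero_add, hD.1] at h0
    rw [Nat.cast_one] at h1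
    exact ⟨h0, h1⟩
  have hderiv : ∀ {B : ℝ} {u w : TensorSection (n := n) M r k} {D}, IsWeakJet 2 u D → 0 ≤ B →
      jetNorm o p 2 δ D ≤ ENNReal.ofReal B → IsCont w → (∀ᵐ x ∂(riemVolume n M), u x = w x) →
      ∃ w' : TensorSection (n := n) M r (fun j => k j + 1), IsCont w' ∧
        (∀ᵐ x ∂(riemVolume n M), D 1 x = w' x) ∧ IsCovDeriv w w' := by
    intro B u w D hD hB hDB hw huw
    obtain ⟨h1, h2⟩ := hpair hD hB hDB
    obtain ⟨w', hw', hDw'⟩ := h.exists_representative hp1 hp h2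
    exact ⟨w', hw', hDw', h1.isCovDeriv hw hw' huw hDw'⟩
  have hsup : ∀ {B : ℝ} {u w : TensorSection (n := n) M r k} {D}, IsWeakJet 2 u D → 0 ≤ B →
      jetNorm o p 2 δ D ≤ ENNReal.ofReal B → IsCont w → (∀ᵐ x ∂(riemVolume n M), u x = w x) →
      weightedCNorm o 1 (δ' + n / p) w ≤ ENNReal.ofReal ((C + C') * B) := by
    intro B u w D hD hB hDB hw huw
    obtain ⟨w', hw', hDw', hww'⟩ := hderiv hD hB hDB hw huw
    obtain ⟨h1, h2⟩ := hpair hD hB hDB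
    refine (weightedCNorm_one_le hw hw' hww').trans ?_
    rw [add_mul, ENNReal.ofReal_add (by positivity) (by positivity)]
    exact add_le_add
      (weightedSup_le hβ.le (by positivity) (hC B u w (D 1) h1 hw huw))
      (weightedSup_le hβ'.le (by positivity) (hC' B (D 1) w' (D 2) h2 hw' hDw'))
  refine ⟨fun u hu => ?_, ⟨(C + C' + 1).toNNReal, fun u v hu hv huv => ?_⟩,
    fun B u v hu hv huv => ?_⟩
  · obtain ⟨D, hD, hDt⟩ := exists_jet_of_sobolevNorm_lt hu
    have hDB := (ENNReal.ofReal_toReal hDt.ne).ge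
    obtain ⟨w, hw, huw⟩ := h.exists_representative hp1 hp (hpair hD ENNReal.toReal_nonneg hDB).1
    refine ⟨w, ⟨(hsup hD ENNReal.toReal_nonneg hDB hw huw).trans_lt ENNReal.ofReal_lt_top, huw⟩,
      fun w' hw' => ?_⟩
    refine (isCont_of_weightedCNorm_lt_top hw'.1).eq_of_ae_eq hw ?_
    filter_upwards [hw'.2, huw] with x h1 h2
    rw [← h1, h2]
  · refine le_mul_sobolevNorm (C := C + C' + 1) (by linarith) fun D A hD hA hDA => ?_
    refine (hsup hD hA hDA (isCont_of_weightedCNorm_lt_top hv) huv).trans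
      (ENNReal.ofReal_le_ofReal ?_)
    nlinarith
  · have hlt : ∀ i, sobolevNorm o p 2 δ (u i) < ENNReal.ofReal (B + 1) := fun i =>
      (hu i).trans_lt (by
        rw [← ENNReal.ofReal_coe_nnreal]
        exact (ENNReal.ofReal_lt_ofReal_iff (by positivity)).2 (by linarith))
    choose D hD hDB using fun i => exists_jet_of_sobolevNorm_lt (hlt i)
    have hB : (0 : ℝ) ≤ B + 1 := by positivity
    have hP := fun i => hpair (hD i) hB (hDB i).le
    have hvc : ∀ i, IsCont (v i) := fun i => isCont_of_weightedCNorm_lt_top (hv i)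
    choose v' hv'c hDv' hvv' using fun i => hderiv (hD i) hB (hDB i).le (hvc i) (huv i)
    obtain ⟨w, hw, hloc, ⟨A, hA⟩, hlim⟩ := (isEquicont_of_sobolevPair hp1 hp (fun i => (hP i).1) hvc
      huv).exists_weighted_limit (hyperfilter ℕ) hΛ (h.exists_compact_dist o)
      (fun i => hC (B + 1) (u i) (v i) (D i 1) (hP i).1 (hvc i) (huv i))
    obtain ⟨w', hw', hloc', ⟨A', hA'⟩, hlim'⟩ := (isEquicont_of_sobolevPair hp1 hp
      (fun i => (hP i).2) hv'c hDv').exists_weighted_limit (hyperfilter ℕ) hΛ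
      (h.exists_compact_dist o)
      (fun i => hC' (B + 1) (D i 1) (v' i) (D i 2) (hP i).2 (hv'c i) (hDv' i))
    have hww' : IsCovDeriv w w' := IsCovDeriv.of_tendstoLocUnif hvv' hloc hloc'
    -- Both limits are taken along the same ultrafilter, so the sum tends to 0 there and a single
    -- subsequence serves the sections and their derivatives.
    have hadd := (hlim _ hβ).add (hlim' _ hβ')
    rw [add_zero] at hadd
    obtain ⟨θ, hθ, hlimθ⟩ := exists_subseq_of_tendsto_hyperfilter hadd
    refine ⟨w, θ, (weightedCNorm_one_le hw hw' hww').trans_lt (ENNReal.add_lt_top.2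
      ⟨weightedSup_lt_top hβ.le hA, weightedSup_lt_top hβ'.le hA'⟩), hθ, ?_⟩
    exact tendsto_of_tendsto_of_tendsto_of_le_of_le tendsto_const_nhds hlimθ (fun _ => zero_le)
      fun i => weightedCNorm_one_le ((hvc _).sub hw) ((hv'c _).sub hw') ((hvv' _).sub hww')

end Embedding

end EucInf

end

theorem mainTheorem9 {n : ℕ} (hn : 1 ≤ n)
    {M : Type*} [MetricSpace M] [ChartedSpace (EucInf.Model n) M] [IsManifold (𝓡 n) ∞ M]
    [RiemannianBundle (fun x : M => TangentSpace (𝓡 n) x)]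
    [IsContMDiffRiemannianBundle (𝓡 n) ∞ (EucInf.Model n) (fun x : M => TangentSpace (𝓡 n) x)]
    [IsRiemannianManifold (𝓡 n) M] [CompleteSpace M]
    [MeasurableSpace M] [BorelSpace M]
    (hM : EucInf.IsEuclideanAtInfinity n M) (o : M)
    {ι : Type*} [Fintype ι] (r k : ι → ℕ)
    (p : ℝ) (hp : (n : ℝ) < p) (δ δ' : ℝ) (hδ : δ' < δ) :
    EucInf.IsCompactEmbedding (n := n) (M := M) (r := r) (k := k)
      (EucInf.sobolevNorm o p 1 δ) (EucInf.weightedCNorm o 0 (δ' + n / p)) ∧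
    EucInf.IsCompactEmbedding (n := n) (M := M) (r := r) (k := k)
      (EucInf.sobolevNorm o p 2 δ) (EucInf.weightedCNorm o 1 (δ' + n / p)) := by
  obtain ⟨K, N, R, Φ, hK, hKc, -, hΦ⟩ := hM
  have h : EucInf.IsEnds K R Φ := ⟨hK, hKc, fun i => (hΦ i).1, fun i => (hΦ i).2.1,
    fun i => (hΦ i).2.2.1, fun i => (hΦ i).2.2.2⟩
  have hp1 : 1 ≤ p := le_trans (by exact_mod_cast hn) hp.le
  exact ⟨h.isCompactEmbedding_one o hp1 hp hδ, h.isCompactEmbedding_two o hp1 hp hδ⟩
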